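/- For integers $n\ge 0$ let $r_2(n)=\#\{(a,b)\in\mathbb{Z}^2: a^2+b^2=n\}$, let $\mu$ be the Möbius function, and for integers $m\ge1$ and $t\in\mathbb{R}$ put $$\phi_{1,m}(t)=-\frac{\sqrt2}{\pi}\,\frac{\mu^2(m)}{m}\sum_{k=1}^{\infty}\frac{r_2(mk^2)}{k^2}\cos(2\pi kt).$$ For $\alpha\in\mathbb{C}$, an integer $M\ge1$ and $X>0$ define $$\mathfrak{M}_X(\alpha;M)=\frac1X\int_X^{2X}\exp\Big(2\pi i\alpha\sum_{m\le M}\phi_{1,m}(\sqrt m\,x)\Big)dx,\qquad \Phi_{1,m}(\alpha)=\int_0^1\exp\big(2\pi i\alpha\,\phi_{1,m}(t)\big)dt,\qquad \mathfrak{M}(\alpha;M)=\prod_{m\le M}\Phi_{1,m}(\alpha).$$ (I) For every $\alpha\in\mathbb{C}$ and every integer $M\ge1$, $\lim_{X\to\infty}\mathfrak{M}_X(\alpha;M)=\mathfrak{M}(\alpha;M)$. The infinite product $\Phi_1(\alpha)=\prod_{m=1}^\infty\Phi_{1,m}(\alpha)$ converges absolutely and uniformly on every compact subset of the plane, and defines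 an entire function of $\alpha$. (II) The restriction of $\Phi_1$ to the real line is integrable, and its Fourier transform $\mathcal{P}_1(x)=\int_{-\infty}^{\infty}\Phi_1(\sigma)e^{-2\pi ix\sigma}\,d\sigma$ ($x\in\mathbb{R}$) is of class $C^\infty$ and is a probability density: it is real-valued, non-negative and integrable, with $\int_{-\infty}^\infty\mathcal{P}_1(x)\,dx=1$. (III) There are absolute constants $C_1>1$ and $c>0$ such that, with $\theta(x)=1-c/\log\log x$, both of the following estimates hold. For all $\alpha=\sigma+i\tau\in\mathbb{C}$ with $|\alpha|$ sufficiently large, $$|\Phi_1(\alpha)|\le\exp\Big(-\frac{\pi^2}{2}\big(C_1^{-1}\sigma^2-C_1\tau^2\big)|\alpha|^{-1/\theta(|\alpha|)}\log|\alpha|+C_1|\tau|\log|\alpha|\Big).$$ For every integer $j\ge0$ and all $x\in\mathbb{R}$ with $|x|$ sufficiently large in terms of $j$, $$\big|\mathcal{P}_1^{(j)}(x)\big|\le\exp\Big(-\frac{\pi}{2}|x|\exp(\rho|x|)\Big),\qquad \rho=\frac{\pi}{5C_1}.$$ -/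

import Mathlib

noncomputable section

namespace CyganKoranyi

/-- `r₂(n)`: the number of pairs `(a, b) ∈ ℤ²` with `a² + b² = n`. -/
def r2 (n : ℕ) : ℕ := Set.ncard {p : ℤ × ℤ | p.1 ^ 2 + p.2 ^ 2 = (n : ℤ)}

/-- `φ_{1,m}(t) = -(√2/π) (μ²(m)/m) ∑_{k ≥ 1} (r₂(m k²)/k²) cos(2π k t)`; the summation
variable `k : ℕ` below stands for `k - 1`. -/
def phi (m : ℕ) (t : ℝ) : ℝ :=
  -(Real.sqrt 2 / Real.pi) * ((ArithmeticFunction.moebius m : ℝ) ^ 2 / (m : ℝ)) *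
    ∑' k : ℕ, (r2 (m * (k + 1) ^ 2) : ℝ) / ((k : ℝ) + 1) ^ 2 *
      Real.cos (2 * Real.pi * ((k : ℝ) + 1) * t)

/-- `𝔐_X(α; M) = (1/X) ∫_X^{2X} exp(2πiα ∑_{1 ≤ m ≤ M} φ_{1,m}(√m x)) dx`. -/
def meanM (X : ℝ) (α : ℂ) (M : ℕ) : ℂ :=
  (1 / (X : ℂ)) * ∫ x in X..(2 * X),
    Complex.exp (2 * (Real.pi : ℂ) * Complex.I * α *
      ((∑ m ∈ Finset.Icc 1 M, phi m (Real.sqrt (m : ℝ) * x) : ℝ) : ℂ))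

/-- `Φ_{1,m}(α) = ∫_0^1 exp(2πiα φ_{1,m}(t)) dt`. -/
def PhiFactor (m : ℕ) (α : ℂ) : ℂ :=
  ∫ t in (0 : ℝ)..1, Complex.exp (2 * (Real.pi : ℂ) * Complex.I * α * (phi m t : ℂ))

/-- `𝔐(α; M) = ∏_{1 ≤ m ≤ M} Φ_{1,m}(α)`. -/
def limitM (α : ℂ) (M : ℕ) : ℂ := ∏ m ∈ Finset.Icc 1 M, PhiFactor m α

/-- `Φ₁(α) = ∏_{m ≥ 1} Φ_{1,m}(α)`; the index `m : ℕ` below stands for `m - 1`. -/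
def Phi1 (α : ℂ) : ℂ := ∏' m : ℕ, PhiFactor (m + 1) α

/-- `P₁(x) = ∫_ℝ Φ₁(σ) exp(-2πixσ) dσ`, the Fourier transform of `Φ₁` restricted to `ℝ`. -/
def P1 : ℝ → ℂ := FourierTransform.fourier (fun σ : ℝ => Phi1 (σ : ℂ))

/-- `θ(x) = 1 - c / log log x`. -/
def theta (c x : ℝ) : ℝ := 1 - c / Real.log (Real.log x)

end CyganKoranyi

end

/-! Arithmetic enters through `r₂(n) ≤ 4 d(n)`, a divisor bound with explicit constant, and the fact
that `r₂` is bounded above and below on average. Every positive integer is uniquely `m k²` with `m`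
squarefree, so sums over the Fourier coefficients of all the `φ_{1,m}` become sums over `n`.

Finite averages: the numbers `√m`, `m` squarefree, are linearly independent over `ℚ`
(`eq_zero_of_sum_int_mul_sqrt_eq_zero`). By Kronecker–Weyl (`tendsto_mean_torusFlow`) the phases `√m
x` behave like independent uniform variables mod 1, and the mean of the product becomes the product
of the means.

Infinite product: `φ_{1,m}` has mean zero, so `Φ_{1,m}(α) - 1` is quadratic in the coefficient sum
`phiBound m = O(m^(ε-1))`, whose squares are summable.

Growth (`exists_norm_Phi1_le`): write `α = σ + iτ`. For `m` well above `|α|`, a second-order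
expansion gives `|Φ_{1,m}(α)| ≤ exp(-π²σ²E + 3π²τ²E)` with `E = ∫ φ_{1,m}²`
(`norm_PhiFactor_le_exp_energy`). The `m` slightly above `|α|` already supply total energy
`|α|^(-1-o(1))`. The earlier factors cost at most `exp(O(|τ| log|α|))`, because `∑_{m ≤ Y} phiBound
m = O(log Y)`. All losses are bounded powers of `|α|^ε` with `ε = 2/log log|α|`, and `θ` absorbs
them.

Density: on horizontal strips `Φ₁` decays faster than any power, so `P₁` is smooth and its defining
integral may be moved to `Im α = ±exp(ρ|x|)`, which gives the doubly exponential decay. For real `σ`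
each factor is the characteristic function of `φ_{1,m}(t)`, `t` uniform, so multiplying by it
averages translates of a Fourier transform and preserves non-negativity (`P1_im_re`). Fourier
inversion at `0` and `Φ₁(0) = 1` give total mass one. -/

noncomputable section

open CyganKoranyi

/-! ### Gaussian integers and the bound of `r₂` by the divisor function -/

/-- The Gaussian integers of norm `n`. -/
def gaussNorm (n : ℕ) : Set GaussianInt := {z | z.norm = (n : ℤ)}

lemma gaussNorm_eq_image (n : ℕ) : gaussNorm n =
    (fun p : ℤ × ℤ => (⟨p.1, p.2⟩ : GaussianInt)) '' {p : ℤ × ℤ | p.1 ^ 2 + p.2 ^ 2 = (n : ℤ)} := by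
  ext z
  simp only [gaussNorm, Set.mem_ofPred_eq, Set.mem_image, Zsqrtd.norm_def]
  constructor
  · intro h
    exact ⟨(z.re, z.im), by simp only; linarith, rfl⟩
  · rintro ⟨p, hp, rfl⟩
    simp only; linarith

lemma r2_eq_ncard_gaussNorm (n : ℕ) : r2 n = (gaussNorm n).ncard := by
  rw [gaussNorm_eq_image, Set.ncard_image_of_injective, r2]
  rintro ⟨a, b⟩ ⟨c, d⟩ h
  simpa [Zsqrtd.ext_iff] using h

lemma finite_sq_add_sq (n : ℕ) : {p : ℤ × ℤ | p.1 ^ 2 + p.2 ^ 2 = (n : ℤ)}.Finite := by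
  refine Set.Finite.subset (Set.finite_Icc ((-n : ℤ), (-n : ℤ)) ((n : ℤ), (n : ℤ))) ?_
  rintro ⟨a, b⟩ h
  simp only [Set.mem_ofPred_eq] at h
  have ha : |a| ≤ n := by
    rw [← sq_abs a] at h
    nlinarith [sq_nonneg b, abs_nonneg a, Int.le_self_sq (|a|)]
  have hb : |b| ≤ n := by
    rw [← sq_abs b] at h
    nlinarith [sq_nonneg a, abs_nonneg b, Int.le_self_sq (|b|)]
  rw [abs_le] at ha hb
  exact ⟨⟨ha.1, hb.1⟩, ⟨ha.2, hb.2⟩⟩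

lemma finite_gaussNorm (n : ℕ) : (gaussNorm n).Finite := by
  rw [gaussNorm_eq_image]; exact (finite_sq_add_sq n).image _

/-- An element `w` of prime norm is itself prime. It divides `z * star z`, so `w` divides `z` or
`star w` does; each division lowers `k` by one. -/
lemma gaussNorm_mul_split {p : ℕ} (hp : p.Prime) {w : GaussianInt} (hw : w.norm = p) (n : ℕ) :
    ∀ (k : ℕ) (z : GaussianInt), z.norm = (p : ℤ) ^ k * n →
      ∃ j ≤ k, ∃ v : GaussianInt, v.norm = n ∧ z = w ^ j * (star w) ^ (k - j) * v := by
  have hwirr : Prime w := by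
    rw [← irreducible_iff_prime]
    have hwn : w.norm.natAbs = p := by rw [hw]; simp
    refine ⟨fun h => ?_, fun a b h => ?_⟩
    · rw [← Zsqrtd.norm_eq_one_iff, hwn] at h; exact hp.one_lt.ne' h
    · have : a.norm.natAbs * b.norm.natAbs = p := by
        rw [← Int.natAbs_mul, ← Zsqrtd.norm_mul, ← h, hwn]
      rcases (Nat.prime_mul_iff.1 (this ▸ hp)) with h | h
      · exact Or.inr (Zsqrtd.norm_eq_one_iff.1 h.2)
      · exact Or.inl (Zsqrtd.norm_eq_one_iff.1 h.2)
  intro k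
  induction k with
  | zero => intro z hz; exact ⟨0, le_rfl, z, by simpa using hz, by simp⟩
  | succ k ih =>
    intro z hz
    have hp0 : (p : ℤ) ≠ 0 := by exact_mod_cast hp.ne_zero
    have hdvd : w ∣ z * star z := by
      have h1 : (z * star z : GaussianInt) = ((z.norm : ℤ) : GaussianInt) :=
        (Zsqrtd.norm_eq_mul_conj z).symm
      have h2 : (w * star w : GaussianInt) = ((w.norm : ℤ) : GaussianInt) :=
        (Zsqrtd.norm_eq_mul_conj w).symm
      rw [h1, hz, pow_succ, mul_comm _ (p : ℤ), mul_assoc, Int.cast_mul, ← hw, ← h2, mul_assoc]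
      exact Dvd.intro _ rfl
    rcases hwirr.dvd_or_dvd hdvd with ⟨z', hz'⟩ | ⟨z', hz'⟩
    · have : z'.norm = (p : ℤ) ^ k * n := by
        rw [hz', Zsqrtd.norm_mul, hw, pow_succ] at hz
        apply mul_left_cancel₀ hp0; linarith
      obtain ⟨j, hj, v, hv, e⟩ := ih z' this
      refine ⟨j + 1, by omega, v, hv, ?_⟩
      rw [hz', e, show k + 1 - (j + 1) = k - j by omega]; ring
    · have hz2 : z = star w * star z' := by
        rw [← star_star z, hz', star_mul, mul_comm]
      have : (star z').norm = (p : ℤ) ^ k * n := by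
        rw [hz2, Zsqrtd.norm_mul, Zsqrtd.norm_conj, hw, pow_succ] at hz
        apply mul_left_cancel₀ hp0; linarith
      obtain ⟨j, hj, v, hv, e⟩ := ih _ this
      refine ⟨j, by omega, v, hv, ?_⟩
      rw [hz2, e, show k + 1 - j = (k - j) + 1 by omega]; ring

/-- Since `p` is prime and self-conjugate, `p ∣ z * star z` forces `p ∣ z`, which removes `p²` from
the norm. At `k = 1` the same division would give `p ∣ n`, so odd exponents do not occur. -/
lemma gaussNorm_mul_inert {p : ℕ} (hp : p.Prime) (hw : Prime (p : GaussianInt)) (n : ℕ)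
    (hn : ¬ p ∣ n) :
    ∀ (k : ℕ) (z : GaussianInt), z.norm = (p : ℤ) ^ k * n →
      ∃ v : GaussianInt, v.norm = n ∧ z = (p : GaussianInt) ^ (k / 2) * v := by
  have hp0 : (p : ℤ) ≠ 0 := by exact_mod_cast hp.ne_zero
  have key : ∀ (k : ℕ) (z : GaussianInt), z.norm = (p : ℤ) ^ (k + 1) * n →
      ∃ z' : GaussianInt, z = p * z' ∧ (p : ℤ) * z'.norm = (p : ℤ) ^ k * n := by
    intro k z hz
    have hdvd : (p : GaussianInt) ∣ z * star z := by
      have h1 : (z * star z : GaussianInt) = ((z.norm : ℤ) : GaussianInt) :=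
        (Zsqrtd.norm_eq_mul_conj z).symm
      rw [h1, hz, pow_succ, mul_comm _ (p : ℤ), mul_assoc, Int.cast_mul]
      rw [Int.cast_natCast]
      exact Dvd.intro _ rfl
    have hz' : (p : GaussianInt) ∣ z := by
      rcases hw.dvd_or_dvd hdvd with h | ⟨z', hz'⟩
      · exact h
      · refine ⟨star z', ?_⟩
        rw [← star_star z, hz', star_mul, mul_comm]; simp
    obtain ⟨z', rfl⟩ := hz'
    refine ⟨z', rfl, ?_⟩
    rw [Zsqrtd.norm_mul, Zsqrtd.norm_natCast, pow_succ] at hz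
    apply mul_left_cancel₀ hp0; linarith
  intro k
  induction k using Nat.twoStepInduction with
  | zero => intro z hz; exact ⟨z, by simpa using hz, by simp⟩
  | one =>
    intro z hz
    obtain ⟨z', -, h⟩ := key 0 z (by simpa using hz)
    exact absurd (by exact_mod_cast (Dvd.intro _ (by simpa using h) : (p : ℤ) ∣ n)) hn
  | more k ih _ =>
    intro z hz
    obtain ⟨z', rfl, h⟩ := key (k + 1) z hz
    have : z'.norm = (p : ℤ) ^ k * n := by
      rw [pow_succ] at h; apply mul_left_cancel₀ hp0; linarith
    obtain ⟨v, hv, e⟩ := ih z' this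
    refine ⟨v, hv, ?_⟩
    rw [e, show (k + 2) / 2 = k / 2 + 1 by omega]; ring

/-- In the split case the factor `k + 1` counts the exponents `j`. Only an upper bound is needed, so
the ramified prime `2` can be treated as split. -/
lemma ncard_gaussNorm_prime_pow_mul {p : ℕ} (hp : p.Prime) (k n : ℕ) (hn : ¬ p ∣ n) :
    (gaussNorm (p ^ k * n)).ncard ≤ (k + 1) * (gaussNorm n).ncard := by
  have := Fact.mk hp
  by_cases hpr : Prime (p : GaussianInt)
  · have : gaussNorm (p ^ k * n) ⊆ (fun v => (p : GaussianInt) ^ (k / 2) * v) '' gaussNorm n := by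
      intro z hz
      obtain ⟨v, hv, e⟩ := gaussNorm_mul_inert hp hpr n hn k z (by simpa [gaussNorm] using hz)
      exact ⟨v, hv, e.symm⟩
    calc _ ≤ _ := Set.ncard_le_ncard this ((finite_gaussNorm n).image _)
      _ ≤ _ := Set.ncard_image_le (finite_gaussNorm n)
      _ ≤ _ := Nat.le_mul_of_pos_left _ (by omega)
  · obtain ⟨a, b, hab⟩ := GaussianInt.sq_add_sq_of_nat_prime_of_not_irreducible p
      (fun h => hpr (irreducible_iff_prime.1 h))
    let w : GaussianInt := ⟨a, b⟩
    have hw : w.norm = p := by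
      simp only [w, Zsqrtd.norm_def, ← hab]; push_cast; ring
    have : gaussNorm (p ^ k * n) ⊆
        (fun q : ℕ × GaussianInt => w ^ q.1 * (star w) ^ (k - q.1) * q.2) ''
          (Set.Iic k ×ˢ gaussNorm n) := by
      intro z hz
      obtain ⟨j, hj, v, hv, e⟩ := gaussNorm_mul_split hp hw n k z (by simpa [gaussNorm] using hz)
      exact ⟨(j, v), ⟨hj, hv⟩, e.symm⟩
    have hf : (Set.Iic k ×ˢ gaussNorm n).Finite := (Set.finite_Iic k).prod (finite_gaussNorm n)
    calc _ ≤ _ := Set.ncard_le_ncard this (hf.image _)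
      _ ≤ _ := Set.ncard_image_le hf
      _ = _ := by
        rw [Set.ncard_prod]
        congr 1
        rw [← Finset.coe_Iic, Set.ncard_coe_finset, Nat.card_Iic]

lemma r2_one_le : r2 1 ≤ 4 := by
  have : {p : ℤ × ℤ | p.1 ^ 2 + p.2 ^ 2 = ((1 : ℕ) : ℤ)} ⊆
      (({(1, 0), (-1, 0), (0, 1), (0, -1)} : Finset (ℤ × ℤ)) : Set (ℤ × ℤ)) := by
    rintro ⟨a, b⟩ h
    simp only [Set.mem_ofPred_eq, Nat.cast_one] at h
    have ha : -1 ≤ a ∧ a ≤ 1 := by constructor <;> nlinarith [sq_nonneg b]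
    have hb : -1 ≤ b ∧ b ≤ 1 := by constructor <;> nlinarith [sq_nonneg a]
    obtain ⟨h1, h2⟩ := ha
    obtain ⟨h3, h4⟩ := hb
    interval_cases a <;> interval_cases b <;> simp_all
  refine (Set.ncard_le_ncard this (Finset.finite_toSet _)).trans ?_
  rw [Set.ncard_coe_finset]; exact Finset.card_le_four

theorem r2_le_four_mul_card_divisors (n : ℕ) (hn : n ≠ 0) : r2 n ≤ 4 * n.divisors.card := by
  induction n using Nat.recOnPrimePow with
  | zero => exact absurd rfl hn
  | one => simpa using r2_one_le
  | prime_pow_mul n p k hp hpn hk ih =>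
    have hn0 : n ≠ 0 := fun h => by simp [h] at hpn
    rw [r2_eq_ncard_gaussNorm]
    refine (ncard_gaussNorm_prime_pow_mul hp k n hpn).trans ?_
    have hc : Nat.Coprime (p ^ k) n :=
      Nat.Coprime.pow_left _ ((Nat.Prime.coprime_iff_not_dvd hp).2 hpn)
    rw [hc.card_divisors_mul, Nat.divisors_prime_pow hp, Finset.card_map, Finset.card_range,
      ← r2_eq_ncard_gaussNorm]
    calc (k + 1) * r2 n ≤ (k + 1) * (4 * n.divisors.card) := Nat.mul_le_mul_left _ (ih hn0)
      _ = _ := by ring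

/-! ### The divisor bound with explicit dependence on `ε` -/

/-- A constant `D(ε)` for which the divisor bound `d(n) ≤ D(ε) n ^ ε` holds. -/
def divisorConst (ε : ℝ) : ℝ := (1 + 2 / ε) ^ ((2 : ℝ) ^ (1 / ε))

lemma divisorConst_pos {ε : ℝ} (hε : 0 < ε) : 0 < divisorConst ε := by
  unfold divisorConst; positivity

lemma succ_le_mul_rpow_of_two_le {ε : ℝ} (hε : 0 < ε) {p : ℕ} (hp : 2 ≤ p) (a : ℕ) :
    (a : ℝ) + 1 ≤ (1 + 2 / ε) * ((p : ℝ) ^ a) ^ ε := by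
  have h1 : 1 + ε * a / 2 ≤ ((p : ℝ) ^ a) ^ ε := by
    calc 1 + ε * a / 2 ≤ Real.exp (ε * a / 2) := by
          have := Real.add_one_le_exp (ε * a / 2); linarith
      _ ≤ Real.exp (Real.log 2 * (a * ε)) := by
          apply Real.exp_le_exp.2
          have := Real.log_two_gt_d9
          have h0 : 0 ≤ (a : ℝ) * ε := by positivity
          nlinarith
      _ = (2 : ℝ) ^ ((a : ℝ) * ε) := by rw [Real.rpow_def_of_pos (by norm_num)]
      _ = ((2 : ℝ) ^ a) ^ ε := by rw [Real.rpow_mul (by norm_num), Real.rpow_natCast]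
      _ ≤ _ := by gcongr; exact_mod_cast hp
  have h2 : (a : ℝ) + 1 ≤ (1 + 2 / ε) * (1 + ε * a / 2) := by
    have : (1 + 2 / ε) * (1 + ε * a / 2) = 1 + a + ε * a / 2 + 2 / ε := by field_simp; ring
    rw [this]
    have : 0 ≤ ε * a / 2 + 2 / ε := by positivity
    linarith
  exact h2.trans (by gcongr)

lemma succ_le_rpow_of_large {ε : ℝ} (hε : 0 < ε) {p : ℕ} (hp : (2 : ℝ) ^ (1 / ε) ≤ p) (a : ℕ) :
    (a : ℝ) + 1 ≤ ((p : ℝ) ^ a) ^ ε := by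
  have h1 : (2 : ℝ) ≤ (p : ℝ) ^ ε := by
    calc (2 : ℝ) = ((2 : ℝ) ^ (1 / ε)) ^ ε := by
          rw [← Real.rpow_mul (by norm_num), one_div_mul_cancel hε.ne', Real.rpow_one]
      _ ≤ _ := by gcongr
  calc (a : ℝ) + 1 ≤ 2 ^ a := by exact_mod_cast Nat.lt_two_pow_self
    _ ≤ ((p : ℝ) ^ ε) ^ a := by gcongr
    _ = _ := by rw [← Real.rpow_natCast, ← Real.rpow_natCast, ← Real.rpow_mul (by positivity),
                  ← Real.rpow_mul (by positivity), mul_comm]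

/-- Compare prime by prime: a prime `p ≥ 2^(1/ε)` costs nothing, and each of the at most `2^(1/ε)`
smaller ones costs a factor `1 + 2/ε`. The constant is explicit because `ε` will later tend to zero
with `|α|`. -/
theorem card_divisors_le_mul_rpow {ε : ℝ} (hε : 0 < ε) {n : ℕ} (hn : n ≠ 0) :
    (n.divisors.card : ℝ) ≤ divisorConst ε * (n : ℝ) ^ ε := by
  set P : ℝ := (2 : ℝ) ^ (1 / ε) with hP
  have hP0 : 0 < P := by positivity
  set K : ℝ := 1 + 2 / ε with hK
  have hK1 : 1 ≤ K := by rw [hK]; have : 0 < 2 / ε := by positivity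
                         linarith
  have hn' : (n : ℝ) ^ ε = ∏ p ∈ n.primeFactors, ((p : ℝ) ^ n.factorization p) ^ ε := by
    rw [Real.finsetProd_rpow _ _ (fun i _ => by positivity)]
    congr 1
    conv_lhs => rw [← Nat.prod_factorization_pow_eq_self hn]
    rw [Finsupp.prod, Nat.support_factorization]
    push_cast; rfl
  rw [Nat.card_divisors hn, hn']
  push_cast
  calc ∏ p ∈ n.primeFactors, ((n.factorization p : ℝ) + 1)
      ≤ ∏ p ∈ n.primeFactors, ((if (p : ℝ) < P then K else 1) *
          ((p : ℝ) ^ n.factorization p) ^ ε) := by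
        apply Finset.prod_le_prod
        · intro p _; positivity
        · intro p hp
          split_ifs with h
          · exact succ_le_mul_rpow_of_two_le hε (Nat.prime_of_mem_primeFactors hp).two_le _
          · rw [one_mul]; exact succ_le_rpow_of_large hε (not_lt.1 h) _
    _ = (∏ p ∈ n.primeFactors, (if (p : ℝ) < P then K else 1)) * _ := Finset.prod_mul_distrib
    _ ≤ _ := by
        refine mul_le_mul_of_nonneg_right ?_ (Finset.prod_nonneg fun p _ => by positivity)
        rw [Finset.prod_ite, Finset.prod_const_one, mul_one, Finset.prod_const, divisorConst,
          ← Real.rpow_natCast]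
        apply Real.rpow_le_rpow_of_exponent_le hK1
        have hsub : n.primeFactors.filter (fun p : ℕ => (p : ℝ) < P) ⊆ Finset.Ioo 0 ⌈P⌉₊ := by
          intro p hp
          rw [Finset.mem_filter] at hp
          rw [Finset.mem_Ioo]
          exact ⟨(Nat.prime_of_mem_primeFactors hp.1).pos, Nat.lt_ceil.2 hp.2⟩
        have hc := Finset.card_le_card hsub
        rw [Nat.card_Ioo] at hc
        have h1 : ((⌈P⌉₊ - 0 - 1 : ℕ) : ℝ) ≤ P := by
          rw [Nat.sub_zero, Nat.cast_sub (Nat.ceil_pos.2 hP0)]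
          have := Nat.ceil_lt_add_one hP0.le
          push_cast; linarith
        exact (Nat.cast_le.2 hc).trans h1

lemma card_divisors_mul_le (a b : ℕ) :
    (a * b).divisors.card ≤ a.divisors.card * b.divisors.card := by
  rw [Nat.divisors_mul]; exact Finset.card_mul_le

/-! ### Fourier coefficients and their pointwise bounds -/

/-- The Fourier coefficient `r₂(m (k + 1)²) / (k + 1)²`. -/
def coef (m k : ℕ) : ℝ := (r2 (m * (k + 1) ^ 2) : ℝ) / ((k : ℝ) + 1) ^ 2

lemma coef_nonneg (m k : ℕ) : 0 ≤ coef m k := by unfold coef; positivity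

lemma summable_card_divisors_sq :
    Summable fun k : ℕ => ((k + 1).divisors.card : ℝ) ^ 2 / ((k : ℝ) + 1) ^ 2 := by
  have h : Summable fun k : ℕ => divisorConst (1 / 4) ^ 2 * (1 / ((k + 1 : ℕ) : ℝ) ^ (3 / 2 : ℝ)) :=
    (((Real.summable_one_div_nat_rpow (p := 3 / 2)).2 (by norm_num)).comp_injective
      (add_left_injective 1)).mul_left _
  refine Summable.of_nonneg_of_le (fun k => by positivity) (fun k => ?_) h
  have h1 := card_divisors_le_mul_rpow (ε := 1 / 4) (by norm_num) (Nat.succ_ne_zero k)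
  have hk : (0 : ℝ) < ((k + 1 : ℕ) : ℝ) := by positivity
  have e : ((k : ℝ) + 1) = ((k + 1 : ℕ) : ℝ) := (Nat.cast_succ k).symm
  rw [e, div_le_iff₀ (by positivity)]
  calc ((k + 1).divisors.card : ℝ) ^ 2
      ≤ (divisorConst (1 / 4) * ((k + 1 : ℕ) : ℝ) ^ (1 / 4 : ℝ)) ^ 2 := by gcongr
    _ = divisorConst (1 / 4) ^ 2 * (((k + 1 : ℕ) : ℝ) ^ (1 / 4 : ℝ)) ^ 2 := by ring
    _ = _ := by
      rw [mul_assoc]; congr 1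
      rw [one_div ((_ : ℝ) ^ _), ← Real.rpow_neg hk.le, ← Real.rpow_natCast, ← Real.rpow_natCast,
        ← Real.rpow_mul hk.le, ← Real.rpow_add hk]
      norm_num

lemma coef_le (m : ℕ) (hm : m ≠ 0) (k : ℕ) :
    coef m k ≤ 4 * m.divisors.card * (((k + 1).divisors.card : ℝ) ^ 2 / ((k : ℝ) + 1) ^ 2) := by
  unfold coef
  rw [← mul_div_assoc]
  apply div_le_div_of_nonneg_right _ (by positivity)
  have h1 := r2_le_four_mul_card_divisors (m * (k + 1) ^ 2) (by positivity)
  have h2 := card_divisors_mul_le m ((k + 1) ^ 2)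
  have h3 := card_divisors_mul_le (k + 1) (k + 1)
  rw [← sq] at h3
  have : r2 (m * (k + 1) ^ 2) ≤ 4 * m.divisors.card * (k + 1).divisors.card ^ 2 := by
    calc _ ≤ _ := h1
      _ ≤ 4 * (m.divisors.card * ((k + 1) ^ 2).divisors.card) := by gcongr
      _ ≤ 4 * (m.divisors.card * ((k + 1).divisors.card * (k + 1).divisors.card)) := by gcongr
      _ = _ := by ring
  exact_mod_cast this

lemma summable_coef (m : ℕ) : Summable (coef m) := by
  rcases eq_or_ne m 0 with rfl | hm
  · have : Summable fun k : ℕ => (r2 0 : ℝ) * (1 / ((k + 1 : ℕ) : ℝ) ^ (2 : ℝ)) :=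
      (((Real.summable_one_div_nat_rpow (p := 2)).2 (by norm_num)).comp_injective
        (add_left_injective 1)).mul_left _
    refine this.congr fun k => ?_
    simp [coef, div_eq_mul_inv]
  · exact Summable.of_nonneg_of_le (coef_nonneg m) (coef_le m hm)
      (summable_card_divisors_sq.mul_left _)

/-- The factor `μ²(m) / m`. -/
def weight (m : ℕ) : ℝ := (ArithmeticFunction.moebius m : ℝ) ^ 2 / (m : ℝ)

lemma weight_nonneg (m : ℕ) : 0 ≤ weight m := by unfold weight; positivity

lemma weight_of_squarefree {m : ℕ} (hm : Squarefree m) : weight m = 1 / m := by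
  unfold weight
  have : ((ArithmeticFunction.moebius m : ℤ) : ℝ) ^ 2 = 1 := by
    exact_mod_cast ArithmeticFunction.moebius_sq_eq_one_of_squarefree hm
  rw [this]

lemma weight_of_not_squarefree {m : ℕ} (hm : ¬ Squarefree m) : weight m = 0 := by
  simp [weight, ArithmeticFunction.moebius_eq_zero_of_not_squarefree hm]

lemma weight_le (m : ℕ) : weight m ≤ 1 / m := by
  by_cases h : Squarefree m
  · exact (weight_of_squarefree h).le
  · rw [weight_of_not_squarefree h]; positivity

/-- The sum of the absolute values of the Fourier coefficients of `φ_{1,m}`. -/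
def phiBound (m : ℕ) : ℝ := Real.sqrt 2 / Real.pi * weight m * ∑' k, coef m k

lemma phiBound_nonneg (m : ℕ) : 0 ≤ phiBound m :=
  mul_nonneg (mul_nonneg (by positivity) (weight_nonneg m)) (tsum_nonneg (coef_nonneg m))

lemma phiBound_of_not_squarefree {m : ℕ} (hm : ¬ Squarefree m) : phiBound m = 0 := by
  simp [phiBound, weight_of_not_squarefree hm]

/-- Submultiplicativity, `d(m k²) ≤ d(m) d(k)²`, separates `m` from `k`; the sum over `k` is then an
absolute constant. It matters that `C` does not depend on `ε`. -/
theorem exists_phiBound_le : ∃ C : ℝ, 0 < C ∧ ∀ ε : ℝ, 0 < ε → ∀ m : ℕ, m ≠ 0 →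
    phiBound m ≤ C * divisorConst ε * (m : ℝ) ^ (ε - 1) := by
  set c := ∑' k : ℕ, ((k + 1).divisors.card : ℝ) ^ 2 / ((k : ℝ) + 1) ^ 2 with hc
  have hc0 : 0 ≤ c := tsum_nonneg fun k => by positivity
  refine ⟨4 * (c + 1), by positivity, fun ε hε m hm => ?_⟩
  have hm' : (0 : ℝ) < m := by exact_mod_cast Nat.pos_of_ne_zero hm
  have h1 : ∑' k, coef m k ≤ 4 * m.divisors.card * c := by
    rw [hc, ← tsum_mul_left]
    exact (summable_coef m).tsum_le_tsum (coef_le m hm) (summable_card_divisors_sq.mul_left _)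
  have h2 := card_divisors_le_mul_rpow hε hm
  have hs : Real.sqrt 2 / Real.pi ≤ 1 := by
    rw [div_le_one Real.pi_pos]
    have : Real.sqrt 2 ≤ 2 := by rw [Real.sqrt_le_left (by norm_num)]; norm_num
    linarith [Real.pi_gt_three]
  have hD := divisorConst_pos hε
  calc phiBound m ≤ 1 * (1 / m) * (4 * m.divisors.card * c) := by
        unfold phiBound
        apply mul_le_mul _ h1 (tsum_nonneg (coef_nonneg m)) (by positivity)
        exact mul_le_mul hs (weight_le m) (weight_nonneg m) (by norm_num)
    _ ≤ (1 / m) * (4 * (divisorConst ε * (m : ℝ) ^ ε) * (c + 1)) := by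
        rw [one_mul]
        gcongr
        linarith
    _ = _ := by rw [Real.rpow_sub_one hm'.ne']; ring

/-- After division by the squared gcd, each of the coprime cofactors has its square dividing a
squarefree number. This serves both to reindex double sums by `n = m k²` and to distinguish the
fields `ℚ(√m)`. -/
lemma mul_sq_unique_of_squarefree {m m' k k' : ℕ} (hm : Squarefree m) (hm' : Squarefree m')
    (hk : k ≠ 0) (h : m * k ^ 2 = m' * k' ^ 2) : m = m' ∧ k = k' := by
  have hk' : k' ≠ 0 := by
    rintro rfl
    have := hm.ne_zero
    simp_all
  obtain ⟨g, a, b, hg, hab, rfl, rfl⟩ :=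
    Nat.exists_coprime' (Nat.gcd_pos_of_pos_left k' (Nat.pos_of_ne_zero hk))
  have h2 : m * a ^ 2 = m' * b ^ 2 := by
    have : 0 < g ^ 2 := by positivity
    apply Nat.eq_of_mul_eq_mul_right this
    linarith
  have hc : Nat.Coprime (a ^ 2) (b ^ 2) := Nat.Coprime.pow _ _ hab
  have ha : a = 1 := by
    have : a ^ 2 ∣ m' := hc.dvd_of_dvd_mul_right (h2 ▸ Dvd.intro_left m rfl)
    rw [sq] at this
    exact Nat.isUnit_iff.1 (hm' a this)
  have hb : b = 1 := by
    have : b ^ 2 ∣ m := hc.symm.dvd_of_dvd_mul_right (h2.symm ▸ Dvd.intro_left m' rfl)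
    rw [sq] at this
    exact Nat.isUnit_iff.1 (hm b this)
  subst ha; subst hb
  simpa using h2

/-! ### Lattice point counts and averages of `r₂` -/

/-- The lattice points in the disc of radius `√x`. -/
def discPoints (x : ℕ) : Finset (ℤ × ℤ) :=
  (Finset.Icc (-(Nat.sqrt x : ℤ)) (Nat.sqrt x) ×ˢ Finset.Icc (-(Nat.sqrt x : ℤ)) (Nat.sqrt x)).filter
    fun p => p.1 ^ 2 + p.2 ^ 2 ≤ (x : ℤ)

lemma abs_le_sqrt_of_sq_le {a : ℤ} {x : ℕ} (h : a ^ 2 ≤ x) : |a| ≤ Nat.sqrt x := by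
  rw [Int.abs_eq_natAbs]
  have : a.natAbs * a.natAbs ≤ x := by
    zify; rw [abs_mul_abs_self, ← sq]; exact h
  exact_mod_cast Nat.le_sqrt.2 this

lemma mem_discPoints {x : ℕ} {p : ℤ × ℤ} : p ∈ discPoints x ↔ p.1 ^ 2 + p.2 ^ 2 ≤ (x : ℤ) := by
  simp only [discPoints, Finset.mem_filter, Finset.mem_product, Finset.mem_Icc, ← abs_le,
    and_iff_right_iff_imp]
  intro h
  exact ⟨abs_le_sqrt_of_sq_le (by nlinarith [sq_nonneg p.2]),
    abs_le_sqrt_of_sq_le (by nlinarith [sq_nonneg p.1])⟩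

lemma sum_r2_eq_card (x : ℕ) : ∑ n ∈ Finset.range (x + 1), r2 n = (discPoints x).card := by
  rw [Finset.card_eq_sum_card_fiberwise (f := fun p : ℤ × ℤ => (p.1 ^ 2 + p.2 ^ 2).toNat)
    (t := Finset.range (x + 1))]
  · refine Finset.sum_congr rfl fun n hn => ?_
    rw [r2, ← Set.ncard_coe_finset]
    congr 1
    ext p
    simp only [Set.mem_ofPred_eq, Finset.coe_filter, mem_discPoints]
    rw [Finset.mem_range] at hn
    have : 0 ≤ p.1 ^ 2 + p.2 ^ 2 := by positivity
    omega
  · intro p hp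
    have := mem_discPoints.1 hp
    simp only [Finset.coe_range, Set.mem_Iio]
    omega

lemma sum_r2_le (x : ℕ) (hx : 1 ≤ x) : ∑ n ∈ Finset.range (x + 1), r2 n ≤ 9 * x := by
  rw [sum_r2_eq_card]
  refine (Finset.card_filter_le _ _).trans ?_
  rw [Finset.card_product, Int.card_Icc]
  have h1 : 1 ≤ Nat.sqrt x := Nat.le_sqrt.2 (by simpa using hx)
  have h2 := Nat.sqrt_le x
  have : ((Nat.sqrt x : ℤ) + 1 - -(Nat.sqrt x : ℤ)).toNat = 2 * Nat.sqrt x + 1 := by omega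
  rw [this]
  nlinarith

/-- The square `[0, b]²` with `b = ⌊√(x/2)⌋` lies inside the disc. -/
lemma le_sum_r2 (x : ℕ) : x / 2 + 1 ≤ ∑ n ∈ Finset.range (x + 1), r2 n := by
  rw [sum_r2_eq_card]
  set b := Nat.sqrt (x / 2)
  have h1 : x / 2 + 1 ≤ (b + 1) * (b + 1) := Nat.succ_le_of_lt (Nat.lt_succ_sqrt _)
  have hb : b * b ≤ x / 2 := Nat.sqrt_le _
  have : (Finset.Icc (0 : ℤ) b ×ˢ Finset.Icc (0 : ℤ) b).card = (b + 1) * (b + 1) := by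
    rw [Finset.card_product, Int.card_Icc]
    congr 1
  rw [← this] at h1
  refine h1.trans (Finset.card_le_card ?_)
  intro p hp
  rw [Finset.mem_product, Finset.mem_Icc, Finset.mem_Icc] at hp
  rw [mem_discPoints]
  have h2 : (b : ℤ) * b * 2 ≤ x := by
    have : b * b * 2 ≤ x := by omega
    exact_mod_cast this
  nlinarith

/-- Each dyadic block `[2^J, 2^(J+1))` contributes at most `9 · 2^(J+1) / 2^J = 18`. -/
lemma sum_r2_div_le (J : ℕ) : ∑ n ∈ Finset.Ico 1 (2 ^ J), (r2 n : ℝ) / n ≤ 18 * J := by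
  induction J with
  | zero => simp
  | succ J ih =>
    have hJ : 1 ≤ 2 ^ J := Nat.one_le_two_pow
    rw [← Finset.sum_Ico_consecutive _ hJ (Nat.pow_le_pow_right (by norm_num) (Nat.le_succ J))]
    have h1 : ∑ n ∈ Finset.Ico (2 ^ J) (2 ^ (J + 1)), (r2 n : ℝ) / n ≤ 18 := by
      calc _ ≤ ∑ n ∈ Finset.Ico (2 ^ J) (2 ^ (J + 1)), (r2 n : ℝ) / 2 ^ J := by
            refine Finset.sum_le_sum fun n hn => ?_
            have := (Finset.mem_Ico.1 hn).1
            gcongr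
            exact_mod_cast this
        _ = ((∑ n ∈ Finset.Ico (2 ^ J) (2 ^ (J + 1)), r2 n : ℕ) : ℝ) / 2 ^ J := by
            rw [← Finset.sum_div]; push_cast; rfl
        _ ≤ (9 * 2 ^ (J + 1) : ℕ) / 2 ^ J := by
            gcongr
            refine le_trans (Finset.sum_le_sum_of_subset ?_)
              (sum_r2_le (2 ^ (J + 1)) Nat.one_le_two_pow)
            intro n hn
            rw [Finset.mem_Ico] at hn
            rw [Finset.mem_range]; omega
        _ = 18 := by
            push_cast
            rw [pow_succ]; field_simp; norm_num
    push_cast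
    linarith

/-- The pairs `(m, k)` with `m` squarefree in `[1, Y]` and `k < K`. -/
def corePairs (Y K : ℕ) : Finset (ℕ × ℕ) :=
  (Finset.Icc 1 Y).filter Squarefree ×ˢ Finset.range K

lemma corePairs_injOn (Y K : ℕ) :
    Set.InjOn (fun q : ℕ × ℕ => q.1 * (q.2 + 1) ^ 2) (corePairs Y K : Set (ℕ × ℕ)) := by
  rintro ⟨m, k⟩ h ⟨m', k'⟩ h' e
  simp only [corePairs, Finset.coe_product, Set.mem_prod, Finset.coe_filter, Set.mem_ofPred_eq] at h h'
  obtain ⟨h1, h2⟩ := mul_sq_unique_of_squarefree h.1.2 h'.1.2 (Nat.succ_ne_zero k) e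
  simp only [Prod.mk.injEq]
  omega

/-- The products `n = m (k+1)²` are distinct and at most `Y · Y²`, and each term on the left is
`r₂(n)/n`. -/
lemma sum_weight_coef_le (Y : ℕ) :
    ∑ m ∈ (Finset.Icc 1 Y).filter Squarefree, (1 / (m : ℝ)) * ∑ k ∈ Finset.range Y, coef m k ≤
      ∑ n ∈ Finset.Icc 1 (Y ^ 3), (r2 n : ℝ) / n := by
  have : ∑ m ∈ (Finset.Icc 1 Y).filter Squarefree, (1 / (m : ℝ)) * ∑ k ∈ Finset.range Y, coef m k =
      ∑ q ∈ corePairs Y Y, (r2 (q.1 * (q.2 + 1) ^ 2) : ℝ) / ((q.1 * (q.2 + 1) ^ 2 : ℕ) : ℝ) := by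
    rw [corePairs, Finset.sum_product]
    refine Finset.sum_congr rfl fun m _ => ?_
    rw [Finset.mul_sum]
    refine Finset.sum_congr rfl fun k _ => ?_
    rw [coef]; push_cast
    rw [div_mul_div_comm, one_mul]
  rw [this, ← Finset.sum_image (g := fun q : ℕ × ℕ => q.1 * (q.2 + 1) ^ 2)
    (f := fun n : ℕ => (r2 n : ℝ) / (n : ℝ)) (corePairs_injOn Y Y)]
  refine Finset.sum_le_sum_of_subset_of_nonneg ?_ fun n _ _ => by positivity
  intro n hn
  obtain ⟨⟨m, k⟩, hq, rfl⟩ := Finset.mem_image.1 hn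
  simp only [corePairs, Finset.mem_product, Finset.mem_filter, Finset.mem_Icc, Finset.mem_range] at hq
  rw [Finset.mem_Icc]
  constructor
  · have := hq.1.1.1; have : 0 < m * (k + 1) ^ 2 := by positivity
    exact this
  · calc m * (k + 1) ^ 2 ≤ Y * Y ^ 2 :=
        Nat.mul_le_mul hq.1.1.2 (Nat.pow_le_pow_left hq.2 2)
      _ = Y ^ 3 := by ring

/-- With `K = k + 1` the divisor bound leaves `m^(-7/8) K^(-7/4)`. Since `K ≥ m`, a factor
`K^(-1/2)` may be traded for `m^(-1/2)`, which makes both exponents summable. -/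
lemma coef_tail_le {m k : ℕ} (hm : m ≠ 0) (hmk : m ≤ k + 1) :
    (1 / (m : ℝ)) * coef m k ≤ 4 * divisorConst (1 / 8) *
      ((1 / (m : ℝ) ^ (11 / 8 : ℝ)) * (1 / ((k + 1 : ℕ) : ℝ) ^ (5 / 4 : ℝ))) := by
  have hm' : (0 : ℝ) < m := by exact_mod_cast Nat.pos_of_ne_zero hm
  set K : ℝ := ((k + 1 : ℕ) : ℝ) with hK
  have hK0 : 0 < K := by positivity
  have hmK : (m : ℝ) ≤ K := Nat.cast_le.2 hmk
  have h0 : m * (k + 1) ^ 2 ≠ 0 := by positivity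
  have h1 : (r2 (m * (k + 1) ^ 2) : ℝ) ≤ 4 * (divisorConst (1 / 8) * (m * K ^ 2) ^ (1 / 8 : ℝ)) := by
    have h2 := card_divisors_le_mul_rpow (ε := 1 / 8) (by norm_num) h0
    have h3 : (r2 (m * (k + 1) ^ 2) : ℝ) ≤ 4 * ((m * (k + 1) ^ 2).divisors.card : ℝ) := by
      exact_mod_cast r2_le_four_mul_card_divisors _ h0
    have e : ((m * (k + 1) ^ 2 : ℕ) : ℝ) = m * K ^ 2 := by push_cast [hK]; ring
    rw [e] at h2
    linarith
  have hD := divisorConst_pos (ε := 1 / 8) (by norm_num)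
  have e : coef m k = (r2 (m * (k + 1) ^ 2) : ℝ) / K ^ 2 := by rw [coef, hK]; push_cast; rfl
  rw [e]
  calc (1 / (m : ℝ)) * ((r2 (m * (k + 1) ^ 2) : ℝ) / K ^ 2)
      ≤ (1 / (m : ℝ)) * ((4 * (divisorConst (1 / 8) * (m * K ^ 2) ^ (1 / 8 : ℝ))) / K ^ 2) := by
        gcongr
    _ = 4 * divisorConst (1 / 8) * ((m : ℝ) ^ (-7 / 8 : ℝ) * (K ^ (-5 / 4 : ℝ) * K ^ (-1 / 2 : ℝ))) := by
        have e1 : (m : ℝ) ^ (-7 / 8 : ℝ) = (m : ℝ) ^ (1 / 8 : ℝ) / m := by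
          rw [← Real.rpow_sub_one hm'.ne']; norm_num
        have e2 : K ^ (-5 / 4 : ℝ) * K ^ (-1 / 2 : ℝ) = (K ^ 2) ^ (1 / 8 : ℝ) / K ^ 2 := by
          rw [← Real.rpow_add hK0, ← Real.rpow_natCast, ← Real.rpow_mul hK0.le, ← Real.rpow_sub hK0]
          norm_num
        rw [e1, e2, Real.mul_rpow hm'.le (by positivity)]
        ring
    _ ≤ 4 * divisorConst (1 / 8) * ((m : ℝ) ^ (-7 / 8 : ℝ) * (K ^ (-5 / 4 : ℝ) * (m : ℝ) ^ (-1 / 2 : ℝ))) := by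
        gcongr 4 * divisorConst (1 / 8) * (_ * (_ * ?_))
        exact Real.rpow_le_rpow_of_nonpos hm' hmK (by norm_num)
    _ = _ := by
        have e1 : (m : ℝ) ^ (-7 / 8 : ℝ) * (m : ℝ) ^ (-1 / 2 : ℝ) = 1 / (m : ℝ) ^ (11 / 8 : ℝ) := by
          rw [← Real.rpow_add hm', one_div, ← Real.rpow_neg hm'.le]; norm_num
        have e2 : K ^ (-5 / 4 : ℝ) = 1 / K ^ (5 / 4 : ℝ) := by
          rw [one_div, ← Real.rpow_neg hK0.le]; norm_num
        rw [← e1, ← e2]; ring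

/-- Terms with `k < Y` are controlled by the average of `r₂` up to `Y³`, the others by
`coef_tail_le`. Summing the pointwise bound would lose a power of `Y`; the logarithm is what the
term `C₁|τ| log|α|` requires. -/
theorem exists_sum_phiBound_le : ∃ C : ℝ, 0 < C ∧ ∀ Y : ℕ, 2 ≤ Y →
    ∑ m ∈ Finset.Icc 1 Y, phiBound m ≤ C * Real.log Y := by
  set D := 4 * divisorConst (1 / 8) with hD
  have hD0 : 0 < D := by have := divisorConst_pos (ε := 1 / 8) (by norm_num); positivity
  have hs1 : Summable fun m : ℕ => 1 / (m : ℝ) ^ (11 / 8 : ℝ) :=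
    Real.summable_one_div_nat_rpow.2 (by norm_num)
  have hs2 : Summable fun k : ℕ => 1 / ((k + 1 : ℕ) : ℝ) ^ (5 / 4 : ℝ) :=
    (Real.summable_one_div_nat_rpow.2 (by norm_num)).comp_injective (add_left_injective 1)
  set c1 := ∑' m : ℕ, 1 / (m : ℝ) ^ (11 / 8 : ℝ)
  set c2 := ∑' k : ℕ, 1 / ((k + 1 : ℕ) : ℝ) ^ (5 / 4 : ℝ)
  have hc1 : 0 ≤ c1 := tsum_nonneg fun m => by positivity
  have hc2 : 0 ≤ c2 := tsum_nonneg fun m => by positivity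
  -- `162 = 18 · 3 · 3`: `18` per dyadic block, `J = 3 (log₂ Y + 1)` blocks up to `Y³`, and `log₂ Y
  -- + 1 ≤ 3 log Y`. The factor `2` covers `1 ≤ 2 log Y`.
  refine ⟨162 + 2 * (D * (c1 * c2)), by positivity, fun Y hY => ?_⟩
  have hlog2 := Real.log_two_gt_d9
  have hlogY : Real.log 2 ≤ Real.log Y := Real.log_le_log (by norm_num) (by exact_mod_cast hY)
  have hhead : ∑ n ∈ Finset.Icc 1 (Y ^ 3), (r2 n : ℝ) / n ≤ 162 * Real.log Y := by
    set J := 3 * (Nat.log 2 Y + 1)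
    have hlt : Y ^ 3 < 2 ^ J := by
      have := Nat.lt_pow_succ_log_self (b := 2) (by norm_num) Y
      calc Y ^ 3 < (2 ^ (Nat.log 2 Y + 1)) ^ 3 := Nat.pow_lt_pow_left this (by norm_num)
        _ = _ := by rw [← pow_mul, mul_comm]
    have h1 : ∑ n ∈ Finset.Icc 1 (Y ^ 3), (r2 n : ℝ) / n ≤ 18 * J := by
      refine le_trans (Finset.sum_le_sum_of_subset_of_nonneg ?_ fun n _ _ => by positivity)
        (sum_r2_div_le J)
      intro n hn
      rw [Finset.mem_Icc] at hn
      rw [Finset.mem_Ico]; omega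
    have h2 : (Nat.log 2 Y : ℝ) * Real.log 2 ≤ Real.log Y := by
      rw [← Real.log_pow]
      apply Real.log_le_log (by positivity)
      exact_mod_cast Nat.pow_log_le_self 2 (by omega)
    have h3 : (Nat.log 2 Y : ℝ) + 1 ≤ 3 * Real.log Y := by nlinarith
    have hJ : (J : ℝ) = 3 * ((Nat.log 2 Y : ℝ) + 1) := by simp [J]
    rw [hJ] at h1
    linarith
  have hsplit : ∀ m ∈ (Finset.Icc 1 Y).filter Squarefree, phiBound m ≤
      (1 / (m : ℝ)) * ∑ k ∈ Finset.range Y, coef m k + D * ((1 / (m : ℝ) ^ (11 / 8 : ℝ)) * c2) := by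
    intro m hm
    rw [Finset.mem_filter, Finset.mem_Icc] at hm
    have hs : Real.sqrt 2 / Real.pi ≤ 1 := by
      rw [div_le_one Real.pi_pos]
      have : Real.sqrt 2 ≤ 2 := by rw [Real.sqrt_le_left (by norm_num)]; norm_num
      linarith [Real.pi_gt_three]
    have h1 : phiBound m ≤ (1 / (m : ℝ)) * ∑' k, coef m k := by
      rw [phiBound, weight_of_squarefree hm.2]
      apply mul_le_mul_of_nonneg_right _ (tsum_nonneg (coef_nonneg m))
      exact mul_le_of_le_one_left (by positivity) hs
    refine h1.trans ?_
    rw [← (summable_coef m).sum_add_tsum_nat_add Y, mul_add]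
    refine add_le_add le_rfl ?_
    rw [← tsum_mul_left, ← tsum_mul_left, ← tsum_mul_left]
    have hsum : Summable fun k : ℕ => D * (1 / (m : ℝ) ^ (11 / 8 : ℝ) * (1 / ((k + 1 : ℕ) : ℝ) ^ (5 / 4 : ℝ))) :=
      (hs2.mul_left _).mul_left _
    calc ∑' k, 1 / (m : ℝ) * coef m (k + Y)
        ≤ ∑' k, (D * (1 / (m : ℝ) ^ (11 / 8 : ℝ) * (1 / ((k + Y + 1 : ℕ) : ℝ) ^ (5 / 4 : ℝ)))) := by
          refine Summable.tsum_le_tsum (fun k => ?_) ?_ ?_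
          · exact coef_tail_le (by omega) (by omega)
          · exact ((summable_nat_add_iff Y).2 (summable_coef m)).mul_left _
          · exact (summable_nat_add_iff Y).2 hsum
      _ ≤ _ := by
          rw [← hsum.sum_add_tsum_nat_add Y]
          exact le_add_of_nonneg_left (Finset.sum_nonneg fun k _ => by positivity)
  have htot : ∑ m ∈ Finset.Icc 1 Y, phiBound m = ∑ m ∈ (Finset.Icc 1 Y).filter Squarefree, phiBound m := by
    rw [Finset.sum_filter]
    refine Finset.sum_congr rfl fun m _ => ?_
    split_ifs with h
    · rfl
    · exact phiBound_of_not_squarefree h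
  rw [htot]
  refine (Finset.sum_le_sum hsplit).trans ?_
  rw [Finset.sum_add_distrib, ← Finset.mul_sum, ← Finset.sum_mul]
  have h4 : ∑ m ∈ (Finset.Icc 1 Y).filter Squarefree, 1 / (m : ℝ) ^ (11 / 8 : ℝ) ≤ c1 :=
    hs1.sum_le_tsum _ fun m _ => by positivity
  have h5 : D * ((∑ m ∈ (Finset.Icc 1 Y).filter Squarefree, 1 / (m : ℝ) ^ (11 / 8 : ℝ)) * c2) ≤
      D * (c1 * c2) := by gcongr
  have h6 := (sum_weight_coef_le Y).trans hhead
  have h7 : D * (c1 * c2) ≤ 2 * (D * (c1 * c2)) * Real.log Y := by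
    have : 0 ≤ D * (c1 * c2) := by positivity
    nlinarith
  linarith

lemma sum_inv_sqrt_le (Y : ℕ) : ∑ m ∈ Finset.Icc 1 Y, 1 / Real.sqrt m ≤ 2 * Real.sqrt Y := by
  induction Y with
  | zero => simp
  | succ Y ih =>
    rw [Finset.sum_Icc_succ_top (by omega)]
    have h1 : 1 / Real.sqrt ((Y + 1 : ℕ) : ℝ) ≤ 2 * (Real.sqrt ((Y + 1 : ℕ) : ℝ) - Real.sqrt Y) := by
      have hs : 0 < Real.sqrt ((Y + 1 : ℕ) : ℝ) := Real.sqrt_pos.2 (by positivity)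
      rw [div_le_iff₀ hs]
      have e1 : Real.sqrt ((Y + 1 : ℕ) : ℝ) ^ 2 = Y + 1 := by rw [Real.sq_sqrt (by positivity)]; push_cast; ring
      have e2 : Real.sqrt (Y : ℝ) ^ 2 = Y := Real.sq_sqrt (by positivity)
      nlinarith [sq_nonneg (Real.sqrt ((Y + 1 : ℕ) : ℝ) - Real.sqrt Y)]
    linarith

lemma r2_zero_le : r2 0 ≤ 1 := by
  have : {p : ℤ × ℤ | p.1 ^ 2 + p.2 ^ 2 = ((0 : ℕ) : ℤ)} ⊆ {(0, 0)} := by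
    rintro ⟨a, b⟩ h
    simp only [Set.mem_ofPred_eq, Nat.cast_zero] at h
    have ha : a = 0 := by nlinarith [sq_nonneg a, sq_nonneg b]
    have hb : b = 0 := by nlinarith [sq_nonneg a, sq_nonneg b]
    simp [ha, hb]
  exact (Set.ncard_le_ncard this).trans (Set.ncard_singleton _).le

/-- Each `n = m (k+1)² ≤ N` contributes `(r₂(n)/n)² ≥ r₂(n)/N²`, and the `r₂(n)` sum to at least
`N/2 - 1`. The discarded `n` with squarefree part at most `Y` number at most `∑_{m ≤ Y} √(N/m) ≤ 2
√(NY)`, each with `r₂(n) ≤ Q`. -/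
theorem le_sum_weight_sq_coef_sq (Y N : ℕ) (hN : 0 < N) (Q : ℝ)
    (hQ : ∀ n, 1 ≤ n → n ≤ N → (r2 n : ℝ) ≤ Q) :
    ((N : ℝ) / 2 - 1 - 2 * Q * (Real.sqrt N * Real.sqrt Y)) / (N : ℝ) ^ 2 ≤
      ∑ m ∈ Finset.Ioc Y N, weight m ^ 2 * ∑ k ∈ Finset.range N, coef m k ^ 2 := by
  have hQ0 : 0 ≤ Q := le_trans (Nat.cast_nonneg _) (hQ 1 le_rfl hN)
  let f : ℕ × ℕ → ℕ := fun q => q.1 * (q.2 + 1) ^ 2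
  set P := (corePairs N N).filter fun q => f q ≤ N with hP
  have htotal : ((N : ℝ) / 2 - 1) ≤ ∑ q ∈ P, (r2 (f q) : ℝ) := by
    rw [← Finset.sum_image (g := f) (f := fun n : ℕ => (r2 n : ℝ))
      ((corePairs_injOn N N).mono (Finset.coe_subset.2 (Finset.filter_subset _ _)))]
    have h1 : ∑ n ∈ Finset.Icc 1 N, (r2 n : ℝ) ≤ ∑ n ∈ P.image f, (r2 n : ℝ) := by
      refine Finset.sum_le_sum_of_subset_of_nonneg ?_ fun n _ _ => by positivity
      intro n hn
      rw [Finset.mem_Icc] at hn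
      obtain ⟨m, k, h, hsq⟩ := Nat.sq_mul_squarefree n
      have hk0 : k ≠ 0 := by rintro rfl; simp at h; omega
      have hm0 : m ≠ 0 := hsq.ne_zero
      rw [Finset.mem_image]
      refine ⟨(m, k - 1), ?_, ?_⟩
      · have e : k - 1 + 1 = k := by omega
        have e2 : m * k ^ 2 = n := by rw [mul_comm]; exact h
        have hm1 : m ≤ n := by rw [← e2]; exact Nat.le_mul_of_pos_right _ (by positivity)
        have hk1 : k ≤ n := by
          rw [← e2]; calc k ≤ k ^ 2 := Nat.le_self_pow (by norm_num) k
            _ ≤ _ := Nat.le_mul_of_pos_left _ (by omega)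
        simp only [hP, corePairs, Finset.mem_filter, Finset.mem_product, Finset.mem_Icc,
          Finset.mem_range, f, e, e2]
        exact ⟨⟨⟨⟨by omega, by omega⟩, hsq⟩, by omega⟩, hn.2⟩
      · simp only [f]
        rw [show k - 1 + 1 = k by omega, mul_comm]; exact h
    have h2 := le_sum_r2 N
    rw [Finset.sum_range_succ', ] at h2
    have h3 : ∑ n ∈ Finset.Icc 1 N, r2 n = ∑ n ∈ Finset.range N, r2 (n + 1) := by
      rw [Finset.range_eq_Ico, Finset.sum_Ico_add' (fun n => r2 n) 0 N 1]
      rfl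
    rw [← h3] at h2
    have h4 := r2_zero_le
    have h5 : N / 2 ≤ ∑ n ∈ Finset.Icc 1 N, r2 n := by omega
    have h6 : (N : ℝ) / 2 - 1 ≤ ((N / 2 : ℕ) : ℝ) := by
      have : N ≤ 2 * (N / 2) + 1 := by omega
      have : (N : ℝ) ≤ 2 * ((N / 2 : ℕ) : ℝ) + 1 := by exact_mod_cast this
      linarith
    have h7 : ((N / 2 : ℕ) : ℝ) ≤ ∑ n ∈ Finset.Icc 1 N, (r2 n : ℝ) := by exact_mod_cast h5
    linarith
  have hsplit : ∑ q ∈ P, (r2 (f q) : ℝ) =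
      ∑ q ∈ P.filter (fun q => q.1 ≤ Y), (r2 (f q) : ℝ) +
        ∑ q ∈ P.filter (fun q => ¬ q.1 ≤ Y), (r2 (f q) : ℝ) :=
    (Finset.sum_filter_add_sum_filter_not _ _ _).symm
  have hbad : ∑ q ∈ P.filter (fun q => q.1 ≤ Y), (r2 (f q) : ℝ) ≤
      2 * Q * (Real.sqrt N * Real.sqrt Y) := by
    have hQ' : ∀ q ∈ P.filter (fun q => q.1 ≤ Y), (r2 (f q) : ℝ) ≤ Q := by
      intro q hq
      simp only [hP, corePairs, Finset.mem_filter, Finset.mem_product, Finset.mem_Icc] at hq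
      refine hQ _ ?_ hq.1.2
      have := hq.1.1.1.1.1
      have : 0 < q.1 * (q.2 + 1) ^ 2 := by positivity
      exact this
    have hsub : P.filter (fun q => q.1 ≤ Y) ⊆
        ((Finset.Icc 1 Y).sigma (fun m => Finset.range (Nat.sqrt (N / m)))).map
          (Equiv.sigmaEquivProd ℕ ℕ).toEmbedding := by
      rintro ⟨m, k⟩ hq
      simp only [hP, corePairs, Finset.mem_filter, Finset.mem_product, Finset.mem_Icc, f] at hq
      simp only [Finset.mem_map, Finset.mem_sigma, Finset.mem_Icc, Finset.mem_range]
      refine ⟨⟨m, k⟩, ⟨⟨hq.1.1.1.1.1, hq.2⟩, ?_⟩, rfl⟩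
      rw [Nat.lt_iff_add_one_le, Nat.le_sqrt, Nat.le_div_iff_mul_le hq.1.1.1.1.1, ← sq, mul_comm]
      exact hq.1.2
    have hcard : ((P.filter (fun q => q.1 ≤ Y)).card : ℝ) ≤ Real.sqrt N * (2 * Real.sqrt Y) := by
      have h1 := Finset.card_le_card hsub
      rw [Finset.card_map, Finset.card_sigma] at h1
      calc ((P.filter (fun q => q.1 ≤ Y)).card : ℝ)
          ≤ ((∑ m ∈ Finset.Icc 1 Y, (Finset.range (Nat.sqrt (N / m))).card : ℕ) : ℝ) := by
            exact_mod_cast h1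
        _ = ∑ m ∈ Finset.Icc 1 Y, (Nat.sqrt (N / m) : ℝ) := by push_cast [Finset.card_range]; rfl
        _ ≤ ∑ m ∈ Finset.Icc 1 Y, Real.sqrt N * (1 / Real.sqrt m) := by
            refine Finset.sum_le_sum fun m _ => ?_
            rw [mul_one_div, ← Real.sqrt_div (by positivity)]
            refine Real.nat_sqrt_le_real_sqrt.trans (Real.sqrt_le_sqrt Nat.cast_div_le)
        _ ≤ _ := by
            rw [← Finset.mul_sum]
            gcongr
            exact sum_inv_sqrt_le Y
    calc _ ≤ (P.filter (fun q => q.1 ≤ Y)).card • Q := Finset.sum_le_card_nsmul _ _ _ hQ'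
      _ = ((P.filter (fun q => q.1 ≤ Y)).card : ℝ) * Q := nsmul_eq_mul _ _
      _ ≤ Real.sqrt N * (2 * Real.sqrt Y) * Q := by gcongr
      _ = _ := by ring
  have hgood : ∑ q ∈ P.filter (fun q => ¬ q.1 ≤ Y), (r2 (f q) : ℝ) / (N : ℝ) ^ 2 ≤
      ∑ m ∈ Finset.Ioc Y N, weight m ^ 2 * ∑ k ∈ Finset.range N, coef m k ^ 2 := by
    simp_rw [Finset.mul_sum]
    rw [← Finset.sum_product']
    calc _ ≤ ∑ q ∈ P.filter (fun q => ¬ q.1 ≤ Y), weight q.1 ^ 2 * coef q.1 q.2 ^ 2 := by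
          refine Finset.sum_le_sum ?_
          rintro ⟨m, k⟩ hq
          simp only [hP, corePairs, Finset.mem_filter, Finset.mem_product, Finset.mem_Icc, f] at hq
          simp only [f]
          have hm1 : 0 < m := hq.1.1.1.1.1
          have hm : (0 : ℝ) < m := by exact_mod_cast hm1
          rw [weight_of_squarefree hq.1.1.1.2, coef, ← mul_pow, div_mul_div_comm, one_mul, div_pow]
          have hle : (m : ℝ) * ((k : ℝ) + 1) ^ 2 ≤ N := by exact_mod_cast hq.1.2
          -- Integrality of `r₂` replaces a second-moment estimate by the first moment.
          have hr : (r2 (m * (k + 1) ^ 2) : ℝ) ≤ (r2 (m * (k + 1) ^ 2) : ℝ) ^ 2 := by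
            exact_mod_cast Nat.le_self_pow (by norm_num) _
          gcongr
      _ ≤ _ := by
          refine Finset.sum_le_sum_of_subset_of_nonneg ?_ fun q _ _ => by positivity
          rintro ⟨m, k⟩ hq
          simp only [hP, corePairs, Finset.mem_filter, Finset.mem_product, Finset.mem_Icc] at hq
          simp only [Finset.mem_product, Finset.mem_Ioc]
          exact ⟨⟨not_le.1 hq.2, hq.1.1.1.1.2⟩, hq.1.1.2⟩
  refine le_trans ?_ hgood
  rw [← Finset.sum_div]
  gcongr
  linarith

/-! ### The Fourier series of `φ_{1,m}` and Parseval's identity -/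

/-- The cosine coefficients of `φ_{1,m}`. -/
def phiCoef (m k : ℕ) : ℝ := -(Real.sqrt 2 / Real.pi) * weight m * coef m k

lemma abs_phiCoef (m k : ℕ) : |phiCoef m k| = Real.sqrt 2 / Real.pi * weight m * coef m k := by
  have : 0 ≤ Real.sqrt 2 / Real.pi := by positivity
  rw [phiCoef, abs_mul, abs_mul, abs_neg, abs_of_nonneg (coef_nonneg m k),
    abs_of_nonneg (weight_nonneg m), abs_of_nonneg this]

lemma summable_abs_phiCoef (m : ℕ) : Summable fun k => |phiCoef m k| := by
  simp_rw [abs_phiCoef]; exact (summable_coef m).mul_left _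

lemma tsum_abs_phiCoef (m : ℕ) : ∑' k, |phiCoef m k| = phiBound m := by
  simp_rw [abs_phiCoef]; rw [tsum_mul_left, phiBound]

lemma norm_phi_term_le (m k : ℕ) (t : ℝ) :
    ‖phiCoef m k * Real.cos (2 * Real.pi * ((k : ℝ) + 1) * t)‖ ≤ |phiCoef m k| := by
  rw [norm_mul, Real.norm_eq_abs, Real.norm_eq_abs]
  exact mul_le_of_le_one_right (abs_nonneg _) (Real.abs_cos_le_one _)

lemma phi_eq_tsum (m : ℕ) (t : ℝ) :
    phi m t = ∑' k : ℕ, phiCoef m k * Real.cos (2 * Real.pi * ((k : ℝ) + 1) * t) := by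
  simp only [phiCoef, mul_assoc]
  rw [tsum_mul_left, tsum_mul_left]
  simp only [phi, weight, coef, mul_assoc]

lemma hasSum_phi (m : ℕ) (t : ℝ) :
    HasSum (fun k : ℕ => phiCoef m k * Real.cos (2 * Real.pi * ((k : ℝ) + 1) * t)) (phi m t) := by
  rw [phi_eq_tsum]
  exact ((summable_abs_phiCoef m).of_norm_bounded (norm_phi_term_le m · t)).hasSum

lemma abs_phi_le (m : ℕ) (t : ℝ) : |phi m t| ≤ phiBound m := by
  rw [← tsum_abs_phiCoef, phi_eq_tsum]
  exact tsum_of_norm_bounded (summable_abs_phiCoef m).hasSum (norm_phi_term_le m · t)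

lemma phi_of_not_squarefree {m : ℕ} (hm : ¬ Squarefree m) (t : ℝ) : phi m t = 0 := by
  have := abs_phi_le m t
  rw [phiBound_of_not_squarefree hm] at this
  exact abs_nonpos_iff.1 this

lemma continuous_phi (m : ℕ) : Continuous (phi m) := by
  have : phi m = fun t => ∑' k : ℕ, phiCoef m k * Real.cos (2 * Real.pi * ((k : ℝ) + 1) * t) :=
    funext (phi_eq_tsum m)
  rw [this]
  exact continuous_tsum (fun k => by fun_prop) (summable_abs_phiCoef m) (norm_phi_term_le m)

lemma phi_add_one (m : ℕ) (t : ℝ) : phi m (t + 1) = phi m t := by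
  rw [phi_eq_tsum, phi_eq_tsum]
  congr 1
  ext k
  congr 1
  have : 2 * Real.pi * ((k : ℝ) + 1) * (t + 1) =
      2 * Real.pi * ((k : ℝ) + 1) * t + ((k + 1 : ℕ) : ℝ) * (2 * Real.pi) := by
    push_cast; ring
  rw [this, Real.cos_add_nat_mul_two_pi]

lemma integral_cos_two_pi_mul (n : ℤ) (hn : n ≠ 0) :
    ∫ t in (0 : ℝ)..1, Real.cos (2 * Real.pi * n * t) = 0 := by
  have hc : 2 * Real.pi * (n : ℝ) ≠ 0 := by
    have : (n : ℝ) ≠ 0 := by exact_mod_cast hn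
    positivity
  rw [intervalIntegral.integral_comp_mul_left (fun x => Real.cos x) hc, integral_cos]
  have : Real.sin (2 * Real.pi * n * 1) = 0 := by
    rw [show 2 * Real.pi * (n : ℝ) * 1 = ((2 * n : ℤ) : ℝ) * Real.pi by push_cast; ring]
    exact Real.sin_int_mul_pi _
  rw [this]; simp

lemma integral_cos_mul_cos (j k : ℕ) :
    ∫ t in (0 : ℝ)..1, Real.cos (2 * Real.pi * ((k : ℝ) + 1) * t) *
      Real.cos (2 * Real.pi * ((j : ℝ) + 1) * t) = if k = j then 1 / 2 else 0 := by
  have h : ∀ t : ℝ, Real.cos (2 * Real.pi * ((k : ℝ) + 1) * t) *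
      Real.cos (2 * Real.pi * ((j : ℝ) + 1) * t) =
      (1 / 2) * Real.cos (2 * Real.pi * (((k : ℤ) - j : ℤ) : ℝ) * t) +
      (1 / 2) * Real.cos (2 * Real.pi * (((k : ℤ) + j + 2 : ℤ) : ℝ) * t) := by
    intro t
    have h1 := Real.cos_sub (2 * Real.pi * ((k : ℝ) + 1) * t) (2 * Real.pi * ((j : ℝ) + 1) * t)
    have h2 := Real.cos_add (2 * Real.pi * ((k : ℝ) + 1) * t) (2 * Real.pi * ((j : ℝ) + 1) * t)
    rw [show 2 * Real.pi * (((k : ℤ) - j : ℤ) : ℝ) * t =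
      2 * Real.pi * ((k : ℝ) + 1) * t - 2 * Real.pi * ((j : ℝ) + 1) * t by push_cast; ring,
      show 2 * Real.pi * (((k : ℤ) + j + 2 : ℤ) : ℝ) * t =
      2 * Real.pi * ((k : ℝ) + 1) * t + 2 * Real.pi * ((j : ℝ) + 1) * t by push_cast; ring, h1, h2]
    ring
  simp_rw [h]
  rw [intervalIntegral.integral_add (Continuous.intervalIntegrable (by fun_prop) _ _)
    (Continuous.intervalIntegrable (by fun_prop) _ _), intervalIntegral.integral_const_mul,
    intervalIntegral.integral_const_mul, integral_cos_two_pi_mul ((k : ℤ) + j + 2) (by omega)]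
  split_ifs with hkj
  · subst hkj; simp
  · rw [integral_cos_two_pi_mul _ (by omega)]; simp

/-- Termwise integration, used with `g = 1` (mean zero), `g` a cosine (the coefficients) and `g =
φ_{1,m}` (Parseval). -/
lemma hasSum_integral_phi_mul (m : ℕ) {g : ℝ → ℝ} (hg : Continuous g) {B : ℝ}
    (hB : ∀ t, |g t| ≤ B) :
    HasSum (fun k : ℕ => phiCoef m k *
      ∫ t in (0 : ℝ)..1, Real.cos (2 * Real.pi * ((k : ℝ) + 1) * t) * g t)
      (∫ t in (0 : ℝ)..1, phi m t * g t) := by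
  have hb : Summable fun k => |phiCoef m k| * B := (summable_abs_phiCoef m).mul_right B
  have := intervalIntegral.hasSum_integral_of_dominated_convergence
    (μ := MeasureTheory.volume) (a := 0) (b := 1)
    (F := fun k t => phiCoef m k * Real.cos (2 * Real.pi * ((k : ℝ) + 1) * t) * g t)
    (f := fun t => phi m t * g t) (fun k _ => |phiCoef m k| * B)
    (fun k => Continuous.aestronglyMeasurable (by fun_prop))
    (fun k => .of_forall fun t _ => by
      rw [norm_mul]
      exact mul_le_mul (norm_phi_term_le m k t) (hB t) (norm_nonneg _) (abs_nonneg _))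
    (.of_forall fun t _ => hb) (by simp)
    (.of_forall fun t _ => (hasSum_phi m t).mul_right _)
  refine this.congr_fun ?_
  intro k
  rw [← intervalIntegral.integral_const_mul]
  simp only [mul_assoc]

lemma integral_phi (m : ℕ) : ∫ t in (0 : ℝ)..1, phi m t = 0 := by
  have h := hasSum_integral_phi_mul m (g := fun _ => 1) continuous_const (B := 1) (by simp)
  have h0 : ∀ k : ℕ, ∫ t in (0 : ℝ)..1, Real.cos (2 * Real.pi * ((k : ℝ) + 1) * t) * 1 = 0 := by
    intro k
    simpa using integral_cos_two_pi_mul ((k : ℤ) + 1) (by omega)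
  simp_rw [h0] at h
  simpa using h.unique (by simp)

/-- The second moment `∫₀¹ φ_{1,m}²`. -/
def energy (m : ℕ) : ℝ := ∫ t in (0 : ℝ)..1, phi m t ^ 2

lemma energy_nonneg (m : ℕ) : 0 ≤ energy m :=
  intervalIntegral.integral_nonneg (by norm_num) fun t _ => sq_nonneg _

lemma integral_cos_mul_phi (m j : ℕ) :
    ∫ t in (0 : ℝ)..1, Real.cos (2 * Real.pi * ((j : ℝ) + 1) * t) * phi m t = phiCoef m j / 2 := by
  have h := hasSum_integral_phi_mul m (g := fun t => Real.cos (2 * Real.pi * ((j : ℝ) + 1) * t))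
    (by fun_prop) (B := 1) (fun t => Real.abs_cos_le_one _)
  simp_rw [integral_cos_mul_cos] at h
  simp_rw [mul_comm (Real.cos _) (phi m _)]
  refine h.unique ?_
  have := hasSum_ite_eq j (phiCoef m j / 2)
  refine this.congr_fun ?_
  intro k
  split_ifs with hk
  · subst hk; ring
  · ring

lemma hasSum_energy (m : ℕ) : HasSum (fun k => phiCoef m k ^ 2 / 2) (energy m) := by
  have h := hasSum_integral_phi_mul m (continuous_phi m) (abs_phi_le m)
  simp_rw [integral_cos_mul_phi] at h
  rw [energy]
  simp_rw [sq]
  refine h.congr_fun ?_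
  intro k; ring

lemma le_energy (m K : ℕ) :
    1 / Real.pi ^ 2 * (weight m ^ 2 * ∑ k ∈ Finset.range K, coef m k ^ 2) ≤ energy m := by
  refine le_trans (le_of_eq ?_) (sum_le_hasSum (Finset.range K) (fun k _ => by positivity)
    (hasSum_energy m))
  rw [Finset.mul_sum, Finset.mul_sum]
  refine Finset.sum_congr rfl fun k _ => ?_
  rw [phiCoef, mul_pow, mul_pow, neg_sq, div_pow, Real.sq_sqrt (by norm_num)]
  field_simp

lemma energy_le (m : ℕ) : energy m ≤ phiBound m ^ 2 := by
  have : energy m ≤ ∫ t in (0 : ℝ)..1, phiBound m ^ 2 := by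
    apply intervalIntegral.integral_mono_on (by norm_num)
      (Continuous.intervalIntegrable ((continuous_phi m).pow 2) _ _) (by simp)
    intro t _
    change phi m t ^ 2 ≤ _
    rw [← sq_abs]
    exact pow_le_pow_left₀ (abs_nonneg _) (abs_phi_le m t) 2
  simpa using this

/-! ### Estimates for a single factor `Φ_{1,m}(α)` -/

lemma norm_exponent (α : ℂ) (x : ℝ) :
    ‖2 * (Real.pi : ℂ) * Complex.I * α * (x : ℂ)‖ = 2 * Real.pi * ‖α‖ * |x| := by
  simp [abs_of_pos Real.pi_pos]

lemma norm_exp_exponent (α : ℂ) (x : ℝ) :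
    ‖Complex.exp (2 * (Real.pi : ℂ) * Complex.I * α * (x : ℂ))‖ =
      Real.exp (-(2 * Real.pi * α.im * x)) := by
  rw [Complex.norm_exp]
  congr 1
  simp

lemma norm_exponent_phi_le (m : ℕ) (α : ℂ) (t : ℝ) :
    ‖2 * (Real.pi : ℂ) * Complex.I * α * (phi m t : ℂ)‖ ≤ 2 * Real.pi * ‖α‖ * phiBound m := by
  rw [norm_exponent]
  have := abs_phi_le m t
  have := Real.pi_pos
  gcongr

lemma continuous_exponent_phi (m : ℕ) (α : ℂ) :
    Continuous fun t : ℝ => 2 * (Real.pi : ℂ) * Complex.I * α * (phi m t : ℂ) :=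
  continuous_const.mul (Complex.continuous_ofReal.comp (continuous_phi m))

lemma norm_PhiFactor_le (m : ℕ) (α : ℂ) :
    ‖PhiFactor m α‖ ≤ Real.exp (2 * Real.pi * |α.im| * phiBound m) := by
  have := intervalIntegral.norm_integral_le_of_norm_le_const (a := 0) (b := 1)
    (f := fun t : ℝ => Complex.exp (2 * (Real.pi : ℂ) * Complex.I * α * (phi m t : ℂ)))
    (C := Real.exp (2 * Real.pi * |α.im| * phiBound m)) (fun t _ => by
      rw [norm_exp_exponent]
      apply Real.exp_le_exp.2
      calc -(2 * Real.pi * α.im * phi m t) ≤ |-(2 * Real.pi * α.im * phi m t)| := le_abs_self _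
        _ = 2 * Real.pi * |α.im| * |phi m t| := by
          rw [abs_neg, abs_mul, abs_mul, abs_of_pos Real.two_pi_pos]
        _ ≤ _ := by
          have := abs_phi_le m t
          have := Real.pi_pos
          gcongr)
  simpa [PhiFactor] using this

lemma norm_PhiFactor_ofReal_le (m : ℕ) (σ : ℝ) : ‖PhiFactor m (σ : ℂ)‖ ≤ 1 := by
  simpa using norm_PhiFactor_le m (σ : ℂ)

lemma integral_exponent_phi (m : ℕ) (α : ℂ) :
    ∫ t in (0 : ℝ)..1, 2 * (Real.pi : ℂ) * Complex.I * α * (phi m t : ℂ) = 0 := by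
  rw [intervalIntegral.integral_const_mul, intervalIntegral.integral_ofReal, integral_phi]
  simp

/-- The linear term of the exponential integrates to zero, so the deviation from `1` is of second
order. -/
lemma norm_PhiFactor_sub_one_le (m : ℕ) (α : ℂ) :
    ‖PhiFactor m α - 1‖ ≤ (2 * Real.pi * ‖α‖ * phiBound m) ^ 2 *
      Real.exp (2 * Real.pi * ‖α‖ * phiBound m) := by
  set η := 2 * Real.pi * ‖α‖ * phiBound m
  have hc := continuous_exponent_phi m α
  have e : PhiFactor m α - 1 = ∫ t in (0 : ℝ)..1,
      (Complex.exp (2 * (Real.pi : ℂ) * Complex.I * α * (phi m t : ℂ)) -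
        (1 + 2 * (Real.pi : ℂ) * Complex.I * α * (phi m t : ℂ))) := by
    have hc1 : Continuous fun t => 1 + 2 * (Real.pi : ℂ) * Complex.I * α * (phi m t : ℂ) :=
      continuous_const.add hc
    rw [intervalIntegral.integral_sub (hc.cexp.intervalIntegrable _ _)
      (hc1.intervalIntegrable _ _),
      intervalIntegral.integral_add (by simp) (hc.intervalIntegrable _ _), integral_exponent_phi]
    simp [PhiFactor]
  rw [e]
  have := intervalIntegral.norm_integral_le_of_norm_le_const (a := 0) (b := 1)
    (f := fun t : ℝ => (Complex.exp (2 * (Real.pi : ℂ) * Complex.I * α * (phi m t : ℂ)) -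
        (1 + 2 * (Real.pi : ℂ) * Complex.I * α * (phi m t : ℂ))))
    (C := η ^ 2 * Real.exp η) (fun t _ => by
      have h := Complex.norm_exp_sub_sum_le_norm_mul_exp
        (2 * (Real.pi : ℂ) * Complex.I * α * (phi m t : ℂ)) 2
      simp only [Finset.sum_range_succ, Finset.sum_range_zero, pow_zero, pow_one, Nat.factorial,
        Nat.cast_one, div_one, zero_add, mul_one] at h
      refine h.trans ?_
      have := norm_exponent_phi_le m α t
      gcongr)
  simpa using this

/-- This is `r ≤ (1 + r²)/2` with `r = ‖1 - w‖`. -/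
lemma norm_one_sub_le (w : ℂ) : ‖1 - w‖ ≤ 1 - w.re + ‖w‖ ^ 2 / 2 := by
  have h : ‖1 - w‖ ^ 2 = 1 - 2 * w.re + ‖w‖ ^ 2 := by
    rw [← Complex.normSq_eq_norm_sq, ← Complex.normSq_eq_norm_sq, Complex.normSq_apply,
      Complex.normSq_apply]
    simp; ring
  nlinarith [sq_nonneg (‖1 - w‖ - 1)]

/-- To second order the factor is `1 - w` with `w = 2π²α²E`, and the error is a small multiple of
`‖w‖`. The exponent is `-Re w + ‖w‖/2`: giving up half of `‖w‖` leaves `-π²σ²E` and costs `3π²τ²E`.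
-/
lemma norm_PhiFactor_le_exp_energy (m : ℕ) (α : ℂ) (h : 2 * Real.pi * ‖α‖ * phiBound m ≤ 1 / 8) :
    ‖PhiFactor m α‖ ≤ Real.exp (-(Real.pi ^ 2 * α.re ^ 2 * energy m) +
      3 * Real.pi ^ 2 * α.im ^ 2 * energy m) := by
  set η := 2 * Real.pi * ‖α‖ * phiBound m with hη
  have hη0 : 0 ≤ η := by have := phiBound_nonneg m; have := Real.pi_pos; positivity
  have hc := continuous_exponent_phi m α
  set z : ℝ → ℂ := fun t => 2 * (Real.pi : ℂ) * Complex.I * α * (phi m t : ℂ) with hz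
  set w : ℂ := 2 * (Real.pi : ℂ) ^ 2 * α ^ 2 * (energy m : ℂ) with hw
  set U : ℝ := 2 * Real.pi ^ 2 * energy m with hU
  have hU0 : 0 ≤ U := by have := energy_nonneg m; positivity
  have hzz : ∫ t in (0 : ℝ)..1, z t ^ 2 / 2 = -w := by
    have : ∀ t, z t ^ 2 / 2 = (-(2 * (Real.pi : ℂ) ^ 2 * α ^ 2)) * ((phi m t ^ 2 : ℝ) : ℂ) := by
      intro t
      simp only [hz]
      push_cast
      linear_combination (2 * (Real.pi : ℂ) ^ 2 * α ^ 2 * (phi m t : ℂ) ^ 2) * Complex.I_sq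
    simp_rw [this]
    rw [intervalIntegral.integral_const_mul, intervalIntegral.integral_ofReal, hw, energy]
    ring
  have e : PhiFactor m α - (1 - w) = ∫ t in (0 : ℝ)..1,
      (Complex.exp (z t) - (1 + z t + z t ^ 2 / 2)) := by
    have hcq : Continuous fun t => z t ^ 2 / 2 := (hc.pow 2).div_const 2
    have hc1 : Continuous fun t => 1 + z t := continuous_const.add hc
    have hc2 : Continuous fun t => 1 + z t + z t ^ 2 / 2 := hc1.add hcq
    rw [intervalIntegral.integral_sub (hc.cexp.intervalIntegrable _ _)
      (hc2.intervalIntegrable _ _),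
      intervalIntegral.integral_add (hc1.intervalIntegrable _ _)
        (hcq.intervalIntegrable _ _),
      intervalIntegral.integral_add (by simp) (hc.intervalIntegrable _ _), integral_exponent_phi,
      hzz]
    simp [PhiFactor]
    ring
  have hrem : ‖PhiFactor m α - (1 - w)‖ ≤ 2 * (η * Real.exp η) * (U * ‖α‖ ^ 2) := by
    rw [e]
    have h1 : ‖∫ t in (0 : ℝ)..1, (Complex.exp (z t) - (1 + z t + z t ^ 2 / 2))‖ ≤
        ∫ t in (0 : ℝ)..1, (2 * Real.pi * ‖α‖) ^ 2 * (η * Real.exp η) * phi m t ^ 2 := by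
      refine intervalIntegral.norm_integral_le_of_norm_le (by norm_num) (.of_forall fun t _ => ?_)
        (Continuous.intervalIntegrable (continuous_const.mul ((continuous_phi m).pow 2)) _ _)
      have h := Complex.norm_exp_sub_sum_le_norm_mul_exp (z t) 3
      simp only [Finset.sum_range_succ, Finset.sum_range_zero, pow_zero, pow_one, Nat.factorial,
        Nat.cast_one, div_one, zero_add, mul_one, Nat.succ_eq_add_one, Nat.reduceAdd,
        Nat.cast_ofNat] at h
      refine h.trans ?_
      have h2 : ‖z t‖ ≤ η := norm_exponent_phi_le m α t
      have h3 : ‖z t‖ ^ 2 = (2 * Real.pi * ‖α‖) ^ 2 * phi m t ^ 2 := by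
        rw [hz, norm_exponent, mul_pow, sq_abs]
      calc ‖z t‖ ^ 3 * Real.exp ‖z t‖ = ‖z t‖ ^ 2 * (‖z t‖ * Real.exp ‖z t‖) := by ring
        _ ≤ ‖z t‖ ^ 2 * (η * Real.exp η) := by gcongr
        _ = _ := by rw [h3]; ring
    refine h1.trans (le_of_eq ?_)
    rw [intervalIntegral.integral_const_mul, hU, energy]
    ring
  have hexp : Real.exp η ≤ 5 / 4 := by
    have h1 : Real.exp η ≤ Real.exp (1 / 8) := Real.exp_le_exp.2 h
    have h2 := Real.exp_bound_div_one_sub_of_interval (x := 1 / 8) (by norm_num) (by norm_num)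
    linarith
  have hwn : ‖w‖ = U * ‖α‖ ^ 2 := by
    rw [hw, hU]
    simp [abs_of_nonneg (energy_nonneg m)]
    ring
  have hwre : w.re = U * (α.re ^ 2 - α.im ^ 2) := by
    have : w = (U : ℂ) * α ^ 2 := by rw [hw, hU]; push_cast; ring
    rw [this, Complex.re_ofReal_mul, sq α, Complex.mul_re]
    ring
  have hwsmall : ‖w‖ ≤ 1 / 128 := by
    have h1 := energy_le m
    have h2 : U * ‖α‖ ^ 2 ≤ η ^ 2 / 2 := by
      rw [hU, hη]
      have : 2 * Real.pi ^ 2 * energy m * ‖α‖ ^ 2 ≤ 2 * Real.pi ^ 2 * phiBound m ^ 2 * ‖α‖ ^ 2 := by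
        gcongr
      linarith
    rw [hwn]
    nlinarith
  have hα : ‖α‖ ^ 2 = α.re ^ 2 + α.im ^ 2 := by
    rw [← Complex.normSq_eq_norm_sq, Complex.normSq_apply]; ring
  -- The cubic remainder is at most `2 · (1/8) · (5/4) ‖w‖ = (5/16) ‖w‖`, and `‖w‖²/2 ≤ ‖w‖/256`;
  -- together they stay below `‖w‖/2`.
  have hfin : ‖PhiFactor m α‖ ≤ 1 + (-w.re + ‖w‖ / 2) := by
    have h1 : ‖PhiFactor m α‖ ≤ ‖PhiFactor m α - (1 - w)‖ + ‖1 - w‖ := by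
      simpa using norm_add_le (PhiFactor m α - (1 - w)) (1 - w)
    have h2 := norm_one_sub_le w
    rw [← hwn] at hrem
    have h3 : 2 * (η * Real.exp η) ≤ 5 / 16 := by nlinarith [Real.exp_pos η]
    have h4 : 2 * (η * Real.exp η) * ‖w‖ ≤ 5 / 16 * ‖w‖ := by gcongr
    nlinarith [norm_nonneg w]
  refine hfin.trans ?_
  rw [add_comm]
  refine (Real.add_one_le_exp _).trans (Real.exp_le_exp.2 (le_of_eq ?_))
  rw [hwre, hwn, hα, hU]
  ring

lemma differentiable_PhiFactor (m : ℕ) : Differentiable ℂ (PhiFactor m) := by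
  intro α₀
  have hc : ∀ α, Continuous fun t : ℝ =>
      Complex.exp (2 * (Real.pi : ℂ) * Complex.I * α * (phi m t : ℂ)) := fun α =>
    (continuous_exponent_phi m α).cexp
  have hφ : Continuous fun t : ℝ => 2 * (Real.pi : ℂ) * Complex.I * (phi m t : ℂ) :=
    continuous_const.mul (Complex.continuous_ofReal.comp (continuous_phi m))
  refine (intervalIntegral.hasDerivAt_integral_of_dominated_loc_of_deriv_le
    (μ := MeasureTheory.volume) (a := 0) (b := 1)
    (F := fun α t => Complex.exp (2 * (Real.pi : ℂ) * Complex.I * α * (phi m t : ℂ)))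
    (F' := fun α t => Complex.exp (2 * (Real.pi : ℂ) * Complex.I * α * (phi m t : ℂ)) *
      (2 * (Real.pi : ℂ) * Complex.I * (phi m t : ℂ)))
    (s := Metric.ball α₀ 1) (x₀ := α₀)
    (bound := fun _ => Real.exp (2 * Real.pi * (‖α₀‖ + 1) * phiBound m) *
      (2 * Real.pi * phiBound m))
    (Metric.ball_mem_nhds _ one_pos)
    (.of_forall fun α => (hc α).aestronglyMeasurable)
    ((hc α₀).intervalIntegrable _ _)
    ((hc α₀).mul hφ).aestronglyMeasurable
    (.of_forall fun t _ α hα => ?_) (by simp) (.of_forall fun t _ α _ => ?_)).2.differentiableAt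
  · have hα' : ‖α‖ ≤ ‖α₀‖ + 1 := by
      have := norm_le_norm_add_norm_sub' α α₀
      rw [Metric.mem_ball, dist_eq_norm] at hα
      linarith
    have hb := phiBound_nonneg m
    have hpi := Real.pi_pos
    rw [norm_mul]
    gcongr
    · refine (Complex.norm_exp_le_exp_norm _).trans (Real.exp_le_exp.2 ?_)
      refine (norm_exponent_phi_le m α t).trans ?_
      gcongr
    · simpa using norm_exponent_phi_le m 1 t
  · have h1 : HasDerivAt (fun α : ℂ => 2 * (Real.pi : ℂ) * Complex.I * α * (phi m t : ℂ))
        (2 * (Real.pi : ℂ) * Complex.I * (phi m t : ℂ)) α := by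
      simpa using ((hasDerivAt_id α).const_mul (2 * (Real.pi : ℂ) * Complex.I)).mul_const
        (phi m t : ℂ)
    exact h1.cexp

/-! ### Convergence of the infinite product to an entire function -/

lemma summable_phiBound_sq : Summable fun m : ℕ => phiBound (m + 1) ^ 2 := by
  obtain ⟨C, hC, h⟩ := exists_phiBound_le
  have hs : Summable fun m : ℕ => (C * divisorConst (1 / 8)) ^ 2 *
      (1 / ((m + 1 : ℕ) : ℝ) ^ (7 / 4 : ℝ)) :=
    (((Real.summable_one_div_nat_rpow (p := 7 / 4)).2 (by norm_num)).comp_injective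
      (add_left_injective 1)).mul_left _
  refine Summable.of_nonneg_of_le (fun m => sq_nonneg _) (fun m => ?_) hs
  have hm : (0 : ℝ) < ((m + 1 : ℕ) : ℝ) := by positivity
  have h1 := h (1 / 8) (by norm_num) (m + 1) (Nat.succ_ne_zero m)
  refine (pow_le_pow_left₀ (phiBound_nonneg _) h1 2).trans (le_of_eq ?_)
  rw [mul_pow, ← Real.rpow_natCast (_ ^ _), ← Real.rpow_mul hm.le, one_div (_ ^ _),
    ← Real.rpow_neg hm.le]
  norm_num

lemma exists_norm_PhiFactor_sub_one_le {K : Set ℂ} (hK : IsCompact K) :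
    ∃ C : ℝ, ∀ m : ℕ, ∀ α ∈ K, ‖PhiFactor (m + 1) α - 1‖ ≤ C * phiBound (m + 1) ^ 2 := by
  obtain ⟨R, hR⟩ := hK.isBounded.exists_norm_le
  obtain ⟨B, hB⟩ : ∃ B, ∀ m : ℕ, phiBound (m + 1) ≤ B := by
    refine ⟨1 + ∑' m : ℕ, phiBound (m + 1) ^ 2, fun m => ?_⟩
    have := summable_phiBound_sq.le_tsum m fun j _ => sq_nonneg _
    nlinarith [sq_nonneg (phiBound (m + 1) - 1)]
  refine ⟨(2 * Real.pi * |R|) ^ 2 * Real.exp (2 * Real.pi * |R| * B), fun m α hα => ?_⟩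
  refine (norm_PhiFactor_sub_one_le _ _).trans ?_
  have h1 : ‖α‖ ≤ |R| := (hR α hα).trans (le_abs_self R)
  have h2 := phiBound_nonneg (m + 1)
  have h3 := hB m
  have h4 := Real.pi_pos
  calc (2 * Real.pi * ‖α‖ * phiBound (m + 1)) ^ 2 *
        Real.exp (2 * Real.pi * ‖α‖ * phiBound (m + 1))
      ≤ (2 * Real.pi * |R| * phiBound (m + 1)) ^ 2 * Real.exp (2 * Real.pi * |R| * B) := by
        gcongr
    _ = _ := by ring

theorem summableUniformlyOn_PhiFactor {K : Set ℂ} (hK : IsCompact K) :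
    SummableUniformlyOn (fun (m : ℕ) (α : ℂ) => ‖PhiFactor (m + 1) α - 1‖) K := by
  obtain ⟨C, hC⟩ := exists_norm_PhiFactor_sub_one_le hK
  refine HasSumUniformlyOn.summableUniformlyOn
    (g := fun α => ∑' m : ℕ, ‖PhiFactor (m + 1) α - 1‖) ?_
  rw [hasSumUniformlyOn_iff_tendstoUniformlyOn]
  exact tendstoUniformlyOn_tsum (summable_phiBound_sq.mul_left C) fun m α hα => by
    simpa using hC m α hα

theorem hasProdUniformlyOn_PhiFactor {K : Set ℂ} (hK : IsCompact K) :
    HasProdUniformlyOn (fun (m : ℕ) (α : ℂ) => PhiFactor (m + 1) α) Phi1 K := by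
  obtain ⟨C, hC⟩ := exists_norm_PhiFactor_sub_one_le hK
  have := Summable.hasProdUniformlyOn_nat_one_add (f := fun m α => PhiFactor (m + 1) α - 1) hK
    (summable_phiBound_sq.mul_left C) (.of_forall hC)
    (fun m => ((differentiable_PhiFactor (m + 1)).continuous.sub continuous_const).continuousOn)
  simpa [Phi1] using! this

lemma limitM_eq_prod_range (α : ℂ) (M : ℕ) :
    limitM α M = ∏ m ∈ Finset.range M, PhiFactor (m + 1) α := by
  rw [limitM, Finset.range_eq_Ico, Finset.prod_Ico_add' (fun m => PhiFactor m α) 0 M 1]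
  rfl

lemma tendsto_limitM (α : ℂ) : Filter.Tendsto (limitM α) Filter.atTop (nhds (Phi1 α)) := by
  have h := ((hasProdUniformlyOn_PhiFactor (isCompact_singleton (x := α))).hasProd
    (Set.mem_singleton α)).tendsto_prod_nat
  simpa only [← limitM_eq_prod_range] using h

theorem differentiable_Phi1 : Differentiable ℂ Phi1 := by
  have h : TendstoLocallyUniformlyOn (fun (M : ℕ) α => limitM α M) Phi1 Filter.atTop Set.univ := by
    rw [tendstoLocallyUniformlyOn_iff_forall_isCompact isOpen_univ]
    intro K _ hK
    have := (hasProdUniformlyOn_PhiFactor hK).tendstoUniformlyOn_finsetRange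
    refine this.congr (.of_forall fun M α _ => ?_)
    simp only [limitM_eq_prod_range]
  have hd : ∀ M : ℕ, DifferentiableOn ℂ (fun α => limitM α M) Set.univ := by
    intro M
    simp only [limitM]
    exact (Differentiable.fun_finsetProd fun m _ => differentiable_PhiFactor m).differentiableOn
  exact differentiableOn_univ.1 (h.differentiableOn (.of_forall hd) isOpen_univ)

/-! ### The growth estimate for `Φ₁` -/

/-- Three ranges. Up to `Y₁` only the trivial bound, linear in `|τ|`, is available. Beyond `Y₁` the
energy bound applies; its loss in `τ²` is absorbed into the linear term up to `Y₂` and kept only in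
the tail beyond `Y₂`. -/
lemma norm_limitM_le (α : ℂ) {Y₁ Y₂ M : ℕ} (hY : Y₁ ≤ Y₂) (hM : Y₂ ≤ M)
    (hsmall : ∀ m, Y₁ < m → 2 * Real.pi * ‖α‖ * phiBound m ≤ 1 / 8) :
    ‖limitM α M‖ ≤ Real.exp (2 * Real.pi * |α.im| * ∑ m ∈ Finset.Icc 1 Y₂, phiBound m -
      Real.pi ^ 2 * α.re ^ 2 * ∑ m ∈ Finset.Ioc Y₁ M, energy m +
      3 * Real.pi ^ 2 * α.im ^ 2 * ∑ m ∈ Finset.Ioc Y₂ M, phiBound m ^ 2) := by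
  have hpi := Real.pi_pos
  have hfac : ∀ m ∈ Finset.Icc 1 M, ‖PhiFactor m α‖ ≤ Real.exp
      (2 * Real.pi * |α.im| * (if m ≤ Y₂ then phiBound m else 0) -
        Real.pi ^ 2 * α.re ^ 2 * (if Y₁ < m then energy m else 0) +
        3 * Real.pi ^ 2 * α.im ^ 2 * (if Y₂ < m then phiBound m ^ 2 else 0)) := by
    intro m _
    have hb := phiBound_nonneg m
    by_cases h1 : Y₁ < m
    · refine (norm_PhiFactor_le_exp_energy m α (hsmall m h1)).trans (Real.exp_le_exp.2 ?_)
      rw [if_pos h1]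
      by_cases h2 : Y₂ < m
      · rw [if_neg (by omega), if_pos h2]
        have : 3 * Real.pi ^ 2 * α.im ^ 2 * energy m ≤
            3 * Real.pi ^ 2 * α.im ^ 2 * phiBound m ^ 2 := by
          gcongr; exact energy_le m
        linarith
      · rw [if_pos (by omega), if_neg h2]
        -- One factor `|τ|` is replaced by `‖α‖`, and the smallness of `‖α‖ phiBound m` then makes
        -- the quadratic loss linear.
        have h3 : α.im ^ 2 ≤ |α.im| * ‖α‖ := by
          rw [← sq_abs, sq]; gcongr; exact Complex.abs_im_le_norm α
        have h4 : 3 * Real.pi ^ 2 * α.im ^ 2 * energy m ≤ 2 * Real.pi * |α.im| * phiBound m := by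
          calc 3 * Real.pi ^ 2 * α.im ^ 2 * energy m
              ≤ 3 * Real.pi ^ 2 * (|α.im| * ‖α‖) * phiBound m ^ 2 := by
                gcongr
                · exact energy_nonneg m
                · exact energy_le m
            _ = 3 / 2 * Real.pi * |α.im| * phiBound m * (2 * Real.pi * ‖α‖ * phiBound m) := by ring
            _ ≤ 3 / 2 * Real.pi * |α.im| * phiBound m * (1 / 8) := by
                gcongr; exact hsmall m h1
            _ ≤ _ := by
                have : 0 ≤ Real.pi * |α.im| * phiBound m := by positivity
                linarith
        linarith
    · rw [if_neg h1, if_pos (by omega), if_neg (by omega)]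
      simpa using norm_PhiFactor_le m α
  rw [limitM, norm_prod]
  refine (Finset.prod_le_prod (fun m _ => norm_nonneg _) hfac).trans (le_of_eq ?_)
  rw [← Real.exp_sum, Finset.sum_add_distrib, Finset.sum_sub_distrib, ← Finset.mul_sum,
    ← Finset.mul_sum, ← Finset.mul_sum, ← Finset.sum_filter, ← Finset.sum_filter,
    ← Finset.sum_filter]
  have e1 : (Finset.Icc 1 M).filter (fun m => m ≤ Y₂) = Finset.Icc 1 Y₂ := by
    ext m; simp only [Finset.mem_filter, Finset.mem_Icc]; omega
  have e2 : ∀ Y, (Finset.Icc 1 M).filter (fun m => Y < m) = Finset.Ioc Y M := by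
    intro Y; ext m; simp only [Finset.mem_filter, Finset.mem_Icc, Finset.mem_Ioc]; omega
  rw [e1, e2, e2]

/-- Each term is at most the increment of the telescoping sequence `-2/√m`. -/
lemma sum_rpow_neg_three_halves_le {Y : ℕ} (hY : 1 ≤ Y) (M : ℕ) (hM : Y ≤ M) :
    ∑ m ∈ Finset.Ioc Y M, (m : ℝ) ^ (-3 / 2 : ℝ) ≤ 2 / Real.sqrt Y - 2 / Real.sqrt M := by
  induction M, hM using Nat.le_induction with
  | base => simp
  | succ M hM ih =>
    rw [Finset.sum_Ioc_succ_top (by omega)]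
    have hM0 : (0 : ℝ) < M := by exact_mod_cast (by omega : 0 < M)
    have hM1 : (0 : ℝ) < ((M + 1 : ℕ) : ℝ) := by positivity
    set a := Real.sqrt M with ha
    set b := Real.sqrt ((M + 1 : ℕ) : ℝ) with hb
    have ha0 : 0 < a := Real.sqrt_pos.2 hM0
    have hb0 : 0 < b := Real.sqrt_pos.2 hM1
    have ha2 : a ^ 2 = M := Real.sq_sqrt hM0.le
    have hb2 : b ^ 2 = M + 1 := by rw [hb, Real.sq_sqrt hM1.le]; push_cast; ring
    have hab : a ≤ b := Real.sqrt_le_sqrt (by push_cast; linarith)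
    have e : ((M + 1 : ℕ) : ℝ) ^ (-3 / 2 : ℝ) = 1 / b ^ 3 := by
      rw [hb, Real.sqrt_eq_rpow, ← Real.rpow_natCast, ← Real.rpow_mul hM1.le, one_div,
        ← Real.rpow_neg hM1.le]
      norm_num
    have key : 1 / b ^ 3 ≤ 2 / a - 2 / b := by
      have h1 : 2 / a - 2 / b = 2 / (a * b * (a + b)) := by
        field_simp
        linear_combination hb2 - ha2
      rw [h1, div_le_div_iff₀ (by positivity) (by positivity)]
      have h2 : a * (a + b) ≤ b * (b + b) := by gcongr
      nlinarith
    rw [e]; linarith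

/-- With `x = log log A` the choice is `ε = 2/x`, `q = A^ε = exp(2eˣ/x)`. Then `log D(ε)` is at most
`x e^(x/2)`, hence at most `log q`, so `q` dominates every auxiliary loss, while any fixed power of
`q` is `A^o(1)`. -/
lemma exists_scale (K : ℝ) : ∃ R : ℝ, ∀ A : ℝ, R ≤ A → ∃ ε q : ℝ,
    0 < ε ∧ ε ≤ 1 / 8 ∧ q = A ^ ε ∧ 1 ≤ q ∧ K ≤ q ∧ 1 ≤ Real.log A ∧ Real.log A ≤ q ∧
    divisorConst ε ≤ q ∧ q ^ 200 ≤ A ∧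
    A ^ (-1 / theta 28 A) ≤ A⁻¹ * (q ^ 14)⁻¹ ∧ A⁻¹ * (q ^ 28)⁻¹ ≤ A ^ (-1 / theta 28 A) := by
  -- `q^200 = A^(400/x)`, so `x ≥ 400` gives `q^200 ≤ A`.
  set X := max 400 (Real.log (max K 1)) with hX
  refine ⟨Real.exp (Real.exp X), fun A hA => ?_⟩
  have hA0 : 0 < A := (Real.exp_pos _).trans_le hA
  have hL : Real.exp X ≤ Real.log A := (Real.le_log_iff_exp_le hA0).2 hA
  have hL0 : 0 < Real.log A := (Real.exp_pos _).trans_le hL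
  set x := Real.log (Real.log A) with hx
  have hXx : X ≤ x := (Real.le_log_iff_exp_le hL0).2 hL
  have hx80 : 400 ≤ x := (le_max_left _ _).trans hXx
  have hxK : Real.log (max K 1) ≤ x := (le_max_right _ _).trans hXx
  have hLx : Real.log A = Real.exp x := (Real.exp_log hL0).symm
  have hx0 : 0 < x := by linarith
  have hex := Real.exp_pos x
  have hq : A ^ (2 / x) = Real.exp (2 * Real.exp x / x) := by
    rw [Real.rpow_def_of_pos hA0, hLx]; ring_nf
  have hexp2 : x ^ 2 ≤ 2 * Real.exp (x / 2) := by
    have h := Real.pow_div_factorial_le_exp (x / 2) (by linarith) 3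
    have h6 : ((Nat.factorial 3 : ℕ) : ℝ) = 6 := by norm_num [Nat.factorial]
    rw [h6] at h
    have : x ^ 2 * 80 ≤ x ^ 2 * x := by gcongr; linarith
    nlinarith
  have hee : Real.exp (x / 2) * Real.exp (x / 2) = Real.exp x := by
    rw [← Real.exp_add]; ring_nf
  have he1 : 1 ≤ Real.exp (x / 2) := Real.one_le_exp (by linarith)
  have hxq : x ≤ 2 * Real.exp x / x := by
    rw [le_div_iff₀ hx0]; nlinarith
  have h1x : 1 ≤ Real.exp x := Real.one_le_exp (by linarith)
  have hlogq : Real.log A ≤ A ^ (2 / x) := by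
    rw [hq, hLx]; exact Real.exp_le_exp.2 hxq
  refine ⟨2 / x, A ^ (2 / x), by positivity, ?_, rfl, ?_, ?_, ?_, hlogq, ?_, ?_, ?_, ?_⟩
  · rw [div_le_div_iff₀ hx0 (by norm_num)]; linarith
  · rw [hLx] at hlogq; linarith
  · have : max K 1 ≤ Real.exp x := by
      rw [← Real.log_le_iff_le_exp (by positivity)]; exact hxK
    rw [hLx] at hlogq
    exact (le_max_left _ _).trans (this.trans hlogq)
  · rw [hLx]; exact h1x
  · rw [divisorConst, hq, Real.rpow_def_of_pos (by positivity)]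
    apply Real.exp_le_exp.2
    have e1 : 1 + 2 / (2 / x) = 1 + x := by field_simp
    have e2 : 1 / (2 / x) = x / 2 := by field_simp
    rw [e1, e2]
    have h1 : Real.log (1 + x) ≤ x := by
      have := Real.log_le_sub_one_of_pos (show 0 < 1 + x by linarith); linarith
    have h2 : (2 : ℝ) ^ (x / 2) ≤ Real.exp (x / 2) := by
      rw [Real.rpow_def_of_pos (by norm_num)]
      apply Real.exp_le_exp.2
      have := Real.log_two_lt_d9
      nlinarith
    have h3 : Real.log (1 + x) * (2 : ℝ) ^ (x / 2) ≤ x * Real.exp (x / 2) := by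
      gcongr
    refine h3.trans ?_
    rw [le_div_iff₀ hx0]
    nlinarith
  · rw [hq, ← Real.exp_nat_mul]
    rw [← Real.log_le_log_iff (Real.exp_pos _) hA0, Real.log_exp, hLx]
    have : (200 : ℕ) * (2 * Real.exp x / x) = Real.exp x * (400 / x) := by push_cast; ring
    rw [this]
    apply mul_le_of_le_one_right hex.le
    rw [div_le_one hx0]; exact hx80
  all_goals
    rw [hq, theta, ← hx, ← Real.exp_nat_mul, ← Real.exp_neg,
      Real.rpow_def_of_pos hA0, hLx]
    nth_rewrite 1 [show A = Real.exp (Real.exp x) by rw [← hLx, Real.exp_log hA0]]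
    rw [← Real.exp_neg, ← Real.exp_add]
    apply Real.exp_le_exp.2
    have hx28 : 0 < x - 28 := by linarith
    -- The excess `28/(x - 28)` of `1/θ` over `1` lies between `28/x` and `56/x`, which are the
    -- exponents of `q^14` and `q^28` as powers of `A`.
    have e : -1 / (1 - 28 / x) = -(1 + 28 / (x - 28)) := by
      have : (1 - 28 / x) = (x - 28) / x := by field_simp
      rw [this]; field_simp; ring
    rw [e]
    push_cast
  · have : 28 / x ≤ 28 / (x - 28) := by gcongr; linarith
    have h2 : Real.exp x * (28 / x) ≤ Real.exp x * (28 / (x - 28)) := by gcongr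
    have h3 : 14 * (2 * Real.exp x / x) = Real.exp x * (28 / x) := by ring
    rw [h3]; linarith
  · have : 28 / (x - 28) ≤ 56 / x := by
      rw [div_le_div_iff₀ hx28 hx0]; linarith
    have h2 : Real.exp x * (28 / (x - 28)) ≤ Real.exp x * (56 / x) := by gcongr
    have h3 : 28 * (2 * Real.exp x / x) = Real.exp x * (56 / x) := by ring
    rw [h3]; linarith

lemma natCeil_le_two_mul {r : ℝ} (hr : 1 ≤ r) : (⌈r⌉₊ : ℝ) ≤ 2 * r := by
  have := Nat.ceil_lt_add_one (by linarith : 0 ≤ r); linarith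

-- The three-range bound is applied at cut-offs `A q^j`. It suffices that `W L`, with `W = A^(-1/θ)`
-- and `L = log A`, lies below the energy gained beyond `Y₁` and above the tail beyond `Y₂`; `W` is
-- sandwiched between `A⁻¹ q⁻²⁸` and `A⁻¹ q⁻¹⁴`.
set_option maxHeartbeats 1000000 in
theorem exists_norm_Phi1_le : ∃ C₁ R : ℝ, 1 < C₁ ∧ ∀ α : ℂ, R ≤ ‖α‖ →
    ‖Phi1 α‖ ≤ Real.exp (-(Real.pi ^ 2 / 2) * (C₁⁻¹ * α.re ^ 2 - C₁ * α.im ^ 2) *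
        ‖α‖ ^ (-1 / theta 28 ‖α‖) * Real.log ‖α‖ + C₁ * |α.im| * Real.log ‖α‖) := by
  obtain ⟨C, hC, hS⟩ := exists_phiBound_le
  obtain ⟨C', hC', hsum⟩ := exists_sum_phiBound_le
  obtain ⟨R, hR⟩ := exists_scale (4000 + 60 * C + 2 * C ^ 2)
  -- The `6` gives `3π² ≤ (π²/2) C₁`; the `13` exceeds `4π`, which arises from `2π · C' log Y₂` with
  -- `log Y₂ ≤ 2 log A`.
  refine ⟨6 + 13 * C', max R 1, by linarith, fun α hα => ?_⟩
  set A := ‖α‖ with hAdef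
  obtain ⟨ε, q, hε, hε8, hqA, hq1, hqK, hL1, hLq, hDq, hq200, hup, hlow⟩ :=
    hR A ((le_max_left _ _).trans hα)
  have hA1 : 1 ≤ A := (le_max_right _ _).trans hα
  have hA0 : 0 < A := by linarith
  have hq0 : 0 < q := by linarith
  have hq40 : q ^ 40 ≤ A := (pow_le_pow_right₀ hq1 (by norm_num)).trans hq200
  have hqC : 60 * C ≤ q := by linarith [sq_nonneg C]
  have hqC2 : 2 * C ^ 2 ≤ q := by linarith
  have hq4000 : 4000 ≤ q := by linarith [sq_nonneg C]
  have hpi := Real.pi_pos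
  have hpi4 := Real.pi_lt_four
  set W := A ^ (-1 / theta 28 A) with hW
  have hW0 : 0 < W := Real.rpow_pos_of_pos hA0 _
  set L := Real.log A with hL
  -- numbers up to `A ^ 2` have small `ε`-th power
  have hpow : ∀ y : ℝ, 0 ≤ y → y ≤ A ^ 2 → y ^ ε ≤ q ^ 2 := by
    intro y hy0 hy
    calc y ^ ε ≤ (A ^ 2) ^ ε := by gcongr
      _ = q ^ 2 := by
        rw [hqA, ← Real.rpow_natCast, ← Real.rpow_mul hA0.le, mul_comm, Real.rpow_mul hA0.le,
          Real.rpow_natCast]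
  have hceil : ∀ j : ℕ, j ≤ 39 → A * q ^ j ≤ (⌈A * q ^ j⌉₊ : ℝ) ∧
      (⌈A * q ^ j⌉₊ : ℝ) ≤ 2 * (A * q ^ j) ∧ (⌈A * q ^ j⌉₊ : ℝ) ≤ A ^ 2 := by
    intro j hj
    have h1 : 1 ≤ A * q ^ j := one_le_mul_of_one_le_of_one_le hA1 (one_le_pow₀ hq1)
    have h2 := natCeil_le_two_mul h1
    refine ⟨Nat.le_ceil _, h2, h2.trans ?_⟩
    calc 2 * (A * q ^ j) ≤ q * (A * q ^ j) := by gcongr; linarith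
      _ = A * q ^ (j + 1) := by ring
      _ ≤ A * q ^ 40 := by gcongr; omega
      _ ≤ A * A := by gcongr
      _ = A ^ 2 := by ring
  obtain ⟨hY1l, hY1u, hY1A⟩ := hceil 4 (by norm_num)
  obtain ⟨hNl, hNu, hNA⟩ := hceil 12 (by norm_num)
  obtain ⟨hY2l, hY2u, hY2A⟩ := hceil 35 (by norm_num)
  -- Beyond `Y₁`, `phiBound m ≤ C q · q² / (A q⁴)`, leaving one `q` to beat constants. The ratio
  -- `N/Y₁ ≈ q⁸` beats `(r₂ bound)² ≈ q⁶`, so the energy up to `N` is at least `1/(8π²N)`, above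
  -- `A⁻¹ q⁻¹³ ≥ W L`. At `Y₂` the tail is `q³ · q⁴ / (A q³⁵) = A⁻¹ q⁻²⁸ ≤ W`.
  set Y₁ := ⌈A * q ^ 4⌉₊ with hY1
  set N := ⌈A * q ^ 12⌉₊ with hN
  set Y₂ := ⌈A * q ^ 35⌉₊ with hY2
  have hY1N : Y₁ ≤ N := Nat.ceil_le_ceil (by gcongr; norm_num)
  have hNY2 : N ≤ Y₂ := Nat.ceil_le_ceil (by gcongr; norm_num)
  have hY10 : (0 : ℝ) < Y₁ := lt_of_lt_of_le (by positivity) hY1l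
  have hY20 : (0 : ℝ) < Y₂ := lt_of_lt_of_le (by positivity) hY2l
  have hN0 : (0 : ℝ) < N := lt_of_lt_of_le (by positivity) hNl
  -- the single-term bound
  have hSq : ∀ m : ℕ, m ≠ 0 → phiBound m ≤ C * q * (m : ℝ) ^ (ε - 1) := by
    intro m hm
    refine (hS ε hε m hm).trans ?_
    gcongr
  have hsmall : ∀ m, Y₁ < m → 2 * Real.pi * A * phiBound m ≤ 1 / 8 := by
    intro m hm
    have hmY : (Y₁ : ℝ) ≤ m := by exact_mod_cast hm.le
    have h1 : phiBound m ≤ C * q * (Y₁ : ℝ) ^ (ε - 1) := by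
      refine (hSq m (by omega)).trans ?_
      gcongr C * q * ?_
      exact Real.rpow_le_rpow_of_nonpos hY10 hmY (by linarith)
    have h2 : (Y₁ : ℝ) ^ (ε - 1) ≤ q ^ 2 / (A * q ^ 4) := by
      rw [Real.rpow_sub_one hY10.ne']
      have := hpow Y₁ hY10.le hY1A
      gcongr
    calc 2 * Real.pi * A * phiBound m ≤ 2 * Real.pi * A * (C * q * (q ^ 2 / (A * q ^ 4))) := by
          gcongr; exact h1.trans (by gcongr)
      _ = 2 * Real.pi * C / q := by field_simp
      _ ≤ 1 / 8 := by
          rw [div_le_div_iff₀ hq0 (by norm_num)]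
          have : Real.pi * C ≤ 3.15 * C := by gcongr; exact Real.pi_lt_d2.le
          linarith
  -- the second moment from below
  have hE : ∀ M, N ≤ M → W * L ≤ ∑ m ∈ Finset.Ioc Y₁ M, energy m := by
    intro M hM
    have hQ : ∀ n, 1 ≤ n → n ≤ N → (r2 n : ℝ) ≤ 4 * q ^ 3 := by
      intro n hn hnN
      have h1 : (r2 n : ℝ) ≤ 4 * (n.divisors.card : ℝ) := by
        exact_mod_cast r2_le_four_mul_card_divisors n (by omega)
      have h2 := card_divisors_le_mul_rpow hε (n := n) (by omega)
      have h3 : (n : ℝ) ^ ε ≤ q ^ 2 :=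
        hpow n (by positivity) (le_trans (by exact_mod_cast hnN) hNA)
      have h4 : divisorConst ε * (n : ℝ) ^ ε ≤ q * q ^ 2 := by gcongr
      calc (r2 n : ℝ) ≤ 4 * (q * q ^ 2) := h1.trans (by linarith)
        _ = 4 * q ^ 3 := by ring
    have h1 := le_sum_weight_sq_coef_sq Y₁ N (by exact_mod_cast hN0) (4 * q ^ 3) hQ
    have hbad : 2 * (4 * q ^ 3) * (Real.sqrt N * Real.sqrt Y₁) ≤ (N : ℝ) / 4 := by
      rw [← Real.sqrt_mul hN0.le]
      have hY1N' : 1024 * q ^ 6 * (Y₁ : ℝ) ≤ N := by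
        calc 1024 * q ^ 6 * (Y₁ : ℝ) ≤ 1024 * q ^ 6 * (2 * (A * q ^ 4)) := by gcongr
          _ = 2048 * (A * q ^ 10) := by ring
          _ ≤ q ^ 2 * (A * q ^ 10) := by
              gcongr
              exact (show 2048 ≤ q by linarith).trans (le_self_pow₀ hq1 (by norm_num))
          _ = A * q ^ 12 := by ring
          _ ≤ N := hNl
      have h2 : Real.sqrt (N * Y₁) ≤ N / (32 * q ^ 3) := by
        rw [Real.sqrt_le_left (by positivity), div_pow, le_div_iff₀ (by positivity)]
        calc (N : ℝ) * Y₁ * (32 * q ^ 3) ^ 2 = N * (1024 * q ^ 6 * (Y₁ : ℝ)) := by ring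
          _ ≤ (N : ℝ) * N := by gcongr
          _ = (N : ℝ) ^ 2 := by ring
      calc 2 * (4 * q ^ 3) * Real.sqrt ((N : ℝ) * Y₁)
          ≤ 2 * (4 * q ^ 3) * ((N : ℝ) / (32 * q ^ 3)) := by gcongr
        _ = (N : ℝ) / 4 := by field_simp; norm_num
    have hN8 : (8 : ℝ) ≤ N := by
      refine le_trans ?_ hNl
      calc (8 : ℝ) ≤ 1 * q := by linarith
        _ = 1 * q ^ 1 := by ring
        _ ≤ A * q ^ 12 := by gcongr; norm_num
    have h2 : 1 / (8 * (N : ℝ)) ≤ ∑ m ∈ Finset.Ioc Y₁ N,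
        weight m ^ 2 * ∑ k ∈ Finset.range N, coef m k ^ 2 := by
      refine le_trans ?_ h1
      calc 1 / (8 * (N : ℝ)) = (N / 8) / (N : ℝ) ^ 2 := by field_simp
        _ ≤ _ := by gcongr; linarith
    have h3 : 1 / Real.pi ^ 2 * (1 / (8 * (N : ℝ))) ≤ ∑ m ∈ Finset.Ioc Y₁ M, energy m := by
      calc 1 / Real.pi ^ 2 * (1 / (8 * (N : ℝ)))
          ≤ 1 / Real.pi ^ 2 * ∑ m ∈ Finset.Ioc Y₁ N,
            weight m ^ 2 * ∑ k ∈ Finset.range N, coef m k ^ 2 := by gcongr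
        _ ≤ ∑ m ∈ Finset.Ioc Y₁ N, energy m := by
            rw [Finset.mul_sum]
            exact Finset.sum_le_sum fun m _ => le_energy m N
        _ ≤ _ := Finset.sum_le_sum_of_subset_of_nonneg (Finset.Ioc_subset_Ioc_right hM)
            fun m _ _ => energy_nonneg m
    refine le_trans ?_ h3
    calc W * L ≤ A⁻¹ * (q ^ 14)⁻¹ * q := by gcongr
      _ = 1 / (q * (A * q ^ 12)) := by field_simp
      _ ≤ 1 / (16 ^ 2 * (A * q ^ 12)) := by gcongr; linarith
      _ ≤ 1 / (Real.pi ^ 2 * (8 * N)) := by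
          refine one_div_le_one_div_of_le (by positivity) ?_
          calc Real.pi ^ 2 * (8 * (N : ℝ)) ≤ 4 ^ 2 * (8 * (2 * (A * q ^ 12))) := by gcongr
            _ = 16 ^ 2 * (A * q ^ 12) := by ring
      _ = _ := by rw [div_mul_div_comm, one_mul]
  -- the tail of the second moments from above
  have htail : ∀ M, Y₂ ≤ M → ∑ m ∈ Finset.Ioc Y₂ M, phiBound m ^ 2 ≤ W * L := by
    intro M hM
    have hterm : ∀ m ∈ Finset.Ioc Y₂ M, phiBound m ^ 2 ≤
        (C * q) ^ 2 * (Y₂ : ℝ) ^ (2 * ε - 1 / 2) * (m : ℝ) ^ (-3 / 2 : ℝ) := by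
      intro m hm
      have hmY := (Finset.mem_Ioc.1 hm).1
      have hmY' : (Y₂ : ℝ) ≤ m := by exact_mod_cast hmY.le
      have hm0 : (0 : ℝ) < m := hY20.trans_le hmY'
      calc phiBound m ^ 2 ≤ (C * q * (m : ℝ) ^ (ε - 1)) ^ 2 :=
            pow_le_pow_left₀ (phiBound_nonneg m) (hSq m (by omega)) 2
        _ = (C * q) ^ 2 * ((m : ℝ) ^ (2 * ε - 1 / 2) * (m : ℝ) ^ (-3 / 2 : ℝ)) := by
            rw [mul_pow, ← Real.rpow_natCast ((m : ℝ) ^ (ε - 1)), ← Real.rpow_mul hm0.le,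
              ← Real.rpow_add hm0]
            congr 2; push_cast; ring
        _ ≤ (C * q) ^ 2 * ((Y₂ : ℝ) ^ (2 * ε - 1 / 2) * (m : ℝ) ^ (-3 / 2 : ℝ)) := by
            gcongr (C * q) ^ 2 * (?_ * _)
            exact Real.rpow_le_rpow_of_nonpos hY20 hmY' (by linarith)
        _ = _ := by ring
    have hY21 : 1 ≤ Y₂ := by exact_mod_cast hY20
    have h32 := sum_rpow_neg_three_halves_le hY21 M hM
    have h32' : ∑ m ∈ Finset.Ioc Y₂ M, (m : ℝ) ^ (-3 / 2 : ℝ) ≤ 2 * (Y₂ : ℝ) ^ (-1 / 2 : ℝ) := by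
      refine h32.trans ?_
      have e : 2 / Real.sqrt Y₂ = 2 * (Y₂ : ℝ) ^ (-1 / 2 : ℝ) := by
        rw [Real.sqrt_eq_rpow, div_eq_mul_inv, ← Real.rpow_neg hY20.le]; norm_num
      rw [← e]
      have : 0 ≤ 2 / Real.sqrt M := by positivity
      linarith
    calc ∑ m ∈ Finset.Ioc Y₂ M, phiBound m ^ 2
        ≤ ∑ m ∈ Finset.Ioc Y₂ M,
          (C * q) ^ 2 * (Y₂ : ℝ) ^ (2 * ε - 1 / 2) * (m : ℝ) ^ (-3 / 2 : ℝ) :=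
          Finset.sum_le_sum hterm
      _ ≤ (C * q) ^ 2 * (Y₂ : ℝ) ^ (2 * ε - 1 / 2) * (2 * (Y₂ : ℝ) ^ (-1 / 2 : ℝ)) := by
          rw [← Finset.mul_sum]; gcongr
      _ = 2 * C ^ 2 * q ^ 2 * (((Y₂ : ℝ) ^ ε) ^ 2 / Y₂) := by
          have : (Y₂ : ℝ) ^ (2 * ε - 1 / 2) * (Y₂ : ℝ) ^ (-1 / 2 : ℝ) = ((Y₂ : ℝ) ^ ε) ^ 2 / Y₂ := by
            rw [← Real.rpow_add hY20, ← Real.rpow_natCast, ← Real.rpow_mul hY20.le,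
              ← Real.rpow_sub_one hY20.ne']
            congr 1; push_cast; ring
          rw [← this]; ring
      _ ≤ q * q ^ 2 * ((q ^ 2) ^ 2 / (A * q ^ 35)) := by
          have := hpow Y₂ hY20.le hY2A
          gcongr
      _ = A⁻¹ * (q ^ 28)⁻¹ := by field_simp
      _ ≤ W := hlow
      _ ≤ W * L := le_mul_of_one_le_right hW0.le hL1
  have hlin : ∑ m ∈ Finset.Icc 1 Y₂, phiBound m ≤ 2 * C' * L := by
    have h2 : 2 ≤ Y₂ := by
      have : (2 : ℝ) ≤ Y₂ := by
        refine le_trans ?_ hY2l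
        calc (2 : ℝ) ≤ 1 * q ^ 1 := by linarith
          _ ≤ A * q ^ 35 := by gcongr; norm_num
      exact_mod_cast this
    refine (hsum Y₂ h2).trans ?_
    have : Real.log Y₂ ≤ 2 * L := by
      rw [hL, ← Nat.cast_ofNat, ← Real.log_pow]
      exact Real.log_le_log hY20 hY2A
    calc C' * Real.log Y₂ ≤ C' * (2 * L) := by gcongr
      _ = _ := by ring
  -- The bounds are uniform in `M`, so it is enough to treat finite products with `M ≥ Y₂`.
  refine le_of_tendsto (tendsto_limitM α).norm ?_
  filter_upwards [Filter.eventually_ge_atTop Y₂] with M hM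
  refine (norm_limitM_le α (hY1N.trans hNY2) hM hsmall).trans (Real.exp_le_exp.2 ?_)
  have hL0 : 0 < L := by linarith
  have hWL : 0 < W * L := by positivity
  have t1 : 2 * Real.pi * |α.im| * ∑ m ∈ Finset.Icc 1 Y₂, phiBound m ≤
      (6 + 13 * C') * |α.im| * L := by
    calc _ ≤ 2 * Real.pi * |α.im| * (2 * C' * L) := by gcongr
      _ = (4 * Real.pi * C') * |α.im| * L := by ring
      _ ≤ _ := by
        gcongr
        have : Real.pi * C' ≤ 3.15 * C' := by gcongr; exact Real.pi_lt_d2.le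
        linarith
  have t2 : Real.pi ^ 2 * α.re ^ 2 * (W * L) ≤
      Real.pi ^ 2 * α.re ^ 2 * ∑ m ∈ Finset.Ioc Y₁ M, energy m := by
    gcongr; exact hE M (hNY2.trans hM)
  have t3 : 3 * Real.pi ^ 2 * α.im ^ 2 * ∑ m ∈ Finset.Ioc Y₂ M, phiBound m ^ 2 ≤
      3 * Real.pi ^ 2 * α.im ^ 2 * (W * L) := by
    gcongr; exact htail M hM
  have t4 : Real.pi ^ 2 / 2 * (6 + 13 * C')⁻¹ * α.re ^ 2 * (W * L) ≤
      Real.pi ^ 2 * α.re ^ 2 * (W * L) := by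
    have : (6 + 13 * C')⁻¹ ≤ 1 := inv_le_one_of_one_le₀ (by linarith)
    have h0 : 0 ≤ Real.pi ^ 2 * α.re ^ 2 * (W * L) := by positivity
    calc _ = (6 + 13 * C')⁻¹ / 2 * (Real.pi ^ 2 * α.re ^ 2 * (W * L)) := by ring
      _ ≤ _ := mul_le_of_le_one_left h0 (by linarith)
  have t5 : 3 * Real.pi ^ 2 * α.im ^ 2 * (W * L) ≤
      Real.pi ^ 2 / 2 * (6 + 13 * C') * α.im ^ 2 * (W * L) := by
    have h0 : 0 ≤ C' * (Real.pi ^ 2 * α.im ^ 2 * (W * L)) := by positivity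
    linarith
  linarith

/-! ### Decay of `Φ₁` near the real axis and contour shifting -/

lemma exists_rpow_theta_bounds : ∃ R : ℝ, 1 ≤ R ∧ ∀ A : ℝ, R ≤ A → 1 ≤ Real.log A ∧
    A ^ (-1 / theta 28 A) * Real.log A ≤ A⁻¹ ∧ A ^ (-5 / 4 : ℝ) ≤ A ^ (-1 / theta 28 A) := by
  obtain ⟨R, hR⟩ := exists_scale 1
  refine ⟨max R 1, le_max_right _ _, fun A hA => ?_⟩
  have hA0 : 0 < A := zero_lt_one.trans_le ((le_max_right _ _).trans hA)
  obtain ⟨ε, q, -, -, -, hq1, -, hL1, hLq, -, hq200, hup, hlow⟩ := hR A ((le_max_left _ _).trans hA)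
  have hq0 : 0 < q := by linarith
  refine ⟨hL1, ?_, le_trans ?_ hlow⟩
  · calc A ^ (-1 / theta 28 A) * Real.log A ≤ A⁻¹ * (q ^ 14)⁻¹ * q := by gcongr
      _ = A⁻¹ * (q ^ 13)⁻¹ := by field_simp
      _ ≤ A⁻¹ * 1 := by gcongr; exact inv_le_one_of_one_le₀ (one_le_pow₀ hq1)
      _ = A⁻¹ := mul_one _
  · have h1 : q ^ 28 ≤ A ^ (1 / 4 : ℝ) := by
      calc q ^ 28 ≤ q ^ 50 := by gcongr; norm_num
        _ = ((q ^ 50) ^ 4) ^ (1 / 4 : ℝ) := by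
          rw [← Real.rpow_natCast (q ^ 50) 4, ← Real.rpow_mul (by positivity)]; norm_num
        _ ≤ A ^ (1 / 4 : ℝ) := by
          gcongr; rw [← pow_mul]; exact hq200
    have e : A ^ (-5 / 4 : ℝ) = A⁻¹ * (A ^ (1 / 4 : ℝ))⁻¹ := by
      rw [← Real.rpow_neg hA0.le, ← Real.rpow_neg_one, ← Real.rpow_add hA0]; norm_num
    rw [e]; gcongr

/-- When `τ² ≤ |σ|`, the gain is of order at least `σ² |σ|^(-5/4) = |σ|^(3/4)` times the logarithm,
which beats the loss `C|τ| log|α| ≤ C|σ|^(1/2) log|α|`. The region widens with `|σ|`, so it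
eventually contains any strip. -/
lemma exists_norm_Phi1_le_exp_neg_sqrt : ∃ K : ℝ, 1 ≤ K ∧ ∀ α : ℂ, K ≤ |α.re| →
    α.im ^ 2 ≤ |α.re| → ‖Phi1 α‖ ≤ Real.exp (-Real.sqrt |α.re|) := by
  obtain ⟨C, R, hC, h⟩ := exists_norm_Phi1_le
  obtain ⟨R', hR'1, hR'⟩ := exists_rpow_theta_bounds
  refine ⟨max (max R R') (max (2 * C ^ 2) ((2 * C * (C + 1)) ^ 4)),
    hR'1.trans ((le_max_right _ _).trans (le_max_left _ _)), fun α hα him => ?_⟩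
  set s := |α.re| with hs
  have hsR : R ≤ s := (le_max_left _ _).trans ((le_max_left _ _).trans hα)
  have hsR' : R' ≤ s := (le_max_right _ _).trans ((le_max_left _ _).trans hα)
  have hs2 : 2 * C ^ 2 ≤ s := (le_max_left _ _).trans ((le_max_right _ _).trans hα)
  have hs4 : (2 * C * (C + 1)) ^ 4 ≤ s := (le_max_right _ _).trans ((le_max_right _ _).trans hα)
  have hs1 : 1 ≤ s := hR'1.trans hsR'
  have hsA : s ≤ ‖α‖ := Complex.abs_re_le_norm α
  have himS : |α.im| ≤ Real.sqrt s := Real.abs_le_sqrt him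
  have hsqrt : Real.sqrt s ≤ s := by
    rw [Real.sqrt_le_left (by linarith)]; nlinarith
  have hA2 : ‖α‖ ≤ 2 * s := (Complex.norm_le_abs_re_add_abs_im α).trans (by linarith)
  obtain ⟨hL1, -, hW⟩ := hR' ‖α‖ (hsR'.trans hsA)
  refine (h α (hsR.trans hsA)).trans (Real.exp_le_exp.2 ?_)
  set A := ‖α‖
  set W := A ^ (-1 / theta 28 A)
  set L := Real.log A
  have hC0 : 0 < C := by linarith
  have hs0 : 0 < s := by linarith
  have hA0 : 0 < A := by linarith
  have hre : α.re ^ 2 = s ^ 2 := (sq_abs _).symm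
  -- `u` is the fourth root of `s`
  set u := s ^ (1 / 4 : ℝ) with hu
  have hu0 : 0 < u := Real.rpow_pos_of_pos hs0 _
  have hu4 : u ^ 4 = s := by
    rw [hu, ← Real.rpow_natCast, ← Real.rpow_mul hs0.le]; norm_num
  have hu2 : Real.sqrt s = u ^ 2 := by
    rw [Real.sqrt_eq_iff_mul_self_eq hs0.le (by positivity), ← hu4]; ring
  have huC : 2 * C * (C + 1) ≤ u := by
    have : (2 * C * (C + 1)) ^ 4 ≤ u ^ 4 := by rw [hu4]; exact hs4
    exact le_of_pow_le_pow_left₀ (by norm_num) hu0.le this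
  have hWs : 1 / (4 * u ^ 5) ≤ W := by
    refine le_trans ?_ hW
    calc 1 / (4 * u ^ 5) ≤ (2 : ℝ) ^ (-5 / 4 : ℝ) * s ^ (-5 / 4 : ℝ) := by
          have e : s ^ (-5 / 4 : ℝ) = (u ^ 5)⁻¹ := by
            rw [hu, ← Real.rpow_natCast, ← Real.rpow_mul hs0.le, ← Real.rpow_neg hs0.le]; norm_num
          have e2 : (1 / 4 : ℝ) ≤ (2 : ℝ) ^ (-5 / 4 : ℝ) := by
            calc (1 / 4 : ℝ) = (2 : ℝ) ^ (-2 : ℝ) := by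
                  rw [Real.rpow_neg (by norm_num)]; norm_num
              _ ≤ _ := Real.rpow_le_rpow_of_exponent_le (by norm_num) (by norm_num)
          rw [e]
          calc 1 / (4 * u ^ 5) = 1 / 4 * (u ^ 5)⁻¹ := by field_simp
            _ ≤ _ := by gcongr
      _ = (2 * s) ^ (-5 / 4 : ℝ) := (Real.mul_rpow (by norm_num) hs0.le).symm
      _ ≤ A ^ (-5 / 4 : ℝ) := Real.rpow_le_rpow_of_nonpos hA0 hA2 (by norm_num)
  have hcoef : C⁻¹ * s ^ 2 / 2 ≤ C⁻¹ * α.re ^ 2 - C * α.im ^ 2 := by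
    have h1 : C * α.im ^ 2 ≤ C⁻¹ * s ^ 2 / 2 := by
      calc C * α.im ^ 2 ≤ C * s := by gcongr
        _ = C⁻¹ * (2 * C ^ 2) * s / 2 := by field_simp
        _ ≤ C⁻¹ * s * s / 2 := by gcongr
        _ = _ := by ring
    rw [hre]; linarith
  have hmain : (C + 1) * u ^ 2 ≤ Real.pi ^ 2 / 2 * (C⁻¹ * α.re ^ 2 - C * α.im ^ 2) * W := by
    have hpi : 9 ≤ Real.pi ^ 2 := by nlinarith [Real.pi_gt_three]
    calc (C + 1) * u ^ 2 = (2 * C * (C + 1)) * (C⁻¹ * u ^ 2 / 2) := by field_simp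
      _ ≤ u * (C⁻¹ * u ^ 2 / 2) := by gcongr
      _ = 4 * (C⁻¹ * s ^ 2 / 2) * (1 / (4 * u ^ 5)) := by rw [← hu4]; field_simp
      _ ≤ Real.pi ^ 2 / 2 * (C⁻¹ * α.re ^ 2 - C * α.im ^ 2) * W :=
          mul_le_mul (mul_le_mul (by linarith) hcoef (by positivity) (by positivity)) hWs
            (by positivity) (mul_nonneg (by positivity) (le_trans (by positivity) hcoef))
  have hL0 : 0 ≤ L := by linarith
  have h1 : (C + 1) * u ^ 2 * L ≤
      Real.pi ^ 2 / 2 * (C⁻¹ * α.re ^ 2 - C * α.im ^ 2) * W * L := by gcongr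
  have h2 : C * |α.im| * L ≤ C * u ^ 2 * L := by rw [← hu2]; gcongr
  have h3 : u ^ 2 ≤ u ^ 2 * L := le_mul_of_one_le_right (by positivity) hL1
  rw [hu2]
  linarith

lemma exists_pow_mul_norm_Phi1_le : ∃ K : ℝ, 1 ≤ K ∧ ∀ j : ℕ, ∃ c : ℝ, 0 < c ∧ ∀ α : ℂ,
    K ≤ |α.re| → α.im ^ 2 ≤ |α.re| → ‖α‖ ^ j * ‖Phi1 α‖ ≤ c * (1 + α.re ^ 2)⁻¹ := by
  obtain ⟨K, hK, h⟩ := exists_norm_Phi1_le_exp_neg_sqrt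
  refine ⟨K, hK, fun j => ⟨2 ^ j * 2 * (2 * (j + 2)).factorial, by positivity, fun α hα him => ?_⟩⟩
  set s := |α.re| with hs
  have hs1 : 1 ≤ s := hK.trans hα
  have hs0 : 0 < s := by linarith
  have himS : |α.im| ≤ Real.sqrt s := Real.abs_le_sqrt him
  have hsqrt : Real.sqrt s ≤ s := by
    rw [Real.sqrt_le_left (by linarith)]; nlinarith
  have hA2 : ‖α‖ ≤ 2 * s := (Complex.norm_le_abs_re_add_abs_im α).trans (by linarith)
  have hre : α.re ^ 2 = s ^ 2 := (sq_abs _).symm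
  -- The `2(j+2)`-th term of the series of `exp(√s)` is `s^(j+2)/(2(j+2))!`; two powers beyond `s^j`
  -- pay for `1 + s²`.
  have h1 := Real.pow_div_factorial_le_exp (Real.sqrt s) (Real.sqrt_nonneg s) (2 * (j + 2))
  rw [pow_mul, Real.sq_sqrt hs0.le] at h1
  have hF : (0 : ℝ) < (2 * (j + 2)).factorial := by exact_mod_cast Nat.factorial_pos _
  rw [div_le_iff₀ hF] at h1
  have h2 : s ^ (j + 2) * Real.exp (-Real.sqrt s) ≤ (2 * (j + 2)).factorial := by
    calc s ^ (j + 2) * Real.exp (-Real.sqrt s)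
        ≤ Real.exp (Real.sqrt s) * (2 * (j + 2)).factorial * Real.exp (-Real.sqrt s) := by gcongr
      _ = (2 * (j + 2)).factorial * (Real.exp (Real.sqrt s) * Real.exp (-Real.sqrt s)) := by ring
      _ = _ := by rw [← Real.exp_add]; simp
  rw [← div_eq_mul_inv, le_div_iff₀ (by positivity), hre]
  calc ‖α‖ ^ j * ‖Phi1 α‖ * (1 + s ^ 2)
      ≤ (2 * s) ^ j * Real.exp (-Real.sqrt s) * (s ^ 2 + s ^ 2) := by
        gcongr
        · exact h α hα him
        · nlinarith
    _ = 2 ^ j * 2 * (s ^ (j + 2) * Real.exp (-Real.sqrt s)) := by ring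
    _ ≤ _ := by gcongr

lemma exists_strip_bound (j : ℕ) (T : ℝ) : ∃ B : ℝ, ∀ α : ℂ, |α.im| ≤ T →
    ‖α‖ ^ j * ‖Phi1 α‖ ≤ B * (1 + α.re ^ 2)⁻¹ := by
  obtain ⟨K, hK, h⟩ := exists_pow_mul_norm_Phi1_le
  obtain ⟨c, hc, h⟩ := h j
  -- Past `|σ| = Q` the strip lies in the region `τ² ≤ |σ|`; the remaining part is compact.
  set Q := max K (T ^ 2)
  have hcomp : IsCompact (Set.Icc (-Q) Q ×ℂ Set.Icc (-T) T) := isCompact_Icc.reProdIm isCompact_Icc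
  have hcont : Continuous fun α : ℂ => ‖α‖ ^ j * ‖Phi1 α‖ * (1 + α.re ^ 2) :=
    ((continuous_norm.pow j).mul differentiable_Phi1.continuous.norm).mul
      (continuous_const.add (Complex.continuous_re.pow 2))
  obtain ⟨b, hb⟩ := hcomp.exists_bound_of_continuousOn hcont.continuousOn
  refine ⟨max b c, fun α hα => ?_⟩
  by_cases hre : |α.re| ≤ Q
  · have h1 := hb α ⟨abs_le.1 hre, abs_le.1 hα⟩
    rw [← div_eq_mul_inv, le_div_iff₀ (by positivity)]
    exact (le_abs_self _).trans (h1.trans (le_max_left _ _))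
  · have him : α.im ^ 2 ≤ |α.re| := by
      rw [← sq_abs]
      calc |α.im| ^ 2 ≤ T ^ 2 := by gcongr
        _ ≤ Q := le_max_right _ _
        _ ≤ _ := (not_le.1 hre).le
    refine (h α ((le_max_left _ _).trans (not_le.1 hre).le) him).trans ?_
    gcongr
    exact le_max_right _ _

/-- Cauchy's theorem on the rectangle with vertices `±r`, `±r + iT`; the bound makes the vertical
sides `O(r⁻²)`. -/
lemma integral_eq_integral_add_mul_I {F : ℂ → ℂ} (hF : Differentiable ℂ F) {T B : ℝ}
    (hB : ∀ α : ℂ, |α.im| ≤ |T| → ‖F α‖ ≤ B * (1 + α.re ^ 2)⁻¹) :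
    ∫ x : ℝ, F x = ∫ x : ℝ, F (x + T * Complex.I) := by
  have hint : ∀ y : ℝ, |y| ≤ |T| →
      MeasureTheory.Integrable fun x : ℝ => F (x + y * Complex.I) := by
    intro y hy
    refine (integrable_inv_one_add_sq.const_mul B).mono' ?_ (.of_forall fun x => ?_)
    · exact (hF.continuous.comp (by fun_prop)).aestronglyMeasurable
    · simpa using hB (x + y * Complex.I) (by simpa using hy)
  have h0 := MeasureTheory.intervalIntegral_tendsto_integral (hint 0 (by simp))
    Filter.tendsto_neg_atTop_atBot Filter.tendsto_id
  have hT := MeasureTheory.intervalIntegral_tendsto_integral (hint T le_rfl)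
    Filter.tendsto_neg_atTop_atBot Filter.tendsto_id
  have hside : ∀ f : ℝ → ℝ, (∀ r, (f r) ^ 2 = r ^ 2) → Filter.Tendsto (fun r : ℝ =>
      Complex.I • ∫ y : ℝ in (0 : ℝ)..T, F ((f r : ℂ) + y * Complex.I)) Filter.atTop (nhds 0) := by
    intro f hf
    have hlim : Filter.Tendsto (fun r : ℝ => B * (1 + r ^ 2)⁻¹ * |T - 0|) Filter.atTop (nhds 0) := by
      have h1 : Filter.Tendsto (fun r : ℝ => (1 + r ^ 2)) Filter.atTop Filter.atTop :=
        Filter.tendsto_atTop_add_const_left _ _ (Filter.tendsto_pow_atTop (by norm_num))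
      simpa using (h1.inv_tendsto_atTop.const_mul B).mul_const |T - 0|
    refine squeeze_zero_norm (fun r => ?_) hlim
    rw [norm_smul, Complex.norm_I, one_mul]
    refine intervalIntegral.norm_integral_le_of_norm_le_const fun y hy => ?_
    have hy' : |y| ≤ |T| := by
      have := Set.abs_sub_left_of_mem_uIcc (Set.uIoc_subset_uIcc hy)
      simpa using this
    have := hB ((f r : ℂ) + y * Complex.I) (by simpa using hy')
    simpa [hf] using this
  have hR := hside id (fun r => rfl)
  have hL := hside Neg.neg (fun r => by ring)
  have hrect : ∀ r : ℝ, (∫ x : ℝ in -r..r, F (x + (0 : ℝ) * Complex.I)) -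
      (∫ x : ℝ in -r..r, F (x + T * Complex.I)) +
      Complex.I • (∫ y : ℝ in (0 : ℝ)..T, F ((id r : ℝ) + y * Complex.I)) -
      Complex.I • (∫ y : ℝ in (0 : ℝ)..T, F ((-r : ℝ) + y * Complex.I)) = 0 := by
    intro r
    have := Complex.integral_boundary_rect_eq_zero_of_differentiableOn F ⟨-r, 0⟩ ⟨r, T⟩
      hF.differentiableOn
    exact this
  have hlim := ((h0.sub hT).add hR).sub hL
  have hzero := hlim.congr (f₂ := fun _ => (0 : ℂ)) hrect
  have := tendsto_nhds_unique hzero tendsto_const_nhds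
  simp only [add_zero, sub_zero, sub_eq_zero] at this
  simpa using this

/-! ### Smoothness and decay of `P₁` -/

lemma integrable_pow_mul_Phi1 (j : ℕ) :
    MeasureTheory.Integrable fun σ : ℝ => σ ^ j • Phi1 (σ : ℂ) := by
  obtain ⟨B, hB⟩ := exists_strip_bound j 0
  refine (integrable_inv_one_add_sq.const_mul B).mono' ?_ (.of_forall fun σ => ?_)
  · refine Continuous.aestronglyMeasurable ?_
    exact (continuous_pow j).smul
      (differentiable_Phi1.continuous.comp Complex.continuous_ofReal)
  · simpa [norm_smul] using hB (σ : ℂ) (by simp)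

theorem integrable_Phi1 : MeasureTheory.Integrable fun σ : ℝ => Phi1 (σ : ℂ) := by
  simpa using integrable_pow_mul_Phi1 0

theorem contDiff_P1 : ContDiff ℝ (⊤ : ℕ∞) P1 := by
  refine Real.contDiff_fourier fun n _ => ?_
  simpa [norm_smul] using (integrable_pow_mul_Phi1 n).norm

/-- The integrand of `P₁⁽ʲ⁾(x)`, continued to the complex plane. -/
def derivIntegrand (j : ℕ) (x : ℝ) (α : ℂ) : ℂ :=
  Complex.exp (-2 * Real.pi * Complex.I * x * α) *
    ((-2 * Real.pi * Complex.I * α) ^ j * Phi1 α)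

lemma iteratedDeriv_P1 (j : ℕ) (x : ℝ) :
    iteratedDeriv j P1 x = ∫ σ : ℝ, derivIntegrand j x σ := by
  have := Real.iteratedDeriv_fourier (f := fun σ : ℝ => Phi1 (σ : ℂ)) (N := ⊤) (n := j)
    (fun n _ => integrable_pow_mul_Phi1 n) le_top
  rw [P1, this, Real.fourier_real_eq_integral_exp_smul]
  congr 1
  ext σ
  simp only [derivIntegrand, smul_eq_mul]
  congr 2
  push_cast
  ring

lemma differentiable_derivIntegrand (j : ℕ) (x : ℝ) : Differentiable ℂ (derivIntegrand j x) := by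
  unfold derivIntegrand
  have := differentiable_Phi1
  fun_prop

lemma norm_derivIntegrand (j : ℕ) (x : ℝ) (α : ℂ) : ‖derivIntegrand j x α‖ =
    Real.exp (2 * Real.pi * x * α.im) * ((2 * Real.pi) ^ j * (‖α‖ ^ j * ‖Phi1 α‖)) := by
  rw [derivIntegrand, norm_mul, norm_mul, Complex.norm_exp, norm_pow]
  have e1 : (-2 * (Real.pi : ℂ) * Complex.I * x * α).re = 2 * Real.pi * x * α.im := by simp
  have e2 : ‖-2 * (Real.pi : ℂ) * Complex.I * α‖ = 2 * Real.pi * ‖α‖ := by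
    simp [abs_of_pos Real.pi_pos]
  rw [e1, e2, mul_pow]
  ring

lemma iteratedDeriv_P1_eq_shift (j : ℕ) (x T : ℝ) :
    iteratedDeriv j P1 x = ∫ σ : ℝ, derivIntegrand j x (σ + T * Complex.I) := by
  rw [iteratedDeriv_P1]
  obtain ⟨B, hB⟩ := exists_strip_bound j |T|
  refine integral_eq_integral_add_mul_I (differentiable_derivIntegrand j x)
    (B := Real.exp (2 * Real.pi * |x| * |T|) * ((2 * Real.pi) ^ j * B)) fun α hα => ?_
  rw [norm_derivIntegrand]
  have h1 := hB α hα
  have hpi := Real.pi_pos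
  have h2 : 2 * Real.pi * x * α.im ≤ 2 * Real.pi * |x| * |T| := by
    calc 2 * Real.pi * x * α.im ≤ |2 * Real.pi * x * α.im| := le_abs_self _
      _ = 2 * Real.pi * |x| * |α.im| := by
        rw [abs_mul, abs_mul, abs_of_pos Real.two_pi_pos]
      _ ≤ _ := by gcongr
  calc _ ≤ Real.exp (2 * Real.pi * |x| * |T|) * ((2 * Real.pi) ^ j * (B * (1 + α.re ^ 2)⁻¹)) := by
        gcongr
    _ = _ := by ring

/-- On the line `|τ| = T` the term in `σ²` only helps. The term in `τ²` is at most `5CT` since `W L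
≤ 1/A ≤ 1/T`, and `log A ≤ 1 + 2 log T` bounds the linear term. -/
lemma norm_Phi1_le_of_re_le {C R R' T : ℝ} (hC : 1 < C)
    (h : ∀ α : ℂ, R ≤ ‖α‖ → ‖Phi1 α‖ ≤
      Real.exp (-(Real.pi ^ 2 / 2) * (C⁻¹ * α.re ^ 2 - C * α.im ^ 2) *
        ‖α‖ ^ (-1 / theta 28 ‖α‖) * Real.log ‖α‖ + C * |α.im| * Real.log ‖α‖))
    (hR' : ∀ A : ℝ, R' ≤ A → 1 ≤ Real.log A ∧
      A ^ (-1 / theta 28 A) * Real.log A ≤ A⁻¹ ∧ A ^ (-5 / 4 : ℝ) ≤ A ^ (-1 / theta 28 A))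
    (hT1 : 1 ≤ T) (hTR : R ≤ T) (hTR' : R' ≤ T) {α : ℂ} (him : |α.im| = T)
    (hre : |α.re| ≤ T ^ 2) :
    ‖α‖ ≤ 2 * T ^ 2 ∧ ‖Phi1 α‖ ≤ Real.exp (6 * C * T + 2 * C * T * Real.log T) := by
  have hTA : T ≤ ‖α‖ := him ▸ Complex.abs_im_le_norm α
  have hA2 : ‖α‖ ≤ 2 * T ^ 2 := by
    have := Complex.norm_le_abs_re_add_abs_im α
    nlinarith
  refine ⟨hA2, (h α (hTR.trans hTA)).trans (Real.exp_le_exp.2 ?_)⟩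
  obtain ⟨hL1, hWL, -⟩ := hR' ‖α‖ (hTR'.trans hTA)
  set A := ‖α‖
  set W := A ^ (-1 / theta 28 A)
  set L := Real.log A
  have hT0 : 0 < T := by linarith
  have hA0 : 0 < A := hT0.trans_le hTA
  have hW0 : 0 ≤ W := Real.rpow_nonneg hA0.le _
  have him2 : α.im ^ 2 = T ^ 2 := by rw [← sq_abs, him]
  have hL : L ≤ 1 + 2 * Real.log T := by
    calc L ≤ Real.log (2 * T ^ 2) := Real.log_le_log hA0 hA2
      _ = Real.log 2 + 2 * Real.log T := by
        rw [Real.log_mul (by norm_num) (by positivity), Real.log_pow]; norm_num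
      _ ≤ _ := by linarith [Real.log_two_lt_d9]
  have h1 : Real.pi ^ 2 / 2 * C * T ^ 2 * (W * L) ≤ 5 * C * T := by
    have hpi : Real.pi ^ 2 / 2 ≤ 5 := by nlinarith [Real.pi_lt_d2, Real.pi_pos]
    calc Real.pi ^ 2 / 2 * C * T ^ 2 * (W * L) ≤ 5 * C * T ^ 2 * T⁻¹ := by
          gcongr
          exact hWL.trans (inv_anti₀ hT0 hTA)
      _ = 5 * C * T := by field_simp
  have h2 : C * T * L ≤ C * T * (1 + 2 * Real.log T) := by gcongr
  have h3 : 0 ≤ Real.pi ^ 2 / 2 * C⁻¹ * α.re ^ 2 * (W * L) := by positivity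
  rw [him2, him]
  linarith

/-- Shifting to height `T = exp(ρ|x|)` gains `exp(-2π|x|T)`, while `Φ₁` grows there like `exp(2CT
log T)` up to smaller terms. The choice of `ρ` makes `π|x|T` equal to `5CT log T`, so the gain wins.
-/
theorem norm_iteratedDeriv_P1_le {C R : ℝ} (hC : 1 < C)
    (h : ∀ α : ℂ, R ≤ ‖α‖ → ‖Phi1 α‖ ≤
      Real.exp (-(Real.pi ^ 2 / 2) * (C⁻¹ * α.re ^ 2 - C * α.im ^ 2) *
        ‖α‖ ^ (-1 / theta 28 ‖α‖) * Real.log ‖α‖ + C * |α.im| * Real.log ‖α‖)) (j : ℕ) :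
    ∃ x₀ : ℝ, ∀ x : ℝ, x₀ ≤ |x| → ‖iteratedDeriv j P1 x‖ ≤
      Real.exp (-(Real.pi / 2) * |x| * Real.exp (Real.pi / (5 * C) * |x|)) := by
  obtain ⟨K, hK, hKc⟩ := exists_pow_mul_norm_Phi1_le
  obtain ⟨c, hc, hKc⟩ := hKc j
  obtain ⟨R', hR'1, hR'⟩ := exists_rpow_theta_bounds
  have hpi := Real.pi_pos
  have hC0 : 0 < C := by linarith
  -- `exp 6` gives `6CT ≤ u`. The bound `4j + 6` is the total power of `T` absorbing `(2π)^j`, `1 +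
  -- T⁴`, `(2T²)^j` and `π`.
  set T₀ : ℝ := max (max (max R R') (max K c)) (max (Real.exp 6) (4 * j + 6)) with hT₀
  have hT₀0 : 0 < T₀ := (Real.exp_pos 6).trans_le ((le_max_left _ _).trans (le_max_right _ _))
  refine ⟨Real.log T₀ / (Real.pi / (5 * C)), fun x hx => ?_⟩
  set T := Real.exp (Real.pi / (5 * C) * |x|) with hT
  have hlT : Real.log T = Real.pi / (5 * C) * |x| := Real.log_exp _
  have hTT₀ : T₀ ≤ T := by
    rw [div_le_iff₀ (by positivity), mul_comm] at hx
    exact (Real.log_le_iff_le_exp hT₀0).1 hx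
  have hTR : R ≤ T :=
    (((le_max_left _ _).trans (le_max_left _ _)).trans (le_max_left _ _)).trans hTT₀
  have hTR' : R' ≤ T :=
    (((le_max_right _ _).trans (le_max_left _ _)).trans (le_max_left _ _)).trans hTT₀
  have hTK : K ≤ T :=
    (((le_max_left _ _).trans (le_max_right _ _)).trans (le_max_left _ _)).trans hTT₀
  have hTc : c ≤ T :=
    (((le_max_right _ _).trans (le_max_right _ _)).trans (le_max_left _ _)).trans hTT₀
  have hT6 : Real.exp 6 ≤ T := ((le_max_left _ _).trans (le_max_right _ _)).trans hTT₀
  have hTj : 4 * (j : ℝ) + 6 ≤ T := ((le_max_right _ _).trans (le_max_right _ _)).trans hTT₀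
  have hT0 : 0 < T := Real.exp_pos _
  have hl6 : 6 ≤ Real.log T := (Real.le_log_iff_exp_le hT0).2 hT6
  have hT7 : 7 ≤ T := by
    have := Real.add_one_le_exp (6 : ℝ); linarith
  have hT1 : 1 ≤ T := by linarith
  -- In this unit the shift gains `e^(-10u)`, `Φ₁` costs at most `e^(3u)` for `|σ| ≤ T²`, and powers
  -- of `T` cost `e^u`. What remains is `e^(-5u)` after a spare `e^u` absorbs the factor `2`; the
  -- target is `e^(-5u/2)`.
  set u := C * T * Real.log T with hu
  have hTl : T * Real.log T ≤ u := by
    rw [hu, mul_assoc]; exact le_mul_of_one_le_left (by positivity) hC.le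
  have hu1 : 1 ≤ u := by nlinarith
  have hxu : Real.pi * |x| * T = 5 * u := by
    rw [hu, hlT]; field_simp
  -- The contour moves down for `x > 0` and up for `x < 0`, so that the exponential kernel is small.
  obtain ⟨τ, hτ, hxτ⟩ : ∃ τ : ℝ, |τ| = T ∧ x * τ = -(|x| * T) := by
    rcases le_total 0 x with h0 | h0
    · exact ⟨-T, by rw [abs_neg, abs_of_pos hT0], by rw [abs_of_nonneg h0]; ring⟩
    · exact ⟨T, abs_of_pos hT0, by rw [abs_of_nonpos h0]; ring⟩
  set B := (1 + T ^ 4) * ((2 * T ^ 2) ^ j * Real.exp (6 * C * T + 2 * C * T * Real.log T)) + c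
    with hB
  have hpoint : ∀ σ : ℝ, ‖derivIntegrand j x (σ + τ * Complex.I)‖ ≤
      Real.exp (-(2 * (5 * u))) * ((2 * Real.pi) ^ j * B) * (1 + σ ^ 2)⁻¹ := by
    intro σ
    set α : ℂ := σ + τ * Complex.I with hα
    have hre : α.re = σ := by simp [hα]
    have him : α.im = τ := by simp [hα]
    have hmain : ‖α‖ ^ j * ‖Phi1 α‖ ≤ B * (1 + σ ^ 2)⁻¹ := by
      -- Beyond `T² = τ²` the point lies in the region of rapid decay.
      by_cases hσ : |σ| ≤ T ^ 2
      · obtain ⟨h1, h2⟩ := norm_Phi1_le_of_re_le hC h hR' hT1 hTR hTR' (him ▸ hτ) (hre ▸ hσ)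
        rw [← div_eq_mul_inv, le_div_iff₀ (by positivity)]
        have h3 : 1 + σ ^ 2 ≤ 1 + T ^ 4 := by
          rw [← sq_abs σ, show T ^ 4 = (T ^ 2) ^ 2 by ring]; gcongr
        calc ‖α‖ ^ j * ‖Phi1 α‖ * (1 + σ ^ 2)
            ≤ (2 * T ^ 2) ^ j * Real.exp (6 * C * T + 2 * C * T * Real.log T) * (1 + T ^ 4) := by
              gcongr
          _ ≤ B := by rw [hB, mul_comm]; linarith
      · have hσ' := (not_le.1 hσ).le
        have h1 := hKc α (by rw [hre]; nlinarith) (by rw [him, hre, ← sq_abs, hτ]; exact hσ')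
        rw [hre] at h1
        refine h1.trans ?_
        gcongr
        exact le_add_of_nonneg_left (by positivity)
    have e : 2 * Real.pi * x * α.im = -(2 * (5 * u)) := by
      rw [him, mul_assoc, hxτ, ← hxu]; ring
    rw [norm_derivIntegrand, e]
    calc _ ≤ Real.exp (-(2 * (5 * u))) * ((2 * Real.pi) ^ j * (B * (1 + σ ^ 2)⁻¹)) := by gcongr
      _ = _ := by ring
  rw [iteratedDeriv_P1_eq_shift j x τ]
  have hint : ‖∫ σ : ℝ, derivIntegrand j x (σ + τ * Complex.I)‖ ≤
      Real.exp (-(2 * (5 * u))) * ((2 * Real.pi) ^ j * B) * Real.pi := by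
    refine (MeasureTheory.norm_integral_le_of_norm_le (integrable_inv_one_add_sq.const_mul _)
      (.of_forall hpoint)).trans (le_of_eq ?_)
    rw [MeasureTheory.integral_const_mul, integral_univ_inv_one_add_sq]
  have hpow : ∀ n : ℕ, (n : ℝ) ≤ T → T ^ n ≤ Real.exp u := by
    intro n hn
    calc T ^ n = Real.exp (n * Real.log T) := by rw [Real.exp_nat_mul, Real.exp_log hT0]
      _ ≤ Real.exp u := by
        apply Real.exp_le_exp.2
        refine le_trans ?_ hTl
        gcongr
  have h2pi : 2 * Real.pi ≤ T := by linarith [Real.pi_lt_d2]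
  have hpiT : Real.pi ≤ T := by linarith
  have hBle : (2 * Real.pi) ^ j * B * Real.pi ≤ 2 * Real.exp (4 * u) := by
    have t1 : (2 * Real.pi) ^ j * ((1 + T ^ 4) *
        ((2 * T ^ 2) ^ j * Real.exp (6 * C * T + 2 * C * T * Real.log T))) * Real.pi ≤
        Real.exp (4 * u) := by
      have p1 : 1 + T ^ 4 ≤ T ^ 5 := by
        have : 1 ≤ T ^ 4 := one_le_pow₀ hT1
        calc 1 + T ^ 4 ≤ 2 * T ^ 4 := by linarith
          _ ≤ T * T ^ 4 := by gcongr; linarith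
          _ = _ := by ring
      have p2 : 2 * T ^ 2 ≤ T ^ 3 := by
        calc 2 * T ^ 2 ≤ T * T ^ 2 := by gcongr; linarith
          _ = _ := by ring
      have p3 : 6 * C * T + 2 * C * T * Real.log T ≤ 3 * u := by
        have : C * T * 6 ≤ u := by rw [hu]; gcongr
        have e : 2 * C * T * Real.log T = 2 * u := by rw [hu]; ring
        linarith
      calc _ ≤ T ^ j * (T ^ 5 * ((T ^ 3) ^ j * Real.exp (3 * u))) * T := by gcongr
        _ = T ^ (4 * j + 6) * Real.exp (3 * u) := by ring
        _ ≤ Real.exp u * Real.exp (3 * u) := by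
          gcongr
          exact hpow _ (by push_cast; exact hTj)
        _ = _ := by rw [← Real.exp_add]; ring_nf
    have t2 : (2 * Real.pi) ^ j * c * Real.pi ≤ Real.exp (4 * u) := by
      calc _ ≤ T ^ j * T * T := by gcongr
        _ = T ^ (j + 2) := by ring
        _ ≤ Real.exp u := hpow _ (by
          push_cast
          have : (0 : ℝ) ≤ j := Nat.cast_nonneg j
          linarith)
        _ ≤ _ := Real.exp_le_exp.2 (by linarith)
    rw [hB]
    linarith
  refine hint.trans ?_
  have hfin : -(Real.pi / 2) * |x| * T = -(5 / 2 * u) := by linarith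
  rw [hfin]
  calc Real.exp (-(2 * (5 * u))) * ((2 * Real.pi) ^ j * B) * Real.pi
      = Real.exp (-(2 * (5 * u))) * ((2 * Real.pi) ^ j * B * Real.pi) := by ring
    _ ≤ Real.exp (-(2 * (5 * u))) * (Real.exp u * Real.exp (4 * u)) := by
        refine mul_le_mul_of_nonneg_left (hBle.trans ?_) (Real.exp_nonneg _)
        gcongr
        have := Real.add_one_le_exp u; linarith
    _ = Real.exp (-(5 * u)) := by rw [← Real.exp_add, ← Real.exp_add]; ring_nf
    _ ≤ _ := Real.exp_le_exp.2 (by linarith)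

/-! ### Positivity and total mass of `P₁` -/

open scoped FourierTransform

lemma fourier_eq_integral (f : ℝ → ℂ) (x : ℝ) :
    𝓕 f x = ∫ σ : ℝ, Complex.exp (((-2 * Real.pi * σ * x : ℝ) : ℂ) * Complex.I) * f σ := by
  simp [Real.fourier_real_eq_integral_exp_smul]

/-- `f` is continuous and integrable with a non-negative real Fourier transform. -/
structure IsFourierNonneg (f : ℝ → ℂ) : Prop where
  continuous : Continuous f
  integrable : MeasureTheory.Integrable f
  im_eq_zero : ∀ x, (𝓕 f x).im = 0
  re_nonneg : ∀ x, 0 ≤ (𝓕 f x).re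

lemma continuous_PhiFactor_ofReal (m : ℕ) : Continuous fun σ : ℝ => PhiFactor m (σ : ℂ) :=
  (differentiable_PhiFactor m).continuous.comp Complex.continuous_ofReal

lemma continuous_fourier_of_integrable {f : ℝ → ℂ} (hf : MeasureTheory.Integrable f) :
    Continuous (𝓕 f) := by
  have := Real.contDiff_fourier (f := f) (N := 0) (fun n hn => by
    have : n = 0 := by simpa using hn
    subst this; simpa using hf.norm)
  exact this.continuous

/-- `PhiFactor m` is an average of the characters `exp(2πiσ φ_{1,m}(t))`, each of which translates
the Fourier transform; Fubini exchanges the two integrals. -/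
lemma fourier_mul_PhiFactor {f : ℝ → ℂ} (hc : Continuous f) (hf : MeasureTheory.Integrable f)
    (m : ℕ) (x : ℝ) :
    𝓕 (fun σ : ℝ => f σ * PhiFactor m (σ : ℂ)) x = ∫ t in (0 : ℝ)..1, 𝓕 f (x - phi m t) := by
  have hφ := continuous_phi m
  set F : ℝ → ℝ → ℂ := fun σ t =>
    Complex.exp (((-2 * Real.pi * σ * (x - phi m t) : ℝ) : ℂ) * Complex.I) * f σ with hF
  have hFc : Continuous (Function.uncurry F) := by
    simp only [hF, Function.uncurry_def]
    fun_prop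
  have hFint : MeasureTheory.Integrable (Function.uncurry F)
      (MeasureTheory.volume.prod (MeasureTheory.volume.restrict (Set.Ioc (0 : ℝ) 1))) := by
    refine (hf.norm.comp_fst _).mono' hFc.aestronglyMeasurable (.of_forall fun p => ?_)
    simp only [hF, Function.uncurry_def, norm_mul, Complex.norm_exp_ofReal_mul_I, one_mul]
    exact le_rfl
  rw [intervalIntegral.integral_of_le zero_le_one]
  simp_rw [fourier_eq_integral]
  rw [← MeasureTheory.integral_integral_swap hFint]
  congr 1
  ext σ
  rw [PhiFactor, intervalIntegral.integral_of_le zero_le_one, ← mul_assoc,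
    ← MeasureTheory.integral_const_mul]
  congr 1
  ext t
  simp only [hF]
  rw [mul_right_comm, ← Complex.exp_add]
  congr 2
  push_cast
  ring

lemma IsFourierNonneg.mul_PhiFactor {f : ℝ → ℂ} (hf : IsFourierNonneg f) (m : ℕ) :
    IsFourierNonneg fun σ : ℝ => f σ * PhiFactor m (σ : ℂ) := by
  have hint : ∀ x, IntervalIntegrable (fun t => 𝓕 f (x - phi m t)) MeasureTheory.volume 0 1 :=
    fun x => ((continuous_fourier_of_integrable hf.integrable).comp
      (continuous_const.sub (continuous_phi m))).intervalIntegrable _ _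
  have hc := hf.continuous.mul (continuous_PhiFactor_ofReal m)
  refine ⟨hc, hf.integrable.norm.mono' hc.aestronglyMeasurable (.of_forall fun σ => ?_),
    fun x => ?_, fun x => ?_⟩
  · rw [norm_mul]
    exact mul_le_of_le_one_right (norm_nonneg _) (norm_PhiFactor_ofReal_le m σ)
  · rw [fourier_mul_PhiFactor hf.continuous hf.integrable, ← Complex.imCLM_apply,
      ← Complex.imCLM.intervalIntegral_comp_comm (hint x)]
    simp [hf.im_eq_zero]
  · rw [fourier_mul_PhiFactor hf.continuous hf.integrable, ← Complex.reCLM_apply,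
      ← Complex.reCLM.intervalIntegral_comp_comm (hint x)]
    exact intervalIntegral.integral_nonneg zero_le_one fun t _ => hf.re_nonneg _

lemma isFourierNonneg_gaussian {b : ℝ} (hb : 0 < b) :
    IsFourierNonneg fun σ : ℝ => Complex.exp (-Real.pi * b * σ ^ 2) := by
  have hft : ∀ x : ℝ, 𝓕 (fun σ : ℝ => Complex.exp (-Real.pi * b * σ ^ 2)) x =
      ((1 / b ^ (1 / 2 : ℝ) * Real.exp (-Real.pi / b * x ^ 2) : ℝ) : ℂ) := by
    intro x
    rw [fourier_gaussian_pi (b := (b : ℂ)) (by simpa using hb)]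
    push_cast [Complex.ofReal_cpow hb.le]
    rfl
  refine ⟨by fun_prop, ?_, fun x => ?_, fun x => ?_⟩
  · have h := integrable_cexp_neg_mul_sq (b := (Real.pi * b : ℂ))
      (by simpa using mul_pos Real.pi_pos hb)
    simpa [neg_mul] using h
  · rw [hft]; exact Complex.ofReal_im _
  · rw [hft, Complex.ofReal_re]; positivity

/-- The Gaussian supplies the integrability that finite products are not known to have, and starts
the induction with a positive Fourier transform. -/
lemma isFourierNonneg_gaussian_mul_limitM {b : ℝ} (hb : 0 < b) (M : ℕ) :
    IsFourierNonneg fun σ : ℝ => Complex.exp (-Real.pi * b * σ ^ 2) * limitM (σ : ℂ) M := by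
  induction M with
  | zero => simpa [limitM] using isFourierNonneg_gaussian hb
  | succ M ih =>
    have h := ih.mul_PhiFactor (M + 1)
    simp only [limitM_eq_prod_range, Finset.prod_range_succ] at h ⊢
    simpa only [mul_assoc] using h

lemma tendsto_fourier_of_dominated {f : ℕ → ℝ → ℂ} {g : ℝ → ℂ} {bound : ℝ → ℝ}
    (hf : ∀ n, Continuous (f n)) (hb : MeasureTheory.Integrable bound)
    (hle : ∀ n σ, ‖f n σ‖ ≤ bound σ)
    (hlim : ∀ σ, Filter.Tendsto (fun n => f n σ) Filter.atTop (nhds (g σ))) (x : ℝ) :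
    Filter.Tendsto (fun n => 𝓕 (f n) x) Filter.atTop (nhds (𝓕 g x)) := by
  simp_rw [fourier_eq_integral]
  refine MeasureTheory.tendsto_integral_of_dominated_convergence bound (fun n => ?_) hb
    (fun n => .of_forall fun σ => ?_) (.of_forall fun σ => (hlim σ).const_mul _)
  · have := hf n
    exact Continuous.aestronglyMeasurable (by fun_prop)
  · rw [norm_mul, Complex.norm_exp_ofReal_mul_I, one_mul]; exact hle n σ

lemma norm_limitM_ofReal_le (σ : ℝ) (M : ℕ) : ‖limitM (σ : ℂ) M‖ ≤ 1 := by
  rw [limitM, norm_prod]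
  exact Finset.prod_le_one (fun m _ => norm_nonneg _) fun m _ => norm_PhiFactor_ofReal_le m σ

lemma im_re_of_tendsto {f : ℕ → ℂ} {z : ℂ} (h : Filter.Tendsto f Filter.atTop (nhds z))
    (him : ∀ n, (f n).im = 0) (hre : ∀ n, 0 ≤ (f n).re) : z.im = 0 ∧ 0 ≤ z.re := by
  refine ⟨tendsto_nhds_unique ((Complex.continuous_im.tendsto z).comp h) ?_,
    ge_of_tendsto' ((Complex.continuous_re.tendsto z).comp h) hre⟩
  simp [Function.comp_def, him]

lemma norm_gaussian_le_one {b : ℝ} (hb : 0 ≤ b) (σ : ℝ) :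
    ‖Complex.exp (-Real.pi * b * σ ^ 2)‖ ≤ 1 := by
  rw [show (-Real.pi * b * σ ^ 2 : ℂ) = ((-(Real.pi * b * σ ^ 2) : ℝ) : ℂ) by push_cast; ring,
    Complex.norm_exp, Complex.ofReal_re, Real.exp_le_one_iff]
  have := Real.pi_pos
  have : 0 ≤ Real.pi * b * σ ^ 2 := by positivity
  linarith

/-- Two dominated limits: `M → ∞` with the Gaussian as majorant, then `b → 0` with `|Φ₁|` as
majorant. -/
theorem P1_im_re (x : ℝ) : (P1 x).im = 0 ∧ 0 ≤ (P1 x).re := by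
  have hΦ : Continuous fun σ : ℝ => Phi1 (σ : ℂ) :=
    differentiable_Phi1.continuous.comp Complex.continuous_ofReal
  have hg : ∀ b : ℝ, 0 < b → ∀ y : ℝ,
      (𝓕 (fun σ : ℝ => Complex.exp (-Real.pi * b * σ ^ 2) * Phi1 (σ : ℂ)) y).im = 0 ∧
      0 ≤ (𝓕 (fun σ : ℝ => Complex.exp (-Real.pi * b * σ ^ 2) * Phi1 (σ : ℂ)) y).re := by
    intro b hb y
    have hM := isFourierNonneg_gaussian_mul_limitM hb
    refine im_re_of_tendsto (tendsto_fourier_of_dominated (fun M => (hM M).continuous)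
      (isFourierNonneg_gaussian hb).integrable.norm (fun M σ => ?_)
      (fun σ => (tendsto_limitM (σ : ℂ)).const_mul _) y)
      (fun M => (hM M).im_eq_zero y) (fun M => (hM M).re_nonneg y)
    rw [norm_mul]
    exact mul_le_of_le_one_right (norm_nonneg _) (norm_limitM_ofReal_le σ M)
  have hb : ∀ n : ℕ, (0 : ℝ) < 1 / ((n : ℝ) + 1) := fun n => by positivity
  refine im_re_of_tendsto (tendsto_fourier_of_dominated
    (f := fun n σ => Complex.exp (-Real.pi * ((1 / ((n : ℝ) + 1) : ℝ) : ℂ) * σ ^ 2) * Phi1 (σ : ℂ))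
    (fun n => by fun_prop) integrable_Phi1.norm (fun n σ => ?_) (fun σ => ?_) x)
    (fun n => (hg _ (hb n) x).1) (fun n => (hg _ (hb n) x).2)
  · rw [norm_mul]
    exact mul_le_of_le_one_left (norm_nonneg _) (norm_gaussian_le_one (hb n).le σ)
  · have hcont : Continuous fun b : ℝ => Complex.exp (-Real.pi * (b : ℂ) * σ ^ 2) * Phi1 (σ : ℂ) := by
      fun_prop
    have := (hcont.tendsto 0).comp tendsto_one_div_add_atTop_nhds_zero_nat
    simpa [Function.comp_def] using this

theorem integrable_P1 : MeasureTheory.Integrable P1 := by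
  obtain ⟨C, R, hC, h⟩ := exists_norm_Phi1_le
  obtain ⟨x₀, hx₀⟩ := norm_iteratedDeriv_P1_le hC h 0
  have hcont : Continuous P1 := contDiff_P1.continuous
  obtain ⟨b, hb⟩ := (isCompact_Icc (a := -|x₀|) (b := |x₀|)).exists_bound_of_continuousOn
    (f := fun x => P1 x * (1 + (x : ℂ) ^ 2)) (by fun_prop)
  refine (integrable_inv_one_add_sq.const_mul (max b 1)).mono' hcont.aestronglyMeasurable
    (.of_forall fun x => ?_)
  by_cases hx : |x| ≤ |x₀|
  · have h1 := hb x (abs_le.1 hx)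
    have h2 : ‖(1 + (x : ℂ) ^ 2)‖ = 1 + x ^ 2 := by
      rw [show (1 + (x : ℂ) ^ 2) = ((1 + x ^ 2 : ℝ) : ℂ) by push_cast; ring, Complex.norm_real,
        Real.norm_of_nonneg (by positivity)]
    rw [norm_mul, h2] at h1
    rw [← div_eq_mul_inv, le_div_iff₀ (by positivity)]
    exact h1.trans (le_max_left _ _)
  · have h1 := hx₀ x ((le_abs_self _).trans (not_le.1 hx).le)
    rw [iteratedDeriv_zero] at h1
    have hpi := Real.pi_gt_three
    have h2 : 1 + x ^ 2 ≤ Real.exp (Real.pi / 2 * |x|) := by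
      have := Real.quadratic_le_exp_of_nonneg (x := Real.pi / 2 * |x|) (by positivity)
      have h3 : 9 * x ^ 2 ≤ Real.pi ^ 2 * x ^ 2 := by gcongr; nlinarith
      have h4 : (Real.pi / 2 * |x|) ^ 2 = Real.pi ^ 2 * x ^ 2 / 4 := by
        rw [mul_pow, sq_abs]; ring
      have h5 : 0 ≤ Real.pi / 2 * |x| := by positivity
      nlinarith [sq_nonneg x]
    calc ‖P1 x‖ ≤ Real.exp (-(Real.pi / 2) * |x| * Real.exp (Real.pi / (5 * C) * |x|)) := h1
      _ ≤ Real.exp (-(Real.pi / 2 * |x|)) := by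
        apply Real.exp_le_exp.2
        have : 1 ≤ Real.exp (Real.pi / (5 * C) * |x|) := Real.one_le_exp (by positivity)
        have h0 : 0 ≤ Real.pi / 2 * |x| := by positivity
        nlinarith
      _ ≤ (1 + x ^ 2)⁻¹ := by
        rw [Real.exp_neg]; gcongr
      _ ≤ max b 1 * (1 + x ^ 2)⁻¹ :=
        le_mul_of_one_le_left (by positivity) (le_max_right _ _)

lemma Phi1_zero : Phi1 0 = 1 := by
  simp [Phi1, PhiFactor]

/-- Fourier inversion at `0`, where `Φ₁(0) = 1`. -/
theorem integral_P1 : ∫ x : ℝ, P1 x = 1 := by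
  have hΦ : Continuous fun σ : ℝ => Phi1 (σ : ℂ) :=
    differentiable_Phi1.continuous.comp Complex.continuous_ofReal
  have h := congrFun (hΦ.fourierInv_fourier_eq integrable_Phi1 integrable_P1) 0
  rw [Real.fourierInv_eq'] at h
  simpa [Phi1_zero, P1] using h

/-! ### Linear independence of square roots of squarefree integers -/

section SquareRoots

variable {K : Type*} [Field K] [CharZero K] [Algebra ℚ K]

/-- The quadratic character `σ ↦ σ s / s` of the Galois group attached to a square root `s`
of a positive integer. -/
def sqrtChar {m : ℕ} (hm : m ≠ 0) {s : K} (hs : s ^ 2 = m) : (K ≃ₐ[ℚ] K) →* K where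
  toFun g := g s / s
  map_one' := by
    have hs0 : s ≠ 0 := by
      rintro rfl; apply hm; simpa using hs.symm
    simp [hs0]
  map_mul' g h := by
    have hs0 : s ≠ 0 := by
      rintro rfl; apply hm; simpa using hs.symm
    have hh : h s = s ∨ h s = -s := by
      rw [← sq_eq_sq_iff_eq_or_eq_neg, ← map_pow, hs, map_natCast]
    rw [AlgEquiv.mul_apply]
    rcases hh with hh | hh
    · rw [hh, div_self hs0, mul_one]
    · rw [hh, map_neg, neg_div, neg_div, div_self hs0, mul_neg, mul_one]

lemma sqrtChar_mul_self {m : ℕ} (hm : m ≠ 0) {s : K} (hs : s ^ 2 = m) (g : K ≃ₐ[ℚ] K) :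
    sqrtChar hm hs g * s = g s := by
  have hs0 : s ≠ 0 := by
    rintro rfl; apply hm; simpa using hs.symm
  exact div_mul_cancel₀ _ hs0

lemma sqrtChar_sq {m : ℕ} (hm : m ≠ 0) {s : K} (hs : s ^ 2 = m) (g : K ≃ₐ[ℚ] K) :
    sqrtChar hm hs g ^ 2 = 1 := by
  have hm' : (m : K) ≠ 0 := by exact_mod_cast hm
  have h : (sqrtChar hm hs g * s) ^ 2 = m := by
    rw [sqrtChar_mul_self, ← map_pow, hs, map_natCast]
  rw [mul_pow, hs] at h
  exact mul_right_cancel₀ hm' (by rw [h, one_mul])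

/-- Equal characters mean that `s * s'` is fixed by the Galois group, hence rational; then `m m'` is
a square, which for squarefree numbers forces equality. -/
lemma eq_of_sqrtChar_eq [IsGalois ℚ K] {m m' : ℕ} (hm : Squarefree m) (hm' : Squarefree m')
    {s s' : K} (hs : s ^ 2 = m) (hs' : s' ^ 2 = m')
    (h : sqrtChar hm.ne_zero hs = sqrtChar hm'.ne_zero hs') : m = m' := by
  have hfix : ∀ g : K ≃ₐ[ℚ] K, g (s * s') = s * s' := by
    intro g
    rw [map_mul, ← sqrtChar_mul_self hm.ne_zero hs g, ← sqrtChar_mul_self hm'.ne_zero hs' g, h,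
      mul_mul_mul_comm, ← sq, sqrtChar_sq, one_mul]
  obtain ⟨q, hq⟩ := (InfiniteGalois.mem_range_algebraMap_iff_fixed (s * s')).2 hfix
  have hq2 : q ^ 2 = ((m * m' : ℕ) : ℚ) := by
    apply (algebraMap ℚ K).injective
    rw [map_pow, hq, mul_pow, hs, hs']
    simp
  have hsq : IsSquare ((m * m' : ℕ) : ℚ) := ⟨q, by rw [← hq2, sq]⟩
  rw [Rat.isSquare_natCast_iff] at hsq
  obtain ⟨k, hk⟩ := hsq
  have : m * m' ^ 2 = m' * k ^ 2 := by
    rw [sq k, ← hk]; ring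
  exact (mul_sq_unique_of_squarefree hm hm' hm'.ne_zero this).1

end SquareRoots

/-- Applying each Galois automorphism `g` to the relation multiplies its `i`-th term by `χ_i(g)`.
The characters `χ_i` are distinct, so Dedekind's independence of characters kills every term. -/
lemma eq_zero_of_sum_int_mul_sqrt_eq_zero {ι : Type*} [Fintype ι] {d : ι → ℕ}
    (hd : Function.Injective d) (hsq : ∀ i, Squarefree (d i)) {n : ι → ℤ} (h : ∑ i, (n i : ℝ) * Real.sqrt (d i) = 0) :
    n = 0 := by
  let K := AlgebraicClosure ℚ
  -- Two `ℚ`-algebra structures on `K` are in play; they agree because such a structure is unique.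
  have : IsAlgClosure ℚ K := by
    convert (inferInstance :
      @IsAlgClosure ℚ (AlgebraicClosure ℚ) _ _ (AlgebraicClosure.instAlgebra ℚ) _)
    exact Subsingleton.elim _ _
  have : IsGalois ℚ K := IsAlgClosure.isGalois ℚ K
  let φ : K →ₐ[ℚ] ℂ := IsAlgClosed.lift
  have hroot : ∀ i, ∃ s : K, s ^ 2 = (d i : K) := fun i =>
    IsAlgClosed.exists_pow_nat_eq _ (by norm_num)
  choose s hs using hroot
  -- An embedding into `ℂ` fixes the roots only up to sign; the signs are moved into the integer
  -- coefficients.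
  have hsign : ∀ i, ∃ e : ℤ, e ≠ 0 ∧ ((Real.sqrt (d i) : ℝ) : ℂ) = e * φ (s i) := by
    intro i
    have h1 : ((Real.sqrt (d i) : ℝ) : ℂ) ^ 2 = φ (s i) ^ 2 := by
      rw [← map_pow, hs, map_natCast, ← Complex.ofReal_pow, Real.sq_sqrt (Nat.cast_nonneg _),
        Complex.ofReal_natCast]
    rcases sq_eq_sq_iff_eq_or_eq_neg.1 h1 with h2 | h2
    · exact ⟨1, by norm_num, by simpa using h2⟩
    · exact ⟨-1, by norm_num, by simpa using h2⟩
  choose e he0 he using hsign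
  have hK : ∑ i, ((n i * e i : ℤ) : K) * s i = 0 := by
    apply φ.injective
    rw [map_sum, map_zero]
    have h2 : ((∑ i, (n i : ℝ) * Real.sqrt (d i) : ℝ) : ℂ) = 0 := by rw [h]; simp
    rw [← h2]
    push_cast
    refine Finset.sum_congr rfl fun i _ => ?_
    rw [he i]
    simp [mul_assoc]
  have hli := (linearIndependent_monoidHom (K ≃ₐ[ℚ] K) K).comp
    (fun i => sqrtChar (hsq i).ne_zero (hs i))
    (fun i j hij => hd (eq_of_sqrtChar_eq (hsq i) (hsq j) (hs i) (hs j) hij))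
  rw [Fintype.linearIndependent_iff] at hli
  have hz := hli (fun i => ((n i * e i : ℤ) : K) * s i) (by
    ext g
    simp only [Function.comp_apply, Finset.sum_apply, Pi.smul_apply, smul_eq_mul, Pi.zero_apply]
    rw [← map_zero g, ← hK, map_sum]
    refine Finset.sum_congr rfl fun i _ => ?_
    rw [map_mul, map_intCast, ← sqrtChar_mul_self (hsq i).ne_zero (hs i) g]
    ring)
  ext i
  have hs0 : s i ≠ 0 := by
    intro h0
    have h1 := hs i
    rw [h0] at h1
    exact (hsq i).ne_zero (by simpa using h1.symm)
  have h1 := (mul_eq_zero.1 (hz i)).resolve_right hs0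
  have h2 : n i * e i = 0 := by exact_mod_cast h1
  simpa [he0 i] using h2

/-! ### Kronecker–Weyl equidistribution on the torus -/

section Equidistribution

open UnitAddTorus

variable {ι : Type*}

/-- The linear flow on the torus with frequencies `w`. -/
def torusFlow (w : ι → ℝ) (x : ℝ) : UnitAddTorus ι := fun i => ((w i * x : ℝ) : UnitAddCircle)

lemma continuous_torusFlow (w : ι → ℝ) : Continuous (torusFlow w) :=
  continuous_pi fun i => (AddCircle.continuous_mk' 1).comp (by fun_prop)

variable [Fintype ι]

lemma mFourier_torusFlow (w : ι → ℝ) (n : ι → ℤ) (x : ℝ) : mFourier n (torusFlow w x) =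
    Complex.exp (((2 * Real.pi * ∑ i, (n i : ℝ) * w i : ℝ) : ℂ) * Complex.I * x) := by
  simp only [mFourier, ContinuousMap.coe_mk, torusFlow, fourier_coe_apply]
  rw [← Complex.exp_sum]
  congr 1
  push_cast
  rw [Finset.mul_sum, Finset.sum_mul, Finset.sum_mul]
  refine Finset.sum_congr rfl fun i _ => ?_
  simp only [div_one]
  ring

/-- The integral of a non-trivial character stays bounded by `2/|c|`, so its mean is `O(1/X)`. -/
lemma tendsto_mean_exp {c : ℝ} (hc : c ≠ 0) : Filter.Tendsto (fun X : ℝ =>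
    (1 / (X : ℂ)) * ∫ x in X..(2 * X), Complex.exp ((c : ℂ) * Complex.I * x))
    Filter.atTop (nhds 0) := by
  have hcI : (c : ℂ) * Complex.I ≠ 0 := by simp [hc]
  have hlim : Filter.Tendsto (fun X : ℝ => X⁻¹ * (2 / |c|)) Filter.atTop (nhds 0) := by
    simpa using tendsto_inv_atTop_zero.mul_const (2 / |c|)
  refine squeeze_zero_norm' ?_ hlim
  filter_upwards [Filter.eventually_gt_atTop 0] with X hX
  rw [integral_exp_mul_complex hcI, norm_mul, norm_div, norm_div]
  have h1 : ∀ y : ℝ, ‖Complex.exp ((c : ℂ) * Complex.I * y)‖ = 1 := by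
    intro y
    rw [show (c : ℂ) * Complex.I * y = ((c * y : ℝ) : ℂ) * Complex.I by push_cast; ring]
    exact Complex.norm_exp_ofReal_mul_I _
  have h2 : ‖Complex.exp ((c : ℂ) * Complex.I * ((2 * X : ℝ) : ℂ)) -
      Complex.exp ((c : ℂ) * Complex.I * X)‖ ≤ 2 := by
    refine (norm_sub_le _ _).trans ?_
    rw [h1, h1]; norm_num
  have h3 : ‖(c : ℂ) * Complex.I‖ = |c| := by simp
  rw [h3, norm_one, Complex.norm_real, Real.norm_of_nonneg hX.le, one_div]
  gcongr

lemma norm_mean_le {f : ℝ → ℂ} {B : ℝ} (hf : ∀ x, ‖f x‖ ≤ B) {X : ℝ} (hX : 0 < X) :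
    ‖(1 / (X : ℂ)) * ∫ x in X..(2 * X), f x‖ ≤ B := by
  have h := intervalIntegral.norm_integral_le_of_norm_le_const (a := X) (b := 2 * X) (f := f)
    (C := B) fun x _ => hf x
  rw [norm_mul, norm_div, norm_one, Complex.norm_real, Real.norm_of_nonneg hX.le, one_div,
    inv_mul_le_iff₀ hX]
  rwa [show 2 * X - X = X by ring, abs_of_pos hX, mul_comm B] at h

lemma integral_fourier_of_ne_zero {n : ℤ} (hn : n ≠ 0) :
    ∫ t : UnitAddCircle, fourier n t = 0 := by
  rw [← UnitAddCircle.intervalIntegral_preimage 0]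
  simp only [fourier_coe_apply]
  have hc : 2 * (Real.pi : ℂ) * Complex.I * n ≠ 0 := by simp [hn, Real.pi_ne_zero]
  have := integral_exp_mul_complex (a := 0) (b := 0 + 1) hc
  simp only [Complex.ofReal_one, div_one]
  rw [this]
  have h1 : Complex.exp (2 * (Real.pi : ℂ) * Complex.I * n * ((0 + 1 : ℝ) : ℂ)) = 1 := by
    rw [Complex.exp_eq_one_iff]
    exact ⟨n, by push_cast; ring⟩
  rw [h1]; simp

lemma integral_mFourier {n : ι → ℤ} (hn : n ≠ 0) : ∫ t : UnitAddTorus ι, mFourier n t = 0 := by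
  obtain ⟨i, hi⟩ := Function.ne_iff.1 hn
  have h : ∫ t : UnitAddTorus ι, mFourier n t = ∏ i, ∫ t : UnitAddCircle, fourier (n i) t :=
    MeasureTheory.integral_fintype_prod_volume_eq_prod (fun i t => fourier (n i) t)
  rw [h]
  exact Finset.prod_eq_zero (Finset.mem_univ i) (integral_fourier_of_ne_zero hi)

lemma volume_real_univ_torus :
    MeasureTheory.volume.real (Set.univ : Set (UnitAddTorus ι)) = 1 := by
  have : MeasureTheory.IsProbabilityMeasure
      (MeasureTheory.volume : MeasureTheory.Measure UnitAddCircle) := ⟨UnitAddCircle.measure_univ⟩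
  rw [MeasureTheory.volume_pi, MeasureTheory.probReal_univ]

lemma integrable_torus (F : C(UnitAddTorus ι, ℂ)) :
    MeasureTheory.Integrable fun t => F t :=
  F.continuous.integrable_of_hasCompactSupport (HasCompactSupport.of_compactSpace _)

/-- The continuous functions whose mean along the flow is their mean over the torus. -/
def equidistributed (w : ι → ℝ) : Submodule ℂ C(UnitAddTorus ι, ℂ) where
  carrier := {F | Filter.Tendsto (fun X : ℝ =>
    (1 / (X : ℂ)) * ∫ x in X..(2 * X), F (torusFlow w x)) Filter.atTop (nhds (∫ t, F t))}
  zero_mem' := by simp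
  add_mem' := by
    intro F G hF hG
    have hc : ∀ F : C(UnitAddTorus ι, ℂ), Continuous fun x => F (torusFlow w x) := fun F =>
      F.continuous.comp (continuous_torusFlow w)
    have h := Filter.Tendsto.add hF hG
    simp only [Set.mem_ofPred_eq, ContinuousMap.add_apply]
    rw [MeasureTheory.integral_add (integrable_torus F) (integrable_torus G)]
    refine h.congr fun X => ?_
    rw [intervalIntegral.integral_add ((hc F).intervalIntegrable _ _)
      ((hc G).intervalIntegrable _ _), mul_add]
  smul_mem' := by
    intro c F hF
    have h := Filter.Tendsto.const_mul c hF
    simp only [Set.mem_ofPred_eq, ContinuousMap.smul_apply, smul_eq_mul]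
    rw [MeasureTheory.integral_const_mul]
    refine h.congr fun X => ?_
    rw [intervalIntegral.integral_const_mul]
    ring

/-- Both means are contractions for the sup norm, so an `ε/3` argument applies. -/
lemma isClosed_equidistributed (w : ι → ℝ) :
    IsClosed (equidistributed w : Set C(UnitAddTorus ι, ℂ)) := by
  rw [← closure_subset_iff_isClosed]
  intro F hF
  rw [Metric.mem_closure_iff] at hF
  change Filter.Tendsto _ _ _
  rw [Metric.tendsto_nhds]
  intro ε hε
  obtain ⟨G, hG, hFG⟩ := hF (ε / 3) (by positivity)
  have hG' : Filter.Tendsto (fun X : ℝ =>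
    (1 / (X : ℂ)) * ∫ x in X..(2 * X), G (torusFlow w x)) Filter.atTop (nhds (∫ t, G t)) := hG
  have hc : ∀ F : C(UnitAddTorus ι, ℂ), Continuous fun x => F (torusFlow w x) := fun F =>
    F.continuous.comp (continuous_torusFlow w)
  have hpt : ∀ t, ‖F t - G t‖ ≤ ε / 3 := fun t => by
    rw [← dist_eq_norm]; exact (ContinuousMap.dist_apply_le_dist t).trans hFG.le
  have hint : ‖(∫ t, F t) - ∫ t, G t‖ ≤ ε / 3 := by
    rw [← MeasureTheory.integral_sub (integrable_torus F) (integrable_torus G)]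
    simpa [volume_real_univ_torus] using MeasureTheory.norm_integral_le_of_norm_le_const
      (μ := (MeasureTheory.volume : MeasureTheory.Measure (UnitAddTorus ι))) (.of_forall hpt)
  filter_upwards [(Metric.tendsto_nhds.1 hG') (ε / 3) (by positivity),
    Filter.eventually_gt_atTop 0] with X h1 hX
  have h2 : ‖(1 / (X : ℂ)) * (∫ x in X..(2 * X), F (torusFlow w x)) -
      (1 / (X : ℂ)) * ∫ x in X..(2 * X), G (torusFlow w x)‖ ≤ ε / 3 := by
    rw [← mul_sub, ← intervalIntegral.integral_sub ((hc F).intervalIntegrable _ _)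
      ((hc G).intervalIntegrable _ _)]
    exact norm_mean_le (fun x => hpt _) hX
  rw [dist_eq_norm] at h1 ⊢
  set a := (1 / (X : ℂ)) * ∫ x in X..(2 * X), F (torusFlow w x)
  set b := (1 / (X : ℂ)) * ∫ x in X..(2 * X), G (torusFlow w x)
  calc ‖a - ∫ t, F t‖ = ‖(a - b) + (b - ∫ t, G t) - ((∫ t, F t) - ∫ t, G t)‖ := by congr 1; ring
    _ ≤ ‖(a - b) + (b - ∫ t, G t)‖ + ‖(∫ t, F t) - ∫ t, G t‖ := norm_sub_le _ _
    _ ≤ ‖a - b‖ + ‖b - ∫ t, G t‖ + ‖(∫ t, F t) - ∫ t, G t‖ := by gcongr; exact norm_add_le _ _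
    _ < ε := by linarith

/-- The Kronecker–Weyl theorem for linear flows with rationally independent frequencies. -/
theorem tendsto_mean_torusFlow {w : ι → ℝ}
    (hw : ∀ n : ι → ℤ, ∑ i, (n i : ℝ) * w i = 0 → n = 0) (F : C(UnitAddTorus ι, ℂ)) :
    Filter.Tendsto (fun X : ℝ => (1 / (X : ℂ)) * ∫ x in X..(2 * X), F (torusFlow w x))
      Filter.atTop (nhds (∫ t, F t)) := by
  -- Rational independence makes every non-trivial character oscillate along the flow. Density of
  -- trigonometric polynomials then gives all continuous functions.
  have hspan : Submodule.span ℂ (Set.range (mFourier (d := ι))) ≤ equidistributed w := by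
    rw [Submodule.span_le]
    rintro _ ⟨n, rfl⟩
    change Filter.Tendsto _ _ _
    by_cases hn : n = 0
    · subst hn
      simp only [mFourier_zero, ContinuousMap.one_apply]
      refine tendsto_const_nhds.congr' ?_
      filter_upwards [Filter.eventually_gt_atTop 0] with X hX
      have hX' : (X : ℂ) ≠ 0 := by exact_mod_cast hX.ne'
      rw [intervalIntegral.integral_const, show 2 * X - X = X by ring]
      simp [hX', volume_real_univ_torus]
    · rw [integral_mFourier hn]
      simp_rw [mFourier_torusFlow]
      refine tendsto_mean_exp ?_
      have : ∑ i, (n i : ℝ) * w i ≠ 0 := fun h => hn (hw n h)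
      have := Real.pi_pos
      positivity
  have htop := Submodule.topologicalClosure_minimal _ hspan (isClosed_equidistributed w)
  rw [span_mFourier_closure_eq_top] at htop
  exact htop Submodule.mem_top

end Equidistribution

/-! ### The limit of the finite averages -/

/-- The function `exp(2πiα φ_{1,m})` on the circle. -/
def phiExpCircle (m : ℕ) (α : ℂ) : C(UnitAddCircle, ℂ) where
  toFun := Function.Periodic.lift
    (f := fun t : ℝ => Complex.exp (2 * (Real.pi : ℂ) * Complex.I * α * (phi m t : ℂ))) (c := 1)
    fun t => by simp only [phi_add_one]
  continuous_toFun := continuous_coinduced_dom.2 (continuous_exponent_phi m α).cexp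

lemma integral_phiExpCircle (m : ℕ) (α : ℂ) : ∫ t, phiExpCircle m α t = PhiFactor m α := by
  rw [← UnitAddCircle.intervalIntegral_preimage 0, zero_add]
  rfl

lemma PhiFactor_of_not_squarefree {m : ℕ} (hm : ¬ Squarefree m) (α : ℂ) : PhiFactor m α = 1 := by
  simp [PhiFactor, phi_of_not_squarefree hm]

/-- Non-squarefree `m` contribute `φ_{1,m} = 0`, so the flow involves only independent frequencies.
The test function is a product over coordinates, so its torus integral factors. -/
theorem tendsto_meanM (α : ℂ) (M : ℕ) :
    Filter.Tendsto (fun X : ℝ => meanM X α M) Filter.atTop (nhds (limitM α M)) := by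
  let S := (Finset.Icc 1 M).filter Squarefree
  let w : S → ℝ := fun i => Real.sqrt ((i : ℕ) : ℝ)
  have hw : ∀ n : S → ℤ, ∑ i, (n i : ℝ) * w i = 0 → n = 0 := fun n hn =>
    eq_zero_of_sum_int_mul_sqrt_eq_zero Subtype.val_injective
      (fun i => (Finset.mem_filter.1 i.2).2) hn
  let F : C(UnitAddTorus S, ℂ) :=
    ⟨fun t => ∏ i : S, phiExpCircle i α (t i), by fun_prop⟩
  have h := tendsto_mean_torusFlow hw F
  have hint : ∫ t, F t = limitM α M := by
    have h1 : ∫ t, F t = ∏ i : S, ∫ t, phiExpCircle i α t :=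
      MeasureTheory.integral_fintype_prod_volume_eq_prod
        (fun (i : S) (t : UnitAddCircle) => phiExpCircle i α t)
    rw [h1]
    simp_rw [integral_phiExpCircle]
    rw [Finset.prod_coe_sort S (fun m => PhiFactor m α), Finset.prod_filter, limitM]
    refine Finset.prod_congr rfl fun m _ => ?_
    split_ifs with hm
    · rfl
    · exact (PhiFactor_of_not_squarefree hm α).symm
  rw [hint] at h
  refine h.congr fun X => ?_
  rw [meanM]
  congr 2
  ext x
  have h2 : F (torusFlow w x) = ∏ i : S, Complex.exp
      (2 * (Real.pi : ℂ) * Complex.I * α * (phi i (Real.sqrt ((i : ℕ) : ℝ) * x) : ℂ)) := rfl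
  rw [h2, Finset.prod_coe_sort S (fun m => Complex.exp
    (2 * (Real.pi : ℂ) * Complex.I * α * (phi m (Real.sqrt (m : ℝ) * x) : ℂ))), Finset.prod_filter]
  push_cast
  rw [Finset.mul_sum, Complex.exp_sum]
  refine Finset.prod_congr rfl fun m _ => ?_
  split_ifs with hm
  · rfl
  · simp [phi_of_not_squarefree hm]

end

theorem proposition3 :
    -- the limit of the finite averages
    (∀ (α : ℂ) (M : ℕ), 1 ≤ M →
      Filter.Tendsto (fun X : ℝ => CyganKoranyi.meanM X α M) Filter.atTop
        (nhds (CyganKoranyi.limitM α M))) ∧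
    -- absolute and uniform convergence of the infinite product on compact sets
    (∀ K : Set ℂ, IsCompact K →
      SummableUniformlyOn (fun (m : ℕ) (α : ℂ) => ‖CyganKoranyi.PhiFactor (m + 1) α - 1‖) K ∧
      HasProdUniformlyOn (fun (m : ℕ) (α : ℂ) => CyganKoranyi.PhiFactor (m + 1) α)
        CyganKoranyi.Phi1 K) ∧
    Differentiable ℂ CyganKoranyi.Phi1 ∧
    -- the Fourier transform is a smooth probability density
    MeasureTheory.Integrable (fun σ : ℝ => CyganKoranyi.Phi1 (σ : ℂ)) ∧
    ContDiff ℝ (⊤ : ℕ∞) CyganKoranyi.P1 ∧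
    (∀ x : ℝ, (CyganKoranyi.P1 x).im = 0 ∧ 0 ≤ (CyganKoranyi.P1 x).re) ∧
    MeasureTheory.Integrable CyganKoranyi.P1 ∧
    (∫ x : ℝ, CyganKoranyi.P1 x) = 1 ∧
    -- the two decay estimates, with the same absolute constant `C₁`
    (∃ C₁ c : ℝ, 1 < C₁ ∧ 0 < c ∧
      (∃ R : ℝ, ∀ α : ℂ, R ≤ ‖α‖ →
        ‖CyganKoranyi.Phi1 α‖ ≤
          Real.exp (-(Real.pi ^ 2 / 2) * (C₁⁻¹ * α.re ^ 2 - C₁ * α.im ^ 2) *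
              ‖α‖ ^ (-1 / CyganKoranyi.theta c ‖α‖) * Real.log ‖α‖
            + C₁ * |α.im| * Real.log ‖α‖)) ∧
      (∀ j : ℕ, ∃ x₀ : ℝ, ∀ x : ℝ, x₀ ≤ |x| →
        ‖iteratedDeriv j CyganKoranyi.P1 x‖ ≤
          Real.exp (-(Real.pi / 2) * |x| * Real.exp (Real.pi / (5 * C₁) * |x|)))) := by
  obtain ⟨C₁, R, hC₁, hR⟩ := exists_norm_Phi1_le
  exact ⟨fun α M _ => tendsto_meanM α M,
    fun K hK => ⟨summableUniformlyOn_PhiFactor hK, hasProdUniformlyOn_PhiFactor hK⟩,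
    differentiable_Phi1, integrable_Phi1, contDiff_P1, P1_im_re, integrable_P1, integral_P1,
    C₁, 28, hC₁, by norm_num, ⟨R, hR⟩, norm_iteratedDeriv_P1_le hC₁ hR⟩
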